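/- **Setting.** Let $d\in\{2,3\}$ and $N\ge 1$. Robots $1,\dots,N$ move in a compact workspace $\mathcal W\subset\mathbb R^d$ with an open set $\mathcal O$ of obstacles; $\mathcal W_{\rm free}=\mathcal W\setminus\mathcal O$ is the free workspace, and $\ell_1,\dots,\ell_W\subset\mathbb R^d$ are closed labeled regions. Joint positions $x=(x_1,\dots,x_N)$ are stacked vectors in $\mathbb R^{dN}$ with the Euclidean norm; the initial one is $x_0$. Write $x_i\to_i x_i'$ if the segment $\overline{x_ix_i'}$ lies in $\mathcal W_{\rm free}$ and meets each boundary $\partial\ell_j$ in at most one point, and $x\to x'$ if $x_i\to_i x_i'$ for all $i$. The observation $L(x)$ is the set of atomic propositions true at $x$: "robot $i$ is in $\ell_j$" and "robot $i$ is in no labeled region". Let $\phi$ be an LTL formula without the next operator over these propositions, and $B=(\mathcal Q_B,q_B^0,\to_B,\mathcal Q_B^F)$ a Büchi automaton with finitely many states and one initial state whose language is the set of words that satisfy $\phi$. Put $(x,q)\to_P(x',q')$ if $x\to x'$ and $(q,L(x),q')\in\to_B$. A *feasible plan* is a sequence $\tau=\tau^{\rm pre}[\tau^{\rm suf}]^\omega=\tau(0)\tau(1)\cdots$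 with $\tau(0)=x_0$ and $\tau(k)\to\tau(k+1)$ for all $k$, where the finite sequence $\tau^{\rm suf}$, of length at least $2$, starts and ends at the last position of $\tau^{\rm pre}$; it satisfies $\phi$ if the word $L(\tau(0))L(\tau(1))\cdots$ does. **Algorithm.** TL-RRT$^*$ has parameters $\eta>0$, $\gamma>0$, $w\in[0,1]$ and a steering function with $\|\mathrm{Steer}(x,y)-x\|\le\eta$, $\|\mathrm{Steer}(x,y)-y\|\le\|x-y\|$, and $\mathrm{Steer}(x,y)=y$ if $\|x-y\|\le\eta$. A tree with root $r\in\mathcal W_{\rm free}^N\times\mathcal Q_B$ starts with the single node $r$, of cost $0$. In each iteration, samples $x^{\rm rand}$ are drawn until $x^{\rm new}=\mathrm{Steer}(x^{\rm nearest},x^{\rm rand})$ lies in $\mathcal W_{\rm free}^N$, where $x^{\rm nearest}$ is the position of a node nearest to $x^{\rm rand}$. Let $\mathcal Q^{\rm near}$ consist of all nodes nearest to $x^{\rm rand}$ and all nodes at distance at most $\min\{\gamma(\log n/n)^{1/(dN+1)},\eta\}$ from $x^{\rm new}$, where $n$ is the number of distinct positions in the tree. For each $b\in\mathcal Q_B$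 in turn, if $(x^{\rm new},b)$ is not a node yet and $u\to_P(x^{\rm new},b)$ for some $u\in\mathcal Q^{\rm near}$, then $(x^{\rm new},b)$ is added as a child of such a $u$ for which the cost of $u$ plus the distance is least, with this sum as its cost, and it becomes the parent of those nodes of $\mathcal Q^{\rm near}$ to which it has a transition and whose cost strictly decreases in this way. First, a tree with root $(x_0,q_B^0)$ is grown for $n_{\rm pre}$ iterations; for each of its nodes $v=(x,q)$ with $q\in\mathcal Q_B^F$, the path from the root to $v$ gives a prefix. If $v\to_P v$, the suffix for $v$ is $x,x$. Otherwise a tree with root $v$ is grown for $n_{\rm suf}$ iterations with fresh samples; each of its nodes $u$ with $u\to_P v$ gives a suffix (the path from $v$ to $u$, then $v$), and a shortest one is taken. Among the resulting plans, one that minimizes $w\cdot\mathrm{length}(\tau^{\rm pre})+(1-w)\cdot\mathrm{length}(\tau^{\rm suf})$ is returned, if there is any. **Theorem (probabilistic completeness of TL-RRT$^*$ with unbiased sampling).** Assume: 1. every labeled region has positive Lebesgue measure, and $\mathcal W_{\rm free}$ is contained in the closure of its interior; 2. sampling is unbiased: all draws, for all robots, attempts, iterations and trees, are independent, and robot $i$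 always draws from the same probability distribution $\nu_i$, which is carried by $\mathcal W_{\rm free}$ and satisfies $\nu_i\ge c_i\cdot\mathrm{Lebesgue}$ on $\mathcal W_{\rm free}$ for some $c_i>0$; 3. there is a feasible plan $\tau$ that satisfies $\phi$, with an accepting run $q_0q_1\cdots$ of $B$ over its trace and radii $\delta_k>0$, such that for all $k$ and all $x,y\in\mathcal W_{\rm free}^N$ with $\|x-\tau(k)\|<\delta_k$ and $\|y-\tau(k+1)\|<\delta_{k+1}$: $L(x)=L(\tau(k))$; $(x,q_k)\to_P(y,q_{k+1})$; and every $z\in\overline{xy}$ has $L(z)\in\{L(\tau(k)),L(\tau(k+1))\}$. Then, with probability $1$, for all sufficiently large $n_{\rm pre}$ and $n_{\rm suf}$, TL-RRT$^*$ returns a feasible plan that satisfies $\phi$; and the probability that it does so tends to $1$ as $n_{\rm pre},n_{\rm suf}\to\infty$. -/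

import Mathlib

open MeasureTheory ProbabilityTheory Filter Topology

namespace TLRRT

/-! ### Linear temporal logic without the next operator -/

/-- Formulas of linear temporal logic without the operator "next". -/
inductive LTL (AP : Type*) where
  | tru : LTL AP
  | atom : AP → LTL AP
  | conj : LTL AP → LTL AP → LTL AP
  | neg : LTL AP → LTL AP
  | untl : LTL AP → LTL AP → LTL AP

/-- Satisfaction of a formula by an infinite word over the alphabet `2^AP`. -/
def LTL.Sat {AP : Type*} : LTL AP → (ℕ → Set AP) → Prop
  | .tru, _ => True
  | .atom p, σ => p ∈ σ 0
  | .conj φ ψ, σ => φ.Sat σ ∧ ψ.Sat σ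
  | .neg φ, σ => ¬ φ.Sat σ
  | .untl φ ψ, σ =>
      ∃ j, ψ.Sat (fun k => σ (k + j)) ∧ ∀ i < j, φ.Sat (fun k => σ (k + i))

/-! ### Büchi automata -/

/-- A nondeterministic Büchi automaton over the alphabet `2^AP` with one initial state. -/
structure NBA (Q AP : Type*) where
  init : Q
  trans : Q → Set AP → Q → Prop
  accept : Set Q

/-- `ρ` is an infinite run over `σ` that visits some accepting state infinitely often. -/
def NBA.IsAcceptingRun {Q AP : Type*} (B : NBA Q AP) (σ : ℕ → Set AP) (ρ : ℕ → Q) : Prop :=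
  ρ 0 = B.init ∧ (∀ k, B.trans (ρ k) (σ k) (ρ (k + 1))) ∧
    ∃ q ∈ B.accept, ∃ᶠ k in atTop, ρ k = q

/-- The word `σ` belongs to the language of `B`. -/
def NBA.Accepts {Q AP : Type*} (B : NBA Q AP) (σ : ℕ → Set AP) : Prop :=
  ∃ ρ, B.IsAcceptingRun σ ρ

/-! ### The robots in their workspace -/

/-- Locations of one robot. -/
abbrev Pt (d : ℕ) := EuclideanSpace ℝ (Fin d)

/-- Joint positions of `N` robots: stacked vectors, with the Euclidean norm of the stack. -/
abbrev Pos (d N : ℕ) := PiLp 2 (fun _ : Fin N => Pt d)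

/-- Atomic propositions: `(i, some j)` says that robot `i` is inside region `j`, and `(i, none)`
says that robot `i` is inside no labeled region. -/
abbrev AP (N W : ℕ) := Fin N × Option (Fin W)

/-- A compact workspace with open obstacles, `W` closed labeled regions, and the initial positions
of the `N` robots. -/
structure Scene (d N W : ℕ) where
  workspace : Set (Pt d)
  obstacles : Set (Pt d)
  region : Fin W → Set (Pt d)
  x₀ : Pos d N
  isCompact_workspace : IsCompact workspace
  isOpen_obstacles : IsOpen obstacles
  isClosed_region : ∀ j, IsClosed (region j)

section

variable {d N W : ℕ} {Q : Type*}

/-- The free workspace. -/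
def Scene.free (S : Scene d N W) : Set (Pt d) := S.workspace \ S.obstacles

/-- The joint positions at which every robot is in the free workspace. -/
def Scene.freeN (S : Scene d N W) : Set (Pos d N) := {x | ∀ i, x i ∈ S.free}

/-- The transition relation of one robot: the straight line is inside the free workspace and meets
the boundary of each labeled region at most once. -/
def Scene.Move (S : Scene d N W) (x y : Pt d) : Prop :=
  segment ℝ x y ⊆ S.free ∧ ∀ j, (segment ℝ x y ∩ frontier (S.region j)).Subsingleton

/-- The transition relation of the product transition system. -/
def Scene.MoveN (S : Scene d N W) (x y : Pos d N) : Prop := ∀ i, S.Move (x i) (y i)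

/-- The observation function: the atomic propositions that hold at a joint position. -/
def Scene.label (S : Scene d N W) (x : Pos d N) : Set (AP N W) :=
  {p | (∃ j, p.2 = some j ∧ x p.1 ∈ S.region j) ∨ (p.2 = none ∧ ∀ j, x p.1 ∉ S.region j)}

/-- The transition relation of the product Büchi automaton. -/
def Scene.Step (S : Scene d N W) (B : NBA Q (AP N W)) (u v : Pos d N × Q) : Prop :=
  S.MoveN u.1 v.1 ∧ B.trans u.2 (S.label u.1) v.2

/-! ### Prefix-suffix plans -/

/-- A prefix `τ(1) … τ(K)` and a suffix `τ(K) τ(K+1) … τ(K+S) τ(K+S+1)`. -/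
structure Plan (d N : ℕ) where
  pre : List (Pos d N)
  suf : List (Pos d N)

/-- The infinite sequence of positions obtained by executing the prefix once and then the suffix
indefinitely. -/
noncomputable def Plan.seq (τ : Plan d N) (k : ℕ) : Pos d N :=
  if k < τ.pre.length then τ.pre.getD k 0
  else τ.suf.getD ((k - τ.pre.length) % τ.suf.length) 0

/-- The trace of a plan. -/
noncomputable def Scene.trace (S : Scene d N W) (τ : Plan d N) (k : ℕ) : Set (AP N W) :=
  S.label (τ.seq k)

/-- A feasible plan: the suffix starts and ends where the prefix ends, the plan starts at the
initial positions, and consecutive positions are related by a transition. -/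
def Scene.Feasible (S : Scene d N W) (τ : Plan d N) : Prop :=
  τ.pre ≠ [] ∧ 2 ≤ τ.suf.length ∧
  τ.suf.head? = τ.pre.getLast? ∧ τ.suf.getLast? = τ.pre.getLast? ∧
  τ.seq 0 = S.x₀ ∧ ∀ k, S.MoveN (τ.seq k) (τ.seq (k + 1))

/-- Total Euclidean length of a finite sequence of positions. -/
noncomputable def pathCost (l : List (Pos d N)) : ℝ := (List.zipWith dist l l.tail).sum

/-- The weighted cost of a prefix-suffix plan. -/
noncomputable def Plan.cost (w : ℝ) (τ : Plan d N) : ℝ :=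
  w * pathCost τ.pre + (1 - w) * pathCost τ.suf

/-! ### The assumptions -/

/-- Labeled regions are not negligible. -/
def Scene.NonpointRegions (S : Scene d N W) : Prop := ∀ j, 0 < volume (S.region j)

/-- The free workspace has no lower-dimensional parts. -/
def Scene.SolidFree (S : Scene d N W) : Prop := S.free ⊆ closure (interior S.free)

/-- The neighbourhood condition along the product states `(τ(k), q k)` of a plan. Every waypoint
`τ(k)` has a neighbourhood in the free space where the same observation is made and whose points can
be paired with the same Büchi state `q k`: replacing waypoints by points of their neighbourhoods
again gives a path of the product automaton with the same Büchi states, and on the straight lines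
between such points only the observations of the two waypoints are made. -/
def Scene.ConvergenceSpace (S : Scene d N W) (B : NBA Q (AP N W)) (τ : Plan d N) : Prop :=
  ∃ q : ℕ → Q, B.IsAcceptingRun (S.trace τ) q ∧
    ∃ δ : ℕ → ℝ, (∀ k, 0 < δ k) ∧
      ∀ k, ∀ x ∈ S.freeN, ∀ y ∈ S.freeN,
        dist x (τ.seq k) < δ k → dist y (τ.seq (k + 1)) < δ (k + 1) →
          S.label x = S.trace τ k ∧
          S.Step B (x, q k) (y, q (k + 1)) ∧
          ∀ z ∈ segment ℝ x y, S.label z = S.trace τ k ∨ S.label z = S.trace τ (k + 1)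

/-- Unbiased sampling: `X a n m i` is the location drawn for robot `i` at the `m`-th attempt of
iteration `n` of the `a`-th tree. All draws are independent; robot `i` always uses the same
distribution, which is carried by the free workspace and bounded away from zero on it. -/
structure Scene.UnbiasedSampling (S : Scene d N W) {Ω : Type*} [MeasurableSpace Ω] (μ : Measure Ω)
    (X : ℕ → ℕ → ℕ → Fin N → Ω → Pt d) (ν : Fin N → Measure (Pt d)) : Prop where
  measurable : ∀ a n m i, Measurable (X a n m i)
  indep : iIndepFun (fun (t : ℕ × ℕ × ℕ × Fin N) => X t.1 t.2.1 t.2.2.1 t.2.2.2) μ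
  law : ∀ a n m i, Measure.map (X a n m i) μ = ν i
  carried : ∀ i, ν i S.freeᶜ = 0
  bounded_below : ∀ i, ∃ c : ENNReal, c ≠ 0 ∧
    ∀ s, MeasurableSet s → s ⊆ S.free → c * volume s ≤ ν i s

/-! ### The algorithm -/

/-- User-specified parameters: step size, constant of the connection radius, weight of the prefix
cost, steering function. -/
structure Params (d N : ℕ) where
  η : ℝ
  γ : ℝ
  w : ℝ
  steer : Pos d N → Pos d N → Pos d N

/-- Admissible parameters. The steering function moves by at most `η`, never away from the target,
and reaches a target within distance `η`. -/
structure Params.Valid (A : Params d N) : Prop where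
  η_pos : 0 < A.η
  γ_pos : 0 < A.γ
  w_mem : A.w ∈ Set.Icc (0 : ℝ) 1
  dist_steer_le : ∀ x y, dist x (A.steer x y) ≤ A.η
  steer_closer : ∀ x y, dist (A.steer x y) y ≤ dist x y
  steer_eq : ∀ x y, dist x y ≤ A.η → A.steer x y = y

/-- A tree in the product state space: nodes in the order of their insertion, parents, costs. The
edges are the pairs `(parent v, v)` with `v` a node other than the root. -/
structure SearchTree (d N : ℕ) (Q : Type*) where
  nodes : List (Pos d N × Q)
  parent : Pos d N × Q → Pos d N × Q
  cost : Pos d N × Q → ℝ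

/-- The tree that consists of the root. -/
def SearchTree.root (v : Pos d N × Q) : SearchTree d N Q := ⟨[v], fun _ => v, fun _ => 0⟩

open Classical in
/-- `Nearest`: the nodes whose position is closest to `x`. -/
noncomputable def SearchTree.nearest (T : SearchTree d N Q) (x : Pos d N) :
    List (Pos d N × Q) :=
  T.nodes.filter (fun v => ∀ u ∈ T.nodes, dist x v.1 ≤ dist x u.1)

/-- The new position, obtained by steering from a nearest position to the sample. -/
noncomputable def Params.xNew (A : Params d N) (T : SearchTree d N Q) (x : Pos d N) : Pos d N :=
  match T.nearest x with
  | [] => x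
  | v :: _ => A.steer v.1 x

open Classical in
/-- The connection radius, which depends on the number of distinct positions in the tree. -/
noncomputable def Params.radius (A : Params d N) (T : SearchTree d N Q) : ℝ :=
  let n : ℝ := ((T.nodes.map Prod.fst).toFinset.card : ℝ)
  min (A.γ * (Real.log n / n) ^ (1 / ((d * N : ℕ) + 1 : ℝ))) A.η

open Classical in
/-- The union of `Near` (around the new position) and `Nearest` (around the sample `x`). -/
noncomputable def Params.near (A : Params d N) (T : SearchTree d N Q) (x : Pos d N) :
    List (Pos d N × Q) :=
  T.nodes.filter (fun v => dist v.1 (A.xNew T x) ≤ A.radius T ∨ v ∈ T.nearest x)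

open Classical in
/-- The candidate parent of `v` in the list `l` that gives the smallest cost, with this cost. -/
noncomputable def Scene.bestParent (S : Scene d N W) (B : NBA Q (AP N W)) (T : SearchTree d N Q)
    (l : List (Pos d N × Q)) (v : Pos d N × Q) : Option ((Pos d N × Q) × ℝ) :=
  l.foldl (fun acc u =>
    if S.Step B u v then
      match acc with
      | none => some (u, T.cost u + dist u.1 v.1)
      | some (u', c) =>
        if T.cost u + dist u.1 v.1 ≤ c then some (u, T.cost u + dist u.1 v.1) else some (u', c)
    else acc) none

open Classical in
/-- `Extend`: the tree with `v` added, or `none` if `v` has no candidate parent or already is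
a node. -/
noncomputable def Scene.extend (S : Scene d N W) (B : NBA Q (AP N W)) (T : SearchTree d N Q)
    (l : List (Pos d N × Q)) (v : Pos d N × Q) : Option (SearchTree d N Q) :=
  if v ∈ T.nodes then none
  else (S.bestParent B T l v).map (fun p =>
    ⟨T.nodes ++ [v], Function.update T.parent v p.1, Function.update T.cost v p.2⟩)

open Classical in
/-- `Rewire`: make `v` the parent of those nodes of `l` whose cost decreases in this way. -/
noncomputable def Scene.rewire (S : Scene d N W) (B : NBA Q (AP N W)) (T : SearchTree d N Q)
    (l : List (Pos d N × Q)) (v : Pos d N × Q) : SearchTree d N Q :=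
  l.foldl (fun T u =>
    if S.Step B v u ∧ T.cost v + dist v.1 u.1 < T.cost u then
      ⟨T.nodes, Function.update T.parent u v,
        Function.update T.cost u (T.cost v + dist v.1 u.1)⟩
    else T) T

open Classical in
/-- The nodes on the way from the root `r` to `v`, found by following parents from `v`, at most the
given number of times. -/
noncomputable def SearchTree.pathTo (T : SearchTree d N Q) (r : Pos d N × Q) :
    ℕ → Pos d N × Q → List (Pos d N × Q)
  | 0, v => [v]
  | k + 1, v => if v = r then [v] else T.pathTo r k (T.parent v) ++ [v]

/-- `FindPlan`: the positions on the way from the root `r` to `v` in the tree. -/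
noncomputable def SearchTree.findPlan (T : SearchTree d N Q) (r v : Pos d N × Q) :
    List (Pos d N) :=
  (T.pathTo r T.nodes.length v).map Prod.fst

variable [Fintype Q]

/-- One pass of the loop over the Büchi states, for the sample `x`. -/
noncomputable def Scene.grow (S : Scene d N W) (B : NBA Q (AP N W)) (A : Params d N)
    (T : SearchTree d N Q) (x : Pos d N) : SearchTree d N Q :=
  (Finset.univ.toList : List Q).foldl (fun T' b =>
    match S.extend B T' (A.near T x) (A.xNew T x, b) with
    | none => T'
    | some T'' => S.rewire B T'' (A.near T x) (A.xNew T x, b)) T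

open Classical in
/-- One iteration: samples `s 0, s 1, …` are drawn until the new position is in the free space,
and the tree is grown there. The value is `none` if this never happens. -/
noncomputable def Scene.iteration (S : Scene d N W) (B : NBA Q (AP N W)) (A : Params d N)
    (s : ℕ → Pos d N) (T : SearchTree d N Q) : Option (SearchTree d N Q) :=
  if h : ∃ m, A.xNew T (s m) ∈ S.freeN then some (S.grow B A T (s (Nat.find h))) else none

/-- `ConstructTree`: the tree with a given root after `n` iterations; `s n m` is the sample of
attempt `m` in iteration `n`. The value is `none` if an iteration does not end. -/
noncomputable def Scene.constructTree (S : Scene d N W) (B : NBA Q (AP N W)) (A : Params d N)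
    (s : ℕ → ℕ → Pos d N) (v : Pos d N × Q) : ℕ → Option (SearchTree d N Q)
  | 0 => some (SearchTree.root v)
  | n + 1 => (S.constructTree B A s v n).bind (S.iteration B A (s n))

open Classical in
/-- The suffix plan with root `v`: trivial if `v` has a transition to itself, otherwise the shortest
one among those that close the cycle from a node of the tree rooted at `v`. The value is `none` if
the tree construction does not end, and `some none` if no suffix plan is found. -/
noncomputable def Scene.suffixPlan (S : Scene d N W) (B : NBA Q (AP N W)) (A : Params d N)
    (s : ℕ → ℕ → Pos d N) (v : Pos d N × Q) (n : ℕ) : Option (Option (List (Pos d N))) :=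
  if S.Step B v v then some (some [v.1, v.1])
  else (S.constructTree B A s v n).map (fun T =>
    ((T.nodes.filter (fun u => S.Step B u v)).map
      (fun u => T.findPlan v u ++ [v.1])).argmin pathCost)

open Classical in
/-- The candidate plans: for the `a`-th accepting node of the prefix tree `T`, the prefix plan from
the tree and the suffix plan computed with the samples `s (a + 1)`. -/
noncomputable def Scene.candidates (S : Scene d N W) (B : NBA Q (AP N W)) (A : Params d N)
    (s : ℕ → ℕ → ℕ → Pos d N) (n : ℕ) (T : SearchTree d N Q) :
    List (Option (Option (Plan d N))) :=
  (T.nodes.filter (fun v => v.2 ∈ B.accept)).zipIdx.map (fun va =>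
    (S.suffixPlan B A (s (va.2 + 1)) va.1 n).map
      (Option.map (fun suf => ⟨T.findPlan (S.x₀, B.init) va.1, suf⟩)))

open Classical in
/-- The plan returned with `nPre` iterations for the prefix tree and `nSuf` iterations for each
suffix tree: a candidate of least cost. The value is `none` if some tree construction does not end
or if no plan is found. -/
noncomputable def Scene.tlRRT (S : Scene d N W) (B : NBA Q (AP N W)) (A : Params d N)
    (s : ℕ → ℕ → ℕ → Pos d N) (nPre nSuf : ℕ) : Option (Plan d N) :=
  (S.constructTree B A (s 0) (S.x₀, B.init) nPre).bind (fun T =>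
    if none ∈ S.candidates B A s nSuf T then none
    else (S.candidates B A s nSuf T).reduceOption.reduceOption.argmin (Plan.cost A.w))

/-- With the draws `X` at the outcome `ω`, the algorithm returns a feasible plan that
satisfies `φ`. -/
def Scene.FindsPlan (S : Scene d N W) (φ : LTL (AP N W)) (B : NBA Q (AP N W)) (A : Params d N)
    {Ω : Type*} (X : ℕ → ℕ → ℕ → Fin N → Ω → Pt d) (ω : Ω) (n : ℕ × ℕ) : Prop :=
  ∃ τ, S.tlRRT B A (fun a k m => WithLp.toLp 2 (fun i => X a k m i ω)) n.1 n.2 = some τ ∧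
    S.Feasible τ ∧ φ.Sat (S.trace τ)

end

end TLRRT

/-!
A plan with uniform neighbourhoods of its waypoints can be moved into the interior of the free
space. Between two consecutive waypoints all observations change at a common time, so that the
neighbourhoods are joined by a double cone whose apex is the place of the change. Together the
neighbourhoods and cones form a corridor whose observations are those of the plan. Cut every leg
of the corridor into `2 * M` steps. The observations along these steps stutter those along the
plan, so they still satisfy a formula without the next operator and there is an accepting run over
them. Since there are finitely many waypoints and finitely many ways in which blocks of length
`2 * M` can act on the automaton, the pigeonhole principle closes this run into a lasso, at
waypoints that are the same for infinitely many `M`.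

The steps have length of order `1 / M`, and small boxes around their end points have probability
of order `1 / M ^ (d * N)`. If the number `n` of iterations is of order `M ^ (d * N + 1) * log M`,
with a small constant, then the connection radius `γ * (log n / n) ^ (1 / (d * N + 1))` still
admits the steps, while the boxes along the lasso, of which there are of order `M`, are hit in
their order with probability tending to `1`: this is where the exponent `d * N + 1` matters. Every
box that is hit in its turn adds the next step of the lasso to the tree. As nodes are only ever
appended, a success after `n` iterations persists for all larger `nPre` and `nSuf`.
-/

namespace TLRRT

/-! ### Stuttering -/

/-- The reindexings `f` for which `σ ∘ f` is a stuttering of the word `σ`: they enumerate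
`0, 1, 2, …` in order, with finite repetitions. -/
structure IsStutter (f : ℕ → ℕ) : Prop where
  zero : f 0 = 0
  step : ∀ k, f (k + 1) = f k ∨ f (k + 1) = f k + 1
  unbounded : ∀ n, ∃ k, n ≤ f k

theorem IsStutter.monotone {f : ℕ → ℕ} (hf : IsStutter f) : Monotone f :=
  monotone_nat_of_le_succ fun k => by have := hf.step k; omega

theorem IsStutter.tendsto_atTop {f : ℕ → ℕ} (hf : IsStutter f) : Tendsto f atTop atTop :=
  tendsto_atTop_atTop_of_monotone hf.monotone hf.unbounded

theorem IsStutter.exists_first {f : ℕ → ℕ} (hf : IsStutter f) (n : ℕ) :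
    ∃ k, f k = n ∧ ∀ i < k, f i < n := by
  classical
  have hreach := hf.unbounded n
  have hlt : ∀ i < Nat.find hreach, f i < n := fun i hi => not_le.1 (Nat.find_min hreach hi)
  refine ⟨Nat.find hreach, (Nat.find_spec hreach).antisymm' ?_, hlt⟩
  rcases hk : Nat.find hreach with _ | m
  · simp [hf.zero]
  · have := hlt m (by omega)
    have := hf.step m
    omega

theorem IsStutter.shift {f : ℕ → ℕ} (hf : IsStutter f) (i : ℕ) :
    IsStutter (fun k => f (k + i) - f i) where
  zero := by simp
  step k := by
    have := hf.monotone (Nat.le_add_left i k)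
    have := hf.step (k + i)
    rw [Nat.add_right_comm]
    omega
  unbounded n := by
    obtain ⟨k, hk⟩ := hf.unbounded (n + f i)
    have := hf.monotone (Nat.le_add_right k i)
    exact ⟨k, by omega⟩

theorem isStutter_div {m : ℕ} (hm : 0 < m) : IsStutter (fun k => k / m) where
  zero := Nat.zero_div m
  step k := by rw [Nat.succ_div]; split <;> simp
  unbounded n := ⟨m * n, by simp [hm]⟩

theorem isStutter_count {p : ℕ → Prop} [DecidablePred p] (hp : {k | p k}.Infinite) :
    IsStutter (Nat.count p) where
  zero := Nat.count_zero p
  step k := by rw [Nat.count_succ]; split <;> simp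
  unbounded n := ⟨Nat.nth p n, (Nat.count_nth_of_infinite hp n).ge⟩

theorem LTL.sat_comp_iff {P : Type*} {φ : LTL P} {f : ℕ → ℕ} (hf : IsStutter f)
    (σ : ℕ → Set P) : φ.Sat (fun k => σ (f k)) ↔ φ.Sat σ := by
  induction φ generalizing σ f with
  | tru => rfl
  | atom p => simp only [LTL.Sat, hf.zero]
  | conj φ ψ ihφ ihψ => exact and_congr (ihφ hf σ) (ihψ hf σ)
  | neg φ ih => exact not_congr (ih hf σ)
  | untl φ ψ ihφ ihψ =>
    have suffix_iff {χ : LTL P}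
        (ih : ∀ {g}, IsStutter g → ∀ σ, χ.Sat (fun k => σ (g k)) ↔ χ.Sat σ) (i : ℕ) :
        χ.Sat (fun k => σ (f (k + i))) ↔ χ.Sat (fun k => σ (k + f i)) := by
      simpa only [Nat.sub_add_cancel (hf.monotone (Nat.le_add_left i _))] using
        ih (hf.shift i) (fun k => σ (k + f i))
    simp only [LTL.Sat, suffix_iff ihφ, suffix_iff ihψ]
    constructor
    · rintro ⟨j, hψ, hφ⟩
      refine ⟨f j, hψ, fun n hn => ?_⟩
      obtain ⟨i, rfl, -⟩ := hf.exists_first n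
      exact hφ i (hf.monotone.reflect_lt hn)
    · rintro ⟨n, hψ, hφ⟩
      obtain ⟨j, rfl, hj⟩ := hf.exists_first n
      exact ⟨j, hψ, fun i hi => hφ _ (hj i hi)⟩

theorem exists_path_comp_isStutter {α : Type*} {R : α → α → Prop} {P : ℕ → α}
    (hP : ∀ k, R (P k) (P (k + 1)) ∨ P (k + 1) = P k)
    (hinf : ∃ᶠ k in atTop, R (P k) (P (k + 1))) :
    ∃ ρ f, IsStutter f ∧ P = ρ ∘ f ∧ ∀ n, R (ρ n) (ρ (n + 1)) := by
  classical
  set p : ℕ → Prop := fun k => R (P k) (P (k + 1))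
  have hp : {k | p k}.Infinite := Nat.frequently_atTop_iff_infinite.1 hinf
  have hf := isStutter_count hp
  have factors_of_le {i j : ℕ} (hij : i ≤ j) (h : Nat.count p i = Nat.count p j) : P i = P j := by
    induction j, hij using Nat.le_induction with
    | base => rfl
    | succ j hij ih =>
      have hj : Nat.count p (j + 1) = Nat.count p j := by
        have := hf.monotone hij
        have := hf.step j
        omega
      rw [(hP j).resolve_left (Nat.count_succ_eq_count_iff.1 hj), ih (h.trans hj)]
  have factors {i j : ℕ} (h : Nat.count p i = Nat.count p j) : P i = P j :=
    (le_total i j).elim (factors_of_le · h) fun hji => (factors_of_le hji h.symm).symm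
  refine ⟨P ∘ Nat.nth p, Nat.count p, hf, ?_, fun n => ?_⟩
  · funext k
    exact factors (Nat.count_nth_of_infinite hp _).symm
  · have hnext : P (Nat.nth p (n + 1)) = P (Nat.nth p n + 1) :=
      factors (by rw [Nat.count_nth_of_infinite hp, Nat.count_nth_succ_of_infinite hp])
    simpa only [Function.comp_apply, hnext] using Nat.nth_mem_of_infinite hp n

/-! ### Lassos -/

/-- A path `lp` to `v` and a cycle `ls` through `v`, listed without its last entry `v`. -/
structure IsLasso {α : Type*} (R : α → α → Prop) (v : α) (lp ls : List α) : Prop where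
  chain_pre : lp.IsChain R
  getLast_pre : lp.getLast? = some v
  chain_suf : (ls ++ [v]).IsChain R
  head_suf : ls.head? = some v

/-- The sequence visited by a lasso when, as in `Plan.seq`, `v` is listed at both ends of every copy
of the cycle. -/
def lassoSeq {α : Type*} (v : α) (lp ls : List α) (k : ℕ) : α :=
  if k < lp.length then lp.getD k v else (ls ++ [v]).getD ((k - lp.length) % (ls.length + 1)) v

section

variable {α : Type*} {R : α → α → Prop} {v : α} {lp ls : List α}

theorem IsLasso.length_pre_pos (h : IsLasso R v lp ls) : 0 < lp.length := by
  have := h.getLast_pre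
  cases lp <;> simp_all

theorem IsLasso.length_suf_pos (h : IsLasso R v lp ls) : 0 < ls.length := by
  have := h.head_suf
  cases ls <;> simp_all

theorem IsLasso.lassoSeq_of_mod_eq_zero (h : IsLasso R v lp ls) {k : ℕ} (hk : lp.length ≤ k)
    (h0 : (k - lp.length) % (ls.length + 1) = 0) : lassoSeq v lp ls k = v := by
  have := h.head_suf
  rw [lassoSeq, if_neg hk.not_gt, h0]
  cases ls <;> simp_all

theorem IsLasso.lassoSeq_zero (h : IsLasso R v lp ls) {u : α} (hu : lp.head? = some u) :
    lassoSeq v lp ls 0 = u := by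
  have := h.length_pre_pos
  cases lp <;> simp_all [lassoSeq]

theorem IsLasso.step_suf (h : IsLasso R v lp ls) {k : ℕ} (hk : lp.length ≤ k)
    (hlt : (k - lp.length) % (ls.length + 1) < ls.length) :
    R (lassoSeq v lp ls k) (lassoSeq v lp ls (k + 1)) := by
  have hmod : (k + 1 - lp.length) % (ls.length + 1) =
      (k - lp.length) % (ls.length + 1) + 1 := by
    rw [Nat.sub_add_comm hk, Nat.add_mod, Nat.mod_eq_of_lt (a := 1) (by omega),
      Nat.mod_eq_of_lt (by omega)]
  rw [lassoSeq, lassoSeq, if_neg (by omega), if_neg (by omega), hmod,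
    List.getD_eq_getElem _ _ (by simp; omega), List.getD_eq_getElem _ _ (by simp; omega)]
  exact h.chain_suf.getElem _ _

theorem IsLasso.step_or_eq (h : IsLasso R v lp ls) (k : ℕ) :
    R (lassoSeq v lp ls k) (lassoSeq v lp ls (k + 1)) ∨
      lassoSeq v lp ls (k + 1) = lassoSeq v lp ls k := by
  have hlast := h.getLast_pre
  rcases lt_trichotomy (k + 1) lp.length with hk | hk | hk
  · left
    rw [lassoSeq, lassoSeq, if_pos hk, if_pos (by omega), List.getD_eq_getElem _ _ hk,
      List.getD_eq_getElem _ _ (by omega)]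
    exact h.chain_pre.getElem _ hk
  · right
    rw [h.lassoSeq_of_mod_eq_zero hk.ge (by simp [hk]), lassoSeq, if_pos (by omega)]
    rw [List.getLast?_eq_getElem?, ← hk, Nat.add_sub_cancel] at hlast
    simp [List.getD, hlast]
  · have hlt := Nat.mod_lt (k - lp.length) ls.length.succ_pos
    rcases (Nat.lt_succ_iff.1 hlt).lt_or_eq with hlt | heq
    · exact .inl (h.step_suf (by omega) hlt)
    · right
      rw [h.lassoSeq_of_mod_eq_zero (by omega), lassoSeq, if_neg (by omega), heq]
      · simp [List.getD]
      · rw [Nat.sub_add_comm (by omega), Nat.succ_mod_succ_eq_zero_iff.2 heq]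

theorem IsLasso.tendsto_cycle (h : IsLasso R v lp ls) :
    Tendsto (fun n => lp.length + (ls.length + 1) * n) atTop atTop ∧
      ∀ n, lassoSeq v lp ls (lp.length + (ls.length + 1) * n) = v :=
  ⟨tendsto_atTop_mono (fun n => by dsimp only [id]; nlinarith) tendsto_id,
    fun n => h.lassoSeq_of_mod_eq_zero (by omega) (by simp)⟩

theorem IsLasso.frequently_step (h : IsLasso R v lp ls) :
    ∃ᶠ k in atTop, R (lassoSeq v lp ls k) (lassoSeq v lp ls (k + 1)) :=
  h.tendsto_cycle.1.frequently <| .of_forall fun n =>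
    h.step_suf (by omega) (by simpa using h.length_suf_pos)

theorem IsLasso.frequently_eq (h : IsLasso R v lp ls) :
    ∃ᶠ k in atTop, lassoSeq v lp ls k = v :=
  h.tendsto_cycle.1.frequently <| .of_forall h.tendsto_cycle.2

end

section

variable {d N W : ℕ} {Q : Type*} {S : Scene d N W} {B : NBA Q (AP N W)}

theorem Scene.Move.left_mem {x y : Pt d} (h : S.Move x y) : x ∈ S.free :=
  h.1 (left_mem_segment ℝ x y)

theorem Scene.Move.right_mem {x y : Pt d} (h : S.Move x y) : y ∈ S.free :=
  h.1 (right_mem_segment ℝ x y)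

theorem Scene.Move.symm {x y : Pt d} (h : S.Move x y) : S.Move y x := by
  rwa [Scene.Move, segment_symm]

theorem Scene.MoveN.left_mem {x y : Pos d N} (h : S.MoveN x y) : x ∈ S.freeN :=
  fun i => (h i).left_mem

theorem Scene.MoveN.right_mem {x y : Pos d N} (h : S.MoveN x y) : y ∈ S.freeN :=
  fun i => (h i).right_mem

theorem Scene.MoveN.symm {x y : Pos d N} (h : S.MoveN x y) : S.MoveN y x :=
  fun i => (h i).symm

theorem Scene.moveN_self {x : Pos d N} (h : x ∈ S.freeN) : S.MoveN x x := fun i =>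
  ⟨by simpa only [segment_same, Set.singleton_subset_iff] using h i, fun j => by
    rw [segment_same]
    exact Set.subsingleton_singleton.anti Set.inter_subset_left⟩

/-- The plan that executes `lp` and then the cycle `ls` back to `v`. -/
def lassoPlan (v : Pos d N × Q) (lp ls : List (Pos d N × Q)) : Plan d N :=
  ⟨lp.map Prod.fst, ls.map Prod.fst ++ [v.1]⟩

theorem seq_lassoPlan (v : Pos d N × Q) (lp ls : List (Pos d N × Q)) (k : ℕ) :
    (lassoPlan v lp ls).seq k = (lassoSeq v lp ls k).1 := by
  have hlen : (ls.map Prod.fst ++ [v.1]).length = ls.length + 1 := by simp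
  have hmod : (k - lp.length) % (ls.length + 1) < ls.length + 1 := Nat.mod_lt _ (Nat.succ_pos _)
  rw [Plan.seq, lassoPlan, lassoSeq, List.length_map, hlen]
  split_ifs with hk
  · rw [List.getD_eq_getElem _ _ (by simpa using hk), List.getD_eq_getElem _ _ hk, List.getElem_map]
  · rw [List.getD_eq_getElem _ _ (hlen ▸ hmod), List.getD_eq_getElem _ _ (by simpa using hmod)]
    simp only [List.getElem_append, List.length_map, List.getElem_map, List.getElem_singleton]
    split_ifs <;> rfl

variable {v : Pos d N × Q} {lp ls : List (Pos d N × Q)}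

theorem IsLasso.feasible (h : IsLasso (S.Step B) v lp ls)
    (h0 : lp.head? = some (S.x₀, B.init)) : S.Feasible (lassoPlan v lp ls) := by
  obtain ⟨ρ, f, hf, hρ, hstep⟩ := exists_path_comp_isStutter h.step_or_eq h.frequently_step
  refine ⟨?_, ?_, ?_, ?_, ?_, fun k => ?_⟩
  · simpa [lassoPlan] using List.ne_nil_of_length_pos h.length_pre_pos
  · simpa [lassoPlan] using Nat.succ_le_of_lt h.length_suf_pos
  · simp [lassoPlan, List.head?_append, h.head_suf, h.getLast_pre]
  · simp [lassoPlan, h.getLast_pre]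
  · rw [seq_lassoPlan, h.lassoSeq_zero h0]
  · simp only [seq_lassoPlan, hρ, Function.comp_apply]
    rcases hf.step k with heq | hsucc
    · rw [heq]
      exact Scene.moveN_self (hstep _).1.left_mem
    · rw [hsucc]
      exact (hstep _).1

theorem IsLasso.sat (h : IsLasso (S.Step B) v lp ls) (h0 : lp.head? = some (S.x₀, B.init))
    (hv : v.2 ∈ B.accept) {φ : LTL (AP N W)} (hB : ∀ σ, B.Accepts σ ↔ φ.Sat σ) :
    φ.Sat (S.trace (lassoPlan v lp ls)) := by
  obtain ⟨ρ, f, hf, hρ, hstep⟩ := exists_path_comp_isStutter h.step_or_eq h.frequently_step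
  have htrace : S.trace (lassoPlan v lp ls) = fun k => S.label (ρ (f k)).1 := by
    funext k
    rw [Scene.trace, seq_lassoPlan, hρ, Function.comp_apply]
  rw [htrace, LTL.sat_comp_iff hf (fun n => S.label (ρ n).1), ← hB]
  refine ⟨fun n => (ρ n).2, ?_, fun n => (hstep n).2, v.2, hv, ?_⟩
  · have := h.lassoSeq_zero h0
    rw [hρ, Function.comp_apply, hf.zero] at this
    simp only [this]
  · refine hf.tendsto_atTop.frequently (h.frequently_eq.mono fun k hk => ?_)
    rw [hρ, Function.comp_apply] at hk
    simp only [hk]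

end

/-! ### Search trees -/

theorem foldl_of_mem {α β : Type*} {f : β → α → β} {P : β → Prop} {l : List α} {a : α}
    (hkeep : ∀ b a, P b → P (f b a)) (ha : a ∈ l) (hset : ∀ b, P (f b a)) (b : β) :
    P (l.foldl f b) := by
  obtain ⟨l₁, l₂, rfl⟩ := List.append_of_mem ha
  rw [List.foldl_append, List.foldl_cons]
  exact List.foldlRecOn l₂ f (hset _) fun b hb a _ => hkeep b a hb

section

variable {d N W : ℕ} {Q : Type*} {S : Scene d N W} {B : NBA Q (AP N W)} {r : Pos d N × Q}
  {T : SearchTree d N Q}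

/-- `T` is a tree with root `r` whose edges are transitions and along whose branches the cost does
not decrease. -/
structure IsTree (S : Scene d N W) (B : NBA Q (AP N W)) (r : Pos d N × Q)
    (T : SearchTree d N Q) : Prop where
  root_mem : r ∈ T.nodes
  mem_freeN : ∀ v ∈ T.nodes, v.1 ∈ S.freeN
  cost_root_le : ∀ v ∈ T.nodes, T.cost r ≤ T.cost v
  parent_mem : ∀ v ∈ T.nodes, v ≠ r → T.parent v ∈ T.nodes
  step_parent : ∀ v ∈ T.nodes, v ≠ r → S.Step B (T.parent v) v
  cost_parent_le : ∀ v ∈ T.nodes, v ≠ r → T.cost (T.parent v) ≤ T.cost v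
  iterate_parent : ∀ v ∈ T.nodes, ∃ k, T.parent^[k] v = r

theorem isTree_root (hr : r.1 ∈ S.freeN) : IsTree S B r (SearchTree.root r) := by
  constructor <;> simp only [SearchTree.root, List.mem_singleton, forall_eq, hr, le_rfl, ne_eq,
    not_true_eq_false, false_implies]
  exact ⟨0, rfl⟩

-- Costs do not decrease along branches, so making `v` cheaper than before, but not cheaper than its
-- new parent `u`, cannot close a cycle: `v` is not on the branch from the root to `u`.
open Classical in
theorem IsTree.exists_iterate_update (h : IsTree S B r T) {u v : Pos d N × Q} {c : ℝ}
    (hu : u ∈ T.nodes) (huc : T.cost u ≤ c) (hc : v ∈ T.nodes → c < T.cost v) :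
    ∀ w, w ∈ T.nodes ∨ w = v → ∃ k, (Function.update T.parent v u)^[k] w = r := by
  set p := Function.update T.parent v u
  have hpv : p v = u := Function.update_self ..
  have hp {w : Pos d N × Q} (hwv : w ≠ v) : p w = T.parent w := Function.update_of_ne hwv ..
  have of_parent {w : Pos d N × Q} (hw : ∃ k, p^[k] (p w) = r) : ∃ k, p^[k] w = r :=
    hw.imp' Nat.succ fun _ => id
  have cheap (k : ℕ) : ∀ w ∈ T.nodes, T.cost w ≤ T.cost u → T.parent^[k] w = r →
      ∃ k, p^[k] w = r := by
    induction k with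
    | zero => exact fun w _ _ hwr => ⟨0, hwr⟩
    | succ k ih =>
      intro w hw hwu hk
      rcases eq_or_ne w r with rfl | hwr
      · exact ⟨0, rfl⟩
      have hwv : w ≠ v := fun hwv => by subst hwv; linarith [hc hw]
      refine of_parent ?_
      rw [hp hwv]
      exact ih _ (h.parent_mem w hw hwr) ((h.cost_parent_le w hw hwr).trans hwu) hk
  have hv : ∃ k, p^[k] v = r := by
    obtain ⟨k, hk⟩ := h.iterate_parent u hu
    refine of_parent ?_
    rw [hpv]
    exact cheap k u hu le_rfl hk
  have all (k : ℕ) : ∀ w ∈ T.nodes, T.parent^[k] w = r → ∃ k, p^[k] w = r := by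
    induction k with
    | zero => exact fun w _ hwr => ⟨0, hwr⟩
    | succ k ih =>
      intro w hw hk
      rcases eq_or_ne w r with rfl | hwr
      · exact ⟨0, rfl⟩
      rcases eq_or_ne w v with rfl | hwv
      · exact hv
      refine of_parent ?_
      rw [hp hwv]
      exact ih _ (h.parent_mem w hw hwr) hk
  rintro w (hw | rfl)
  · obtain ⟨k, hk⟩ := h.iterate_parent w hw
    exact all k w hw hk
  · exact hv

open Classical in
theorem IsTree.attach (h : IsTree S B r T) {u v : Pos d N × Q} {c : ℝ}
    {nodes : List (Pos d N × Q)} (hnodes : ∀ w, w ∈ nodes ↔ w ∈ T.nodes ∨ w = v)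
    (hu : u ∈ T.nodes) (huv : S.Step B u v) (huc : T.cost u ≤ c)
    (hc : v ∈ T.nodes → c < T.cost v) :
    IsTree S B r ⟨nodes, Function.update T.parent v u, Function.update T.cost v c⟩ := by
  have hne {w : Pos d N × Q} (hw : w ∈ T.nodes) (hwu : T.cost w ≤ T.cost u) : w ≠ v := by
    rintro rfl
    linarith [hc hw]
  have hvr : v ≠ r := (hne h.root_mem (h.cost_root_le u hu)).symm
  have hle (w : Pos d N × Q) (hw : w ∈ T.nodes) : Function.update T.cost v c w ≤ T.cost w := by
    rcases eq_or_ne w v with rfl | hwv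
    · simpa using (hc hw).le
    · simp [hwv]
  have of_mem {P : Pos d N × Q → Prop} (hv : P v) (hold : ∀ w ∈ T.nodes, w ≠ v → P w) :
      ∀ w ∈ nodes, P w := fun w hw => by
    by_cases hwv : w = v
    · exact hwv ▸ hv
    · exact hold w (((hnodes w).1 hw).resolve_right hwv) hwv
  constructor <;> dsimp only
  · exact (hnodes r).2 (.inl h.root_mem)
  · exact of_mem huv.1.right_mem fun w hw _ => h.mem_freeN w hw
  · rw [Function.update_of_ne hvr.symm]
    refine of_mem ?_ fun w hw hwv => ?_
    · simpa using (h.cost_root_le u hu).trans huc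
    · simpa [hwv] using h.cost_root_le w hw
  · refine of_mem (fun _ => ?_) fun w hw hwv hwr => ?_
    · simpa using (hnodes u).2 (.inl hu)
    · simpa [hwv] using (hnodes _).2 (.inl (h.parent_mem w hw hwr))
  · refine of_mem (fun _ => ?_) fun w hw hwv hwr => ?_
    · simpa using huv
    · simpa [hwv] using h.step_parent w hw hwr
  · refine of_mem (fun _ => ?_) fun w hw hwv hwr => ?_
    · simpa [hne hu le_rfl] using huc
    · rw [Function.update_of_ne hwv, Function.update_of_ne hwv]
      exact (hle _ (h.parent_mem w hw hwr)).trans (h.cost_parent_le w hw hwr)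
  · exact fun w hw => h.exists_iterate_update hu huc hc w ((hnodes w).1 hw)

theorem IsTree.exists_iterate_lt_length (h : IsTree S B r T) {v : Pos d N × Q}
    (hv : v ∈ T.nodes) : ∃ k < T.nodes.length, T.parent^[k] v = r := by
  classical
  have hex := h.iterate_parent v hv
  set k := Nat.find hex
  have hk : T.parent^[k] v = r := Nat.find_spec hex
  have hmem : ∀ i ≤ k, T.parent^[i] v ∈ T.nodes := by
    intro i
    induction i with
    | zero => exact fun _ => hv
    | succ i ih =>
      intro hi
      rw [Function.iterate_succ_apply']
      exact h.parent_mem _ (ih (by omega)) (Nat.find_min hex (m := i) (by omega))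
  have hne {i j : ℕ} (hij : i < j) (hj : j ≤ k) : T.parent^[i] v ≠ T.parent^[j] v := by
    intro heq
    refine Nat.find_min hex (m := k - j + i) (by omega) ?_
    rw [Function.iterate_add_apply, heq, ← Function.iterate_add_apply, Nat.sub_add_cancel hj, hk]
  have hinj : Set.InjOn (fun i => T.parent^[i] v) (Finset.range (k + 1)) := by
    intro i hi j hj heq
    rw [Finset.mem_coe, Finset.mem_range] at hi hj
    by_contra hij
    rcases Nat.lt_or_gt_of_ne hij with hij | hij
    · exact hne hij (by omega) heq
    · exact hne hij (by omega) heq.symm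
  have hcard := Finset.card_le_card_of_injOn (t := T.nodes.toFinset) _ (fun i hi => by
    simpa using hmem i (by simpa [Nat.lt_succ_iff] using hi)) hinj
  rw [Finset.card_range] at hcard
  exact ⟨k, hcard.trans T.nodes.toFinset_card_le, hk⟩

theorem IsTree.pathTo_of_iterate (h : IsTree S B r T) {k fuel : ℕ} (hfuel : k ≤ fuel)
    {v : Pos d N × Q} (hv : v ∈ T.nodes) (hk : T.parent^[k] v = r) :
    (T.pathTo r fuel v).IsChain (S.Step B) ∧ (T.pathTo r fuel v).head? = some r ∧
      (T.pathTo r fuel v).getLast? = some v := by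
  induction fuel generalizing k v with
  | zero =>
    obtain rfl := Nat.le_zero.1 hfuel
    obtain rfl : v = r := hk
    simp [SearchTree.pathTo]
  | succ fuel ih =>
    rcases eq_or_ne v r with rfl | hvr
    · simp [SearchTree.pathTo]
    obtain ⟨k, rfl⟩ : ∃ j, k = j + 1 :=
      Nat.exists_eq_succ_of_ne_zero (by rintro rfl; exact hvr hk)
    obtain ⟨hchain, hhead, hlast⟩ := ih (Nat.le_of_succ_le_succ hfuel) (h.parent_mem v hv hvr) hk
    simp only [SearchTree.pathTo, if_neg hvr]
    refine ⟨List.isChain_append.2 ⟨hchain, List.isChain_singleton v, ?_⟩, by simp [hhead], by simp⟩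
    simpa [hlast] using h.step_parent v hv hvr

theorem IsTree.pathTo (h : IsTree S B r T) {v : Pos d N × Q} (hv : v ∈ T.nodes) :
    (T.pathTo r T.nodes.length v).IsChain (S.Step B) ∧
      (T.pathTo r T.nodes.length v).head? = some r ∧
      (T.pathTo r T.nodes.length v).getLast? = some v := by
  obtain ⟨k, hk, hkr⟩ := h.exists_iterate_lt_length hv
  exact h.pathTo_of_iterate hk.le hv hkr

/-! ### Extending and rewiring -/

theorem Scene.nodes_rewire (l : List (Pos d N × Q)) (v : Pos d N × Q) :
    (S.rewire B T l v).nodes = T.nodes :=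
  List.foldlRecOn (motive := fun T' : SearchTree d N Q => T'.nodes = T.nodes) l _ rfl
    fun T' hT' u _ => by split_ifs <;> exact hT'

theorem IsTree.rewire (h : IsTree S B r T) {l : List (Pos d N × Q)} {v : Pos d N × Q}
    (hv : v ∈ T.nodes) (hl : l ⊆ T.nodes) : IsTree S B r (S.rewire B T l v) := by
  refine (List.foldlRecOn (motive := fun T' => IsTree S B r T' ∧ T'.nodes = T.nodes) l _ ⟨h, rfl⟩
    fun T' ⟨hT', hnodes⟩ u hul => ?_).1
  have hu : u ∈ T'.nodes := hnodes ▸ hl hul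
  split_ifs with hc
  · refine ⟨hT'.attach (fun w => ?_) (hnodes ▸ hv) hc.1 (le_add_of_nonneg_right dist_nonneg)
      fun _ => hc.2, hnodes⟩
    exact ⟨.inl, fun hw => hw.elim id (· ▸ hu)⟩
  · exact ⟨hT', hnodes⟩

theorem Scene.bestParent_eq_some {l : List (Pos d N × Q)} {v : Pos d N × Q}
    {p : (Pos d N × Q) × ℝ} (h : S.bestParent B T l v = some p) :
    p.1 ∈ l ∧ S.Step B p.1 v ∧ p.2 = T.cost p.1 + dist p.1.1 v.1 := by
  refine List.foldlRecOn (motive := fun acc => ∀ p, acc = some p →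
    p.1 ∈ l ∧ S.Step B p.1 v ∧ p.2 = T.cost p.1 + dist p.1.1 v.1) l _ (by simp) ?_ p h
  intro acc hacc u hu p hp
  split_ifs at hp with hstep
  · rcases acc with _ | ⟨u', c⟩
    · cases hp
      exact ⟨hu, hstep, rfl⟩
    · dsimp only at hp
      split_ifs at hp
      · cases hp
        exact ⟨hu, hstep, rfl⟩
      · exact hacc p hp
  · exact hacc p hp

theorem Scene.isSome_bestParent {l : List (Pos d N × Q)} {u v : Pos d N × Q} (hu : u ∈ l)
    (h : S.Step B u v) : (S.bestParent B T l v).isSome := by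
  refine foldl_of_mem (P := fun acc : Option ((Pos d N × Q) × ℝ) => acc.isSome = true)
    (fun acc w hacc => ?_) hu (fun acc => ?_) _
  · rcases acc with _ | ⟨u', c⟩
    · simp at hacc
    · dsimp only
      split_ifs <;> rfl
  · rw [if_pos h]
    rcases acc with _ | ⟨u', c⟩
    · rfl
    · dsimp only
      split_ifs <;> rfl

/-- The body of the loop in `Scene.grow`: `Extend` followed by `Rewire`. -/
noncomputable def Scene.insertNode (S : Scene d N W) (B : NBA Q (AP N W))
    (l : List (Pos d N × Q)) (T : SearchTree d N Q) (v : Pos d N × Q) : SearchTree d N Q :=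
  match S.extend B T l v with
  | none => T
  | some T' => S.rewire B T' l v

theorem Scene.nodes_insertNode (l : List (Pos d N × Q)) (v : Pos d N × Q) :
    (S.insertNode B l T v).nodes = T.nodes ∨ (S.insertNode B l T v).nodes = T.nodes ++ [v] := by
  unfold Scene.insertNode Scene.extend
  by_cases hv : v ∈ T.nodes
  · simp [hv]
  · rcases S.bestParent B T l v with _ | p <;> simp [hv, Scene.nodes_rewire]

theorem Scene.subset_insertNode (l : List (Pos d N × Q)) (v : Pos d N × Q) :
    T.nodes ⊆ (S.insertNode B l T v).nodes := by
  rcases Scene.nodes_insertNode (S := S) (B := B) (T := T) l v with h | h <;> simp [h]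

theorem Scene.mem_insertNode {l : List (Pos d N × Q)} {u v : Pos d N × Q} (hu : u ∈ l)
    (h : S.Step B u v) : v ∈ (S.insertNode B l T v).nodes := by
  unfold Scene.insertNode Scene.extend
  by_cases hv : v ∈ T.nodes
  · simp [hv]
  · obtain ⟨p, hp⟩ := Option.isSome_iff_exists.1 (Scene.isSome_bestParent (T := T) hu h)
    simp [hv, hp, Scene.nodes_rewire]

theorem IsTree.insertNode (h : IsTree S B r T) {l : List (Pos d N × Q)} (hl : l ⊆ T.nodes)
    (v : Pos d N × Q) : IsTree S B r (S.insertNode B l T v) := by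
  unfold Scene.insertNode Scene.extend
  by_cases hv : v ∈ T.nodes
  · simpa [hv] using h
  · rcases hbest : S.bestParent B T l v with _ | p
    · simpa [hv] using h
    · obtain ⟨hp, hstep, hcost⟩ := Scene.bestParent_eq_some hbest
      simp only [hv, if_false, Option.map_some]
      refine IsTree.rewire (h.attach (by simp) (hl hp) hstep ?_ (absurd · hv)) (by simp)
        fun u hu => by simp [hl hu]
      exact hcost ▸ le_add_of_nonneg_right dist_nonneg

/-! ### Growing -/

variable {A : Params d N}

theorem Params.near_subset (A : Params d N) (T : SearchTree d N Q) (x : Pos d N) :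
    A.near T x ⊆ T.nodes :=
  fun _ hu => (List.mem_filter.1 hu).1

variable [Fintype Q]

theorem Scene.grow_eq_foldl (x : Pos d N) : S.grow B A T x =
    (Finset.univ.toList : List Q).foldl
      (fun T' b => S.insertNode B (A.near T x) T' (A.xNew T x, b)) T := rfl

theorem Scene.nodes_grow (x : Pos d N) :
    ∃ l, (S.grow B A T x).nodes = T.nodes ++ l ∧ l.length ≤ Fintype.card Q ∧
      ∀ u ∈ l, u.1 = A.xNew T x := by
  have foldl_nodes (near : List (Pos d N × Q)) (y : Pos d N) (bs : List Q) :
      ∃ l, (bs.foldl (fun T' b => S.insertNode B near T' (y, b)) T).nodes = T.nodes ++ l ∧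
        l.length ≤ bs.length ∧ ∀ u ∈ l, u.1 = y := by
    induction bs using List.reverseRecOn with
    | nil => exact ⟨[], by simp⟩
    | append_singleton bs b ih =>
      obtain ⟨l, hnodes, hlen, hl⟩ := ih
      rw [List.foldl_concat]
      rcases Scene.nodes_insertNode (S := S) (B := B) near (y, b) with h | h
      · exact ⟨l, by rw [h, hnodes], by simp; omega, hl⟩
      · refine ⟨l ++ [(y, b)], by rw [h, hnodes, List.append_assoc], by simpa using hlen, ?_⟩
        simpa [or_imp, forall_and] using hl
  simpa [Scene.grow_eq_foldl] using
    foldl_nodes (A.near T x) (A.xNew T x) (Finset.univ.toList : List Q)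

theorem IsTree.grow (h : IsTree S B r T) (x : Pos d N) : IsTree S B r (S.grow B A T x) := by
  rw [Scene.grow_eq_foldl]
  exact (List.foldlRecOn (motive := fun T' => IsTree S B r T' ∧ A.near T x ⊆ T'.nodes) _ _
    ⟨h, A.near_subset T x⟩ fun T' hT' b _ =>
      ⟨hT'.1.insertNode hT'.2 _, fun _ hu => Scene.subset_insertNode _ _ (hT'.2 hu)⟩).1

theorem Scene.mem_grow {x : Pos d N} {b : Q} {u : Pos d N × Q} (hu : u ∈ A.near T x)
    (h : S.Step B u (A.xNew T x, b)) : (A.xNew T x, b) ∈ (S.grow B A T x).nodes := by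
  rw [Scene.grow_eq_foldl]
  exact foldl_of_mem (P := fun T' => (A.xNew T x, b) ∈ T'.nodes)
    (fun T' c hT' => Scene.subset_insertNode _ _ hT') (Finset.mem_toList.2 (Finset.mem_univ b))
    (fun T' => Scene.mem_insertNode hu h) T

theorem Scene.exists_of_iteration_eq_some {s : ℕ → Pos d N} {T' : SearchTree d N Q}
    (h : S.iteration B A s T = some T') : ∃ m, T' = S.grow B A T (s m) := by
  classical
  unfold Scene.iteration at h
  split_ifs at h with hex
  exact ⟨Nat.find hex, (Option.some.inj h).symm⟩

theorem Scene.constructTree_succ_eq_some {s : ℕ → ℕ → Pos d N} {n : ℕ}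
    (h : S.constructTree B A s r (n + 1) = some T) :
    ∃ T₀ x, S.constructTree B A s r n = some T₀ ∧ T = S.grow B A T₀ x := by
  obtain ⟨T₀, hT₀, hiter⟩ := Option.bind_eq_some_iff.1 h
  obtain ⟨m, hm⟩ := Scene.exists_of_iteration_eq_some hiter
  exact ⟨T₀, s n m, hT₀, hm⟩

theorem isTree_of_constructTree {s : ℕ → ℕ → Pos d N} (hr : r.1 ∈ S.freeN) {n : ℕ}
    (h : S.constructTree B A s r n = some T) : IsTree S B r T := by
  induction n generalizing T with
  | zero => exact Option.some.inj h ▸ isTree_root hr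
  | succ n ih =>
    obtain ⟨T₀, x, hT₀, rfl⟩ := Scene.constructTree_succ_eq_some h
    exact (ih hT₀).grow x

theorem Scene.length_constructTree_le {s : ℕ → ℕ → Pos d N} {n : ℕ}
    (h : S.constructTree B A s r n = some T) : T.nodes.length ≤ 1 + Fintype.card Q * n := by
  induction n generalizing T with
  | zero => simp [← Option.some.inj h, SearchTree.root]
  | succ n ih =>
    obtain ⟨T₀, x, hT₀, rfl⟩ := Scene.constructTree_succ_eq_some h
    obtain ⟨l, hnodes, hlen, -⟩ := Scene.nodes_grow (S := S) (B := B) (A := A) (T := T₀) x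
    have := ih hT₀
    rw [hnodes, List.length_append, Nat.mul_succ]
    omega

open Classical in
/-- The number of distinct positions in a tree, on which the connection radius depends. -/
noncomputable def SearchTree.numPos (T : SearchTree d N Q) : ℕ :=
  (T.nodes.map Prod.fst).toFinset.card

theorem Scene.numPos_constructTree_le {s : ℕ → ℕ → Pos d N} {n : ℕ}
    (h : S.constructTree B A s r n = some T) : T.numPos ≤ n + 1 := by
  classical
  induction n generalizing T with
  | zero => simp [← Option.some.inj h, SearchTree.root, SearchTree.numPos]
  | succ n ih =>
    obtain ⟨T₀, x, hT₀, rfl⟩ := Scene.constructTree_succ_eq_some h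
    obtain ⟨l, hnodes, -, hl⟩ := Scene.nodes_grow (S := S) (B := B) (A := A) (T := T₀) x
    have hsub : ((S.grow B A T₀ x).nodes.map Prod.fst).toFinset ⊆
        insert (A.xNew T₀ x) (T₀.nodes.map Prod.fst).toFinset := by
      intro y hy
      rw [hnodes, List.map_append, List.toFinset_append, Finset.mem_union] at hy
      refine Finset.mem_insert.2 (hy.symm.imp_left fun hy => ?_)
      obtain ⟨u, hu, rfl⟩ := List.mem_map.1 (List.mem_toFinset.1 hy)
      exact hl u hu
    exact ((Finset.card_le_card hsub).trans (Finset.card_insert_le _ _)).trans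
      (Nat.succ_le_succ (ih hT₀))

theorem Scene.isPrefix_constructTree {s : ℕ → ℕ → Pos d N} {n n' : ℕ} (hn : n ≤ n')
    {T' : SearchTree d N Q} (h : S.constructTree B A s r n = some T)
    (h' : S.constructTree B A s r n' = some T') : T.nodes <+: T'.nodes := by
  induction n', hn using Nat.le_induction generalizing T' with
  | base => exact Option.some.inj (h.symm.trans h') ▸ List.prefix_rfl
  | succ n' _ ih =>
    obtain ⟨T₀, x, hT₀, rfl⟩ := Scene.constructTree_succ_eq_some h'
    obtain ⟨l, hnodes, -⟩ := Scene.nodes_grow (S := S) (B := B) (A := A) (T := T₀) x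
    exact (ih hT₀).trans ⟨l, hnodes.symm⟩

/-! ### Soundness -/

theorem Scene.suffixPlan_eq_some_some {s : ℕ → ℕ → Pos d N} {v : Pos d N × Q} {n : ℕ}
    {suf : List (Pos d N)} (hv : v.1 ∈ S.freeN) (h : S.suffixPlan B A s v n = some (some suf)) :
    ∃ ls : List (Pos d N × Q), suf = ls.map Prod.fst ++ [v.1] ∧ (ls ++ [v]).IsChain (S.Step B) ∧
      ls.head? = some v := by
  unfold Scene.suffixPlan at h
  split_ifs at h with hvv
  · exact ⟨[v], by simpa using h.symm, by simpa using hvv, rfl⟩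
  · obtain ⟨T, hT, h⟩ := Option.map_eq_some_iff.1 h
    obtain ⟨u, hu, rfl⟩ := List.mem_map.1 (List.argmin_mem h)
    obtain ⟨hu, huv⟩ := List.mem_filter.1 hu
    obtain ⟨hchain, hhead, hlast⟩ := (isTree_of_constructTree hv hT).pathTo hu
    exact ⟨T.pathTo v T.nodes.length u, rfl,
      List.isChain_append.2 ⟨hchain, List.isChain_singleton v, by simpa [hlast] using huv⟩, hhead⟩

theorem Scene.feasible_and_sat_of_mem_candidates {φ : LTL (AP N W)}
    (hB : ∀ σ, B.Accepts σ ↔ φ.Sat σ) {s : ℕ → ℕ → ℕ → Pos d N} {n : ℕ}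
    (hT : IsTree S B (S.x₀, B.init) T) {τ : Plan d N}
    (h : some (some τ) ∈ S.candidates B A s n T) : S.Feasible τ ∧ φ.Sat (S.trace τ) := by
  obtain ⟨⟨v, a⟩, hva, h⟩ := List.mem_map.1 h
  obtain ⟨hv, hacc⟩ := List.mem_filter.1 (List.fst_mem_of_mem_zipIdx hva)
  obtain ⟨_, ho, h⟩ := Option.map_eq_some_iff.1 h
  obtain ⟨suf, rfl, rfl⟩ := Option.map_eq_some_iff.1 h
  obtain ⟨ls, rfl, hchain, hhead⟩ := Scene.suffixPlan_eq_some_some (hT.mem_freeN v hv) ho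
  obtain ⟨hpre, hroot, hlast⟩ := hT.pathTo hv
  have hlasso : IsLasso (S.Step B) v (T.pathTo (S.x₀, B.init) T.nodes.length v) ls :=
    ⟨hpre, hlast, hchain, hhead⟩
  exact ⟨hlasso.feasible hroot, hlasso.sat hroot (by simpa using hacc) hB⟩

end

/-! ### Growth along a chain of targets -/

open Classical in
/-- The number of targets `G 0, G 1, …` that are hit in this order by `y 0, …, y (t - 1)`. -/
noncomputable def stage {α : Type*} (G : ℕ → Set α) (y : ℕ → α) : ℕ → ℕ
  | 0 => 0
  | t + 1 => if y t ∈ G (stage G y t) then stage G y t + 1 else stage G y t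

section

variable {d N W : ℕ} {Q : Type*} {S : Scene d N W} {B : NBA Q (AP N W)} {r u : Pos d N × Q}
  {T : SearchTree d N Q} {A : Params d N}

theorem SearchTree.mem_nearest {x : Pos d N} :
    u ∈ T.nearest x ↔ u ∈ T.nodes ∧ ∀ v ∈ T.nodes, dist x u.1 ≤ dist x v.1 := by
  simp [SearchTree.nearest]

theorem Params.mem_near {x : Pos d N} :
    u ∈ A.near T x ↔ u ∈ T.nodes ∧ (dist u.1 (A.xNew T x) ≤ A.radius T ∨ u ∈ T.nearest x) := by
  simp [Params.near]

theorem Params.xNew_eq (hA : A.Valid) (hu : u ∈ T.nodes) {x : Pos d N} (hx : dist u.1 x ≤ A.η) :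
    A.xNew T x = x := by
  unfold Params.xNew
  rcases hl : T.nearest x with _ | ⟨v, l⟩
  · rfl
  · have hv : v ∈ T.nearest x := hl ▸ List.mem_cons_self
    refine hA.steer_eq _ _ ?_
    rw [dist_comm] at hx ⊢
    exact ((SearchTree.mem_nearest.1 hv).2 u hu).trans hx

theorem SearchTree.mem_nearest_of_numPos_le_one (hT : T.numPos ≤ 1) (hu : u ∈ T.nodes)
    (x : Pos d N) : u ∈ T.nearest x := by
  classical
  have hpos : ∀ v ∈ T.nodes, v.1 ∈ (T.nodes.map Prod.fst).toFinset := fun v hv =>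
    List.mem_toFinset.2 (List.mem_map_of_mem hv)
  refine SearchTree.mem_nearest.2 ⟨hu, fun v hv => ?_⟩
  rw [Finset.card_le_one.1 hT u.1 (hpos u hu) v.1 (hpos v hv)]

-- With a single position in the tree the radius is `0` because `log 1 = 0`; then `Nearest` helps.
theorem Params.mem_near_of_dist_le (hA : A.Valid) (hu : u ∈ T.nodes) {x : Pos d N} {h : ℝ}
    (hx : dist u.1 x ≤ h) (hη : h ≤ A.η)
    (hradius : 2 ≤ T.numPos →
      h ≤ A.γ * (Real.log T.numPos / T.numPos) ^ (1 / ((d * N : ℕ) + 1 : ℝ))) :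
    u ∈ A.near T x := by
  refine Params.mem_near.2 ⟨hu, ?_⟩
  rw [Params.xNew_eq hA hu (hx.trans hη)]
  rcases le_or_gt 2 T.numPos with h2 | h1
  · exact .inl (hx.trans (le_min (hradius h2) hη))
  · exact .inr (SearchTree.mem_nearest_of_numPos_le_one (Nat.le_of_lt_succ h1) hu x)

variable [Fintype Q]

theorem Scene.exists_iteration_eq_some (hA : A.Valid) (hu : u ∈ T.nodes) {s : ℕ → Pos d N} {m : ℕ}
    (hs : dist u.1 (s m) ≤ A.η) (hfree : s m ∈ S.freeN) :
    ∃ T', S.iteration B A s T = some T' :=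
  ⟨_, dif_pos ⟨m, by rwa [Params.xNew_eq hA hu hs]⟩⟩

theorem Scene.iteration_eq_grow (hA : A.Valid) (hu : u ∈ T.nodes) {s : ℕ → Pos d N}
    (hs : dist u.1 (s 0) ≤ A.η) (hfree : s 0 ∈ S.freeN) :
    S.iteration B A s T = some (S.grow B A T (s 0)) := by
  classical
  have h0 : A.xNew T (s 0) ∈ S.freeN := by rwa [Params.xNew_eq hA hu hs]
  have hfind : Nat.find (⟨0, h0⟩ : ∃ m, A.xNew T (s m) ∈ S.freeN) = 0 := (Nat.find_eq_zero _).2 h0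
  rw [Scene.iteration, dif_pos ⟨0, h0⟩, hfind]

theorem Scene.exists_constructTree_eq_some (hA : A.Valid) (hr : r.1 ∈ S.freeN)
    {s : ℕ → ℕ → Pos d N}
    (hs : ∀ n, ∀ x ∈ S.freeN, ∃ m, dist x (s n m) ≤ A.η ∧ s n m ∈ S.freeN) (n : ℕ) :
    ∃ T, S.constructTree B A s r n = some T := by
  induction n with
  | zero => exact ⟨_, rfl⟩
  | succ n ih =>
    obtain ⟨T, hT⟩ := ih
    obtain ⟨m, hm, hfree⟩ := hs n r.1 hr
    rw [Scene.constructTree, hT]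
    exact Scene.exists_iteration_eq_some hA (isTree_of_constructTree hr hT).root_mem hm hfree

theorem Scene.mem_of_iteration_eq_some (hA : A.Valid) {T' : SearchTree d N Q} {s : ℕ → Pos d N}
    {b : Q} {h : ℝ} (hη : h ≤ A.η)
    (hradius : 2 ≤ T.numPos →
      h ≤ A.γ * (Real.log T.numPos / T.numPos) ^ (1 / ((d * N : ℕ) + 1 : ℝ)))
    (hu : u ∈ T.nodes) (hstep : S.Step B u (s 0, b)) (hdist : dist u.1 (s 0) ≤ h)
    (hT' : S.iteration B A s T = some T') : (s 0, b) ∈ T'.nodes := by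
  rw [Scene.iteration_eq_grow hA hu (hdist.trans hη) hstep.1.right_mem] at hT'
  obtain rfl := Option.some.inj hT'
  have hnear := Params.mem_near_of_dist_le hA hu hdist hη hradius
  have hx : A.xNew T (s 0) = s 0 := Params.xNew_eq hA hu (hdist.trans hη)
  simpa only [hx] using Scene.mem_grow hnear (b := b) (by rwa [hx])

theorem Scene.exists_mem_of_le_stage (hA : A.Valid) {s : ℕ → ℕ → Pos d N}
    {U : ℕ → Set (Pos d N)} {b : ℕ → Q} {H n : ℕ} {h : ℝ} (hη : h ≤ A.η)
    (hradius : ∀ k : ℕ, 2 ≤ k → k ≤ n →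
      h ≤ A.γ * (Real.log k / k) ^ (1 / ((d * N : ℕ) + 1 : ℝ)))
    (hr : r.1 ∈ U 0) (hrb : r.2 = b 0)
    (hU : ∀ j < H, ∀ x ∈ U j, ∀ y ∈ U (j + 1), S.Step B (x, b j) (y, b (j + 1)) ∧ dist x y ≤ h)
    (hT : S.constructTree B A s r n = some T)
    (hstage : H ≤ stage (fun j => U (j + 1)) (fun t => s t 0) n) :
    ∃ z ∈ U H, (z, b H) ∈ T.nodes := by
  suffices key : ∀ t ≤ n, ∀ T, S.constructTree B A s r t = some T →
      ∀ j ≤ H, j ≤ stage (fun j => U (j + 1)) (fun t => s t 0) t →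
        ∃ z ∈ U j, (z, b j) ∈ T.nodes from key n le_rfl T hT H le_rfl hstage
  intro t
  induction t with
  | zero =>
    intro _ T hT j _ hj
    obtain rfl : j = 0 := Nat.le_zero.1 hj
    exact ⟨r.1, hr, by simp [← Option.some.inj hT, SearchTree.root, ← hrb]⟩
  | succ t ih =>
    intro htn T hT j hjH hj
    obtain ⟨T₀, hT₀, hiter⟩ := Option.bind_eq_some_iff.1 hT
    rcases le_or_gt j (stage (fun j => U (j + 1)) (fun t => s t 0) t) with hj' | hj'
    · obtain ⟨z, hz, hzT⟩ := ih (by omega) T₀ hT₀ j hjH hj'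
      exact ⟨z, hz, (Scene.isPrefix_constructTree t.le_succ hT₀ hT).subset hzT⟩
    · rw [stage] at hj
      split_ifs at hj with hhit
      · obtain ⟨z, hz, hzT⟩ := ih (by omega) T₀ hT₀ _ (by omega) le_rfl
        obtain ⟨hstep, hdist⟩ := hU _ (by omega) z hz (s t 0) hhit
        obtain rfl := le_antisymm hj hj'
        have hnum := Scene.numPos_constructTree_le hT₀
        exact ⟨_, hhit, Scene.mem_of_iteration_eq_some hA hη (fun h2 => hradius _ h2 (by omega))
          hzT hstep hdist hiter⟩
      · omega

/-! ### Success of the algorithm for given samples -/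

theorem exists_argmin_eq_some {α : Type*} {l : List α} {a : α} (ha : a ∈ l) (f : α → ℝ) :
    ∃ m, l.argmin f = some m :=
  Option.ne_none_iff_exists'.1 fun h => List.ne_nil_of_mem ha (List.argmin_eq_none.1 h)

theorem Scene.none_notMem_candidates (hA : A.Valid) {s : ℕ → ℕ → ℕ → Pos d N}
    (hs : ∀ a n, ∀ x ∈ S.freeN, ∃ m, dist x (s a n m) ≤ A.η ∧ s a n m ∈ S.freeN)
    (hT : ∀ v ∈ T.nodes, v.1 ∈ S.freeN) (n : ℕ) : none ∉ S.candidates B A s n T := by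
  intro h
  obtain ⟨⟨v, a⟩, hva, h⟩ := List.mem_map.1 h
  have hv := (List.mem_filter.1 (List.fst_mem_of_mem_zipIdx hva)).1
  obtain ⟨T', hT'⟩ := Scene.exists_constructTree_eq_some (B := B) (r := v) hA (hT v hv)
    (hs (a + 1)) n
  rw [Option.map_eq_none_iff, Scene.suffixPlan, hT'] at h
  split_ifs at h
  cases h

theorem Scene.exists_suffixPlan_eq_some_some {s : ℕ → ℕ → Pos d N} {v : Pos d N × Q} {n : ℕ}
    (hT : S.constructTree B A s v n = some T) (hu : u ∈ T.nodes) (huv : S.Step B u v) :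
    ∃ suf, S.suffixPlan B A s v n = some (some suf) := by
  classical
  unfold Scene.suffixPlan
  split_ifs with hvv
  · exact ⟨_, rfl⟩
  · have hu' : u ∈ T.nodes.filter (fun u => S.Step B u v) :=
      List.mem_filter.2 ⟨hu, decide_eq_true huv⟩
    obtain ⟨suf, hsuf⟩ := exists_argmin_eq_some
      (List.mem_map_of_mem (f := fun u => T.findPlan v u ++ [v.1]) hu') pathCost
    exact ⟨suf, by rw [hT, Option.map_some]; exact congrArg some hsuf⟩

theorem Scene.exists_tlRRT_eq_some {φ : LTL (AP N W)} (hB : ∀ σ, B.Accepts σ ↔ φ.Sat σ)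
    (h₀ : S.x₀ ∈ S.freeN) {s : ℕ → ℕ → ℕ → Pos d N} {nPre nSuf : ℕ}
    (hT : S.constructTree B A (s 0) (S.x₀, B.init) nPre = some T)
    (hnone : none ∉ S.candidates B A s nSuf T) {τ : Plan d N}
    (hτ : some (some τ) ∈ S.candidates B A s nSuf T) :
    ∃ τ, S.tlRRT B A s nPre nSuf = some τ ∧ S.Feasible τ ∧ φ.Sat (S.trace τ) := by
  obtain ⟨τ', hτ'⟩ := exists_argmin_eq_some
    (List.reduceOption_mem_iff.2 (List.reduceOption_mem_iff.2 hτ)) (Plan.cost A.w)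
  refine ⟨τ', ?_, ?_⟩
  · rw [Scene.tlRRT, hT, Option.bind_some, if_neg hnone, hτ']
  · exact Scene.feasible_and_sat_of_mem_candidates hB (isTree_of_constructTree h₀ hT)
      (List.reduceOption_mem_iff.1 (List.reduceOption_mem_iff.1 (List.argmin_mem hτ')))

open Classical in
theorem exists_mem_zipIdx_filter {α : Type*} {l l' : List α} (h : l <+: l') {a : α} (ha : a ∈ l)
    {p : α → Prop} (hp : p a) : ∃ i ≤ l.length, (a, i) ∈ (l'.filter p).zipIdx := by
  have hmem : a ∈ l.filter p := List.mem_filter.2 ⟨ha, decide_eq_true hp⟩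
  obtain ⟨i, hi, hia⟩ := List.getElem_of_mem hmem
  obtain ⟨l₂, rfl⟩ := h
  refine ⟨i, hi.le.trans (List.length_filter_le _ _), ?_⟩
  rw [List.mem_zipIdx_iff_getElem?, List.filter_append, List.getElem?_append_left hi,
    List.getElem?_eq_getElem hi, hia]

-- Nodes are appended at the end of the tree, so an accepting node found by iteration `n` keeps its
-- index among the accepting nodes, and thereby the samples of its suffix tree, in all later trees.
theorem Scene.exists_tlRRT_eq_some_of_constructTree {φ : LTL (AP N W)} (hA : A.Valid)
    (hB : ∀ σ, B.Accepts σ ↔ φ.Sat σ)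
    (h₀ : S.x₀ ∈ S.freeN) {s : ℕ → ℕ → ℕ → Pos d N}
    (hs : ∀ a n, ∀ x ∈ S.freeN, ∃ m, dist x (s a n m) ≤ A.η ∧ s a n m ∈ S.freeN)
    {n nPre nSuf : ℕ} (hn : n ≤ nPre) (hT : S.constructTree B A (s 0) (S.x₀, B.init) n = some T)
    {v : Pos d N × Q} (hv : v ∈ T.nodes) (hacc : v.2 ∈ B.accept)
    (hsuf : ∀ a ≤ 1 + Fintype.card Q * n, ∀ T', S.constructTree B A (s (a + 1)) v nSuf = some T' →
      ∃ u ∈ T'.nodes, S.Step B u v) :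
    ∃ τ, S.tlRRT B A s nPre nSuf = some τ ∧ S.Feasible τ ∧ φ.Sat (S.trace τ) := by
  obtain ⟨T₁, hT₁⟩ := Scene.exists_constructTree_eq_some (B := B) (r := (S.x₀, B.init)) hA h₀
    (hs 0) nPre
  have htree : IsTree S B (S.x₀, B.init) T₁ := isTree_of_constructTree h₀ hT₁
  have hpre : T.nodes <+: T₁.nodes := Scene.isPrefix_constructTree hn hT hT₁
  obtain ⟨a, ha, hva⟩ := exists_mem_zipIdx_filter (p := fun v => v.2 ∈ B.accept) hpre hv hacc
  obtain ⟨T', hT'⟩ := Scene.exists_constructTree_eq_some (B := B) (r := v) hA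
    (htree.mem_freeN v (hpre.subset hv)) (hs (a + 1)) nSuf
  obtain ⟨u, hu, huv⟩ := hsuf a (ha.trans (Scene.length_constructTree_le hT)) T' hT'
  obtain ⟨suf, hsuf'⟩ := Scene.exists_suffixPlan_eq_some_some hT' hu huv
  exact Scene.exists_tlRRT_eq_some (τ := ⟨T₁.findPlan (S.x₀, B.init) v, suf⟩) hB h₀ hT₁
    (Scene.none_notMem_candidates hA hs htree.mem_freeN _)
    (List.mem_map.2 ⟨(v, a), hva, by simp only [hsuf', Option.map_some]⟩)

end

open AffineMap (lineMap)

/-! ### Cones -/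

/-- The union of the segments from the apex `a` to the points of `U`, without the apex. Cones join
the places where observations change to balls around the waypoints. -/
def cone {E : Type*} [AddCommGroup E] [Module ℝ E] (a : E) (U : Set E) : Set E :=
  {z | ∃ x ∈ U, ∃ t ∈ Set.Ioc (0 : ℝ) 1, lineMap a x t = z}

section

variable {E : Type*}

theorem cone_mono [AddCommGroup E] [Module ℝ E] (a : E) {U V : Set E} (h : U ⊆ V) :
    cone a U ⊆ cone a V :=
  fun _ ⟨x, hx, hz⟩ => ⟨x, h hx, hz⟩

theorem subset_cone [AddCommGroup E] [Module ℝ E] (a : E) (U : Set E) : U ⊆ cone a U :=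
  fun x hx => ⟨x, hx, 1, ⟨one_pos, le_rfl⟩, AffineMap.lineMap_apply_one a x⟩

theorem convex_cone [AddCommGroup E] [Module ℝ E] (a : E) {U : Set E} (hU : Convex ℝ U) :
    Convex ℝ (cone a U) := by
  rintro _ ⟨x, hx, s, hs, rfl⟩ _ ⟨y, hy, t, ht, rfl⟩ α β hα hβ hαβ
  have hr : α * s + β * t ∈ Set.Ioc (0 : ℝ) 1 :=
    convex_Ioc (𝕜 := ℝ) 0 1 hs ht hα hβ hαβ
  have hz := hU hx hy (a := α * s / (α * s + β * t)) (b := β * t / (α * s + β * t))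
    (div_nonneg (mul_nonneg hα hs.1.le) hr.1.le) (div_nonneg (mul_nonneg hβ ht.1.le) hr.1.le)
    (by rw [← add_div, div_self hr.1.ne'])
  refine ⟨_, hz, _, hr, ?_⟩
  simp only [AffineMap.lineMap_apply_module, smul_add, smul_smul,
    mul_div_cancel₀ _ hr.1.ne']
  rw [← eq_sub_iff_add_eq] at hαβ
  subst hαβ
  module

variable [NormedAddCommGroup E] [NormedSpace ℝ E]

theorem isOpen_cone (a : E) {U : Set E} (hU : IsOpen U) : IsOpen (cone a U) := by
  have h : cone a U = ⋃ t ∈ Set.Ioc (0 : ℝ) 1, AffineMap.homothety a t '' U := by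
    ext z
    simp only [cone, AffineMap.homothety_eq_lineMap, Set.mem_ofPred_eq, Set.mem_iUnion,
      Set.mem_image, exists_prop]
    exact ⟨fun ⟨x, hx, t, ht, e⟩ => ⟨t, ht, x, hx, e⟩, fun ⟨t, ht, x, hx, e⟩ => ⟨x, hx, t, ht, e⟩⟩
  rw [h]
  exact isOpen_biUnion fun t ht => AffineMap.homothety_isOpenMap a t ht.1.ne' U hU

theorem ball_subset_cone (a w : E) {t : ℝ} (ht : t ∈ Set.Ioc (0 : ℝ) 1) (r : ℝ) :
    Metric.ball (lineMap a w t) (t * r) ⊆ cone a (Metric.ball w r) := by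
  intro z hz
  have hw : lineMap a (lineMap a w t) t⁻¹ = w := by
    rw [AffineMap.lineMap_lineMap_right, inv_mul_cancel₀ ht.1.ne', AffineMap.lineMap_apply_one]
  refine ⟨lineMap a z t⁻¹, ?_, t, ht, ?_⟩
  · rw [Metric.mem_ball, dist_eq_norm] at hz ⊢
    rwa [← hw, AffineMap.lineMap_apply_module', AffineMap.lineMap_apply_module' a (lineMap a w t),
      add_sub_add_right_eq_sub, ← smul_sub, sub_sub_sub_cancel_right, norm_smul, norm_inv,
      Real.norm_of_nonneg ht.1.le, inv_mul_lt_iff₀ ht.1]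
  · rw [AffineMap.lineMap_lineMap_right, mul_inv_cancel₀ ht.1.ne', AffineMap.lineMap_apply_one]

end

/-! ### Segments and the boundaries of regions -/

theorem mem_iff_mem_of_isPreconnected {E : Type*} [TopologicalSpace E] {P R : Set E}
    (hP : IsPreconnected P) (hR : Disjoint P (frontier R)) {x y : E} (hx : x ∈ P) (hy : y ∈ P) :
    x ∈ R ↔ y ∈ R := by
  have hcover : P ⊆ interior R ∪ (closure R)ᶜ := fun z hz =>
    or_iff_not_imp_left.2 fun hint hcl => Set.disjoint_left.1 hR hz ⟨hcl, hint⟩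
  have hdisj : Disjoint (interior R) (closure R)ᶜ :=
    Set.disjoint_compl_right_iff_subset.2 interior_subset_closure
  rcases hP.subset_or_subset isOpen_interior isClosed_closure.isOpen_compl hdisj hcover with h | h
  · exact iff_of_true (interior_subset (h hx)) (interior_subset (h hy))
  · exact iff_of_false (fun h' => h hx (subset_closure h')) (fun h' => h hy (subset_closure h'))

theorem lineMap_mem_segment {E : Type*} [AddCommGroup E] [Module ℝ E] (x y : E) {t : ℝ}
    (h₀ : 0 ≤ t) (h₁ : t ≤ 1) : lineMap x y t ∈ segment ℝ x y :=
  segment_eq_image_lineMap ℝ x y ▸ Set.mem_image_of_mem _ ⟨h₀, h₁⟩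

theorem exists_lineMap_of_mem_segment {E : Type*} [AddCommGroup E] [Module ℝ E] {x y z : E}
    (h : z ∈ segment ℝ x y) : ∃ t : ℝ, 0 ≤ t ∧ t ≤ 1 ∧ lineMap x y t = z := by
  rw [segment_eq_image_lineMap] at h
  obtain ⟨t, ht, rfl⟩ := h
  exact ⟨t, ht.1, ht.2, rfl⟩

section

variable {d N W : ℕ} {S : Scene d N W} {w w' x y z : Pos d N} {r t : ℝ}

theorem lineMap_pos_apply (x y : Pos d N) (t : ℝ) (i : Fin N) :
    (lineMap x y t) i = lineMap (x i) (y i) t := by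
  simp only [AffineMap.lineMap_apply_module, PiLp.add_apply, PiLp.smul_apply]

theorem apply_mem_segment (h : z ∈ segment ℝ x y) (i : Fin N) :
    z i ∈ segment ℝ (x i) (y i) := by
  obtain ⟨t, h₀, h₁, rfl⟩ := exists_lineMap_of_mem_segment h
  rw [lineMap_pos_apply]
  exact lineMap_mem_segment _ _ h₀ h₁

theorem Scene.mem_label_some {i : Fin N} {j : Fin W} :
    (i, some j) ∈ S.label x ↔ x i ∈ S.region j := by
  simp [Scene.label]

theorem Scene.label_eq_iff :
    S.label x = S.label y ↔ ∀ i j, x i ∈ S.region j ↔ y i ∈ S.region j := by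
  constructor
  · intro h i j
    rw [← Scene.mem_label_some, ← Scene.mem_label_some, h]
  · intro h
    ext ⟨i, o⟩
    simp only [Scene.label, Set.mem_ofPred_eq, h]

theorem Scene.MoveN.mono (h : S.MoveN x y) {z' : Pos d N} (hz : z ∈ segment ℝ x y)
    (hz' : z' ∈ segment ℝ x y) : S.MoveN z z' := by
  intro i
  have hs : segment ℝ (z i) (z' i) ⊆ segment ℝ (x i) (y i) :=
    (convex_segment (x i) (y i)).segment_subset (apply_mem_segment hz i) (apply_mem_segment hz' i)
  exact ⟨hs.trans (h i).1, fun j => ((h i).2 j).anti (Set.inter_subset_inter_left _ hs)⟩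

theorem Scene.MoveN.mem_freeN (h : S.MoveN x y) (hz : z ∈ segment ℝ x y) : z ∈ S.freeN :=
  fun i => (h i).1 (apply_mem_segment hz i)

theorem Scene.notMem_frontier {U : Set (Pos d N)} (hU : IsOpen U) {l : Set (AP N W)}
    (hl : ∀ x ∈ U, S.label x = l) (hz : z ∈ U) (i : Fin N) (j : Fin W) :
    z i ∉ frontier (S.region j) := by
  classical
  let f : Pt d → Pos d N := fun p => WithLp.toLp 2 (Function.update (WithLp.ofLp z) i p)
  have hf : Continuous f :=
    (PiLp.continuous_toLp 2 _).comp (continuous_const.update i continuous_id)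
  have hfz : f (z i) = z := by simp [f]
  have hfi : ∀ p, f p i = p := fun p => by simp [f]
  have hnhds : f ⁻¹' U ∈ 𝓝 (z i) := (hU.preimage hf).mem_nhds (by simpa [hfz] using hz)
  have hconst : ∀ p ∈ f ⁻¹' U, p ∈ S.region j ↔ z i ∈ S.region j := by
    intro p hp
    simpa [hfi] using Scene.label_eq_iff.1 ((hl _ hp).trans (hl _ hz).symm) i j
  intro hfr
  by_cases h : z i ∈ S.region j
  · exact hfr.2 (mem_interior_iff_mem_nhds.2
      (Filter.mem_of_superset hnhds fun p hp => (hconst p hp).2 h))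
  · exact h ((S.isClosed_region j).closure_eq ▸ hfr.1)

theorem Scene.moveN_of_convex {U : Set (Pos d N)} (hU : IsOpen U) (hc : Convex ℝ U)
    (hf : U ⊆ S.freeN) {l : Set (AP N W)} (hl : ∀ x ∈ U, S.label x = l) (hx : x ∈ U) (hy : y ∈ U) :
    S.MoveN x y := by
  intro i
  have hlift : ∀ p ∈ segment ℝ (x i) (y i), ∃ z ∈ U, z i = p := by
    intro p hp
    obtain ⟨t, h₀, h₁, rfl⟩ := exists_lineMap_of_mem_segment hp
    exact ⟨lineMap x y t, hc.segment_subset hx hy (lineMap_mem_segment x y h₀ h₁),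
      lineMap_pos_apply x y t i⟩
  refine ⟨fun p hp => ?_, fun j p hp => ?_⟩
  · obtain ⟨z, hz, rfl⟩ := hlift p hp
    exact hf hz i
  · obtain ⟨z, hz, rfl⟩ := hlift p hp.1
    exact absurd hp.2 (Scene.notMem_frontier hU hl hz i j)

-- A change before time `t` would give the move a second point on the boundary.
theorem Scene.Move.mem_region_iff_of_lt {x y : Pt d} (h : S.Move x y) {j : Fin W}
    (hx : x ∉ frontier (S.region j)) {t u : ℝ} (ht : t ≤ 1) (hu : 0 ≤ u) (hut : u < t)
    (hfr : lineMap x y t ∈ frontier (S.region j)) :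
    x ∈ S.region j ↔ lineMap x y u ∈ S.region j := by
  refine mem_iff_mem_of_isPreconnected (convex_segment x (lineMap x y u)).isPreconnected
    (Set.disjoint_left.2 fun p hp hpf => ?_) (left_mem_segment ℝ _ _) (right_mem_segment ℝ _ _)
  obtain ⟨v, hv₀, hv₁, rfl⟩ := exists_lineMap_of_mem_segment hp
  rw [AffineMap.lineMap_lineMap_right] at hpf
  have hvu : v * u < t := (mul_le_of_le_one_left hu hv₁).trans_lt hut
  have hmeet : lineMap x y (v * u) = lineMap x y t :=
    h.2 j ⟨lineMap_mem_segment x y (mul_nonneg hv₀ hu) (hvu.le.trans ht), hpf⟩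
      ⟨lineMap_mem_segment x y (hu.trans hut.le) ht, hfr⟩
  rcases AffineMap.lineMap_eq_lineMap_iff.1 hmeet with rfl | heq
  · rw [AffineMap.lineMap_same_apply] at hfr
    exact hx hfr
  · exact hvu.ne heq

/-! ### The place where the observation changes -/

/-- All straight lines from the ball of radius `r` around `w` to the one around `w'` are moves, and
only the observations of `w` and `w'` are made on them. -/
structure Tube (S : Scene d N W) (w w' : Pos d N) (r : ℝ) : Prop where
  pos : 0 < r
  label_left : ∀ x ∈ Metric.ball w r, S.label x = S.label w
  label_right : ∀ x ∈ Metric.ball w' r, S.label x = S.label w'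
  move : ∀ x ∈ Metric.ball w r, ∀ y ∈ Metric.ball w' r, S.MoveN x y
  label_segment : ∀ x ∈ Metric.ball w r, ∀ y ∈ Metric.ball w' r, ∀ z ∈ segment ℝ x y,
    S.label z = S.label w ∨ S.label z = S.label w'

theorem Tube.symm (h : Tube S w w' r) : Tube S w' w r :=
  ⟨h.pos, h.label_right, h.label_left, fun x hx y hy => (h.move y hy x hx).symm,
    fun x hx y hy z hz => (h.label_segment y hy x hx z (by rwa [segment_symm])).symm⟩

/-- The point at time `t` on the way from `w` to `w'` is one before which the observation does not
change, on any line of the tube that is at this point at time `t`. -/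
def Tube.IsTime (S : Scene d N W) (w w' : Pos d N) (r t : ℝ) : Prop :=
  ∀ x ∈ Metric.ball w r, ∀ y ∈ Metric.ball w' r, lineMap x y t = lineMap w w' t →
    ∀ u, 0 ≤ u → u < t → S.label (lineMap x y u) = S.label w

theorem Tube.isTime_of_label_eq (h : Tube S w w' r) (hww' : S.label w = S.label w') (ht : t ≤ 1) :
    Tube.IsTime S w w' r t := by
  intro x hx y hy _ u hu hut
  simpa only [← hww', or_self] using
    h.label_segment x hx y hy _ (lineMap_mem_segment x y hu (hut.le.trans ht))

theorem Tube.isTime_of_frontier (h : Tube S w w' r) {i : Fin N} {j : Fin W}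
    (hij : ¬(w i ∈ S.region j ↔ w' i ∈ S.region j)) (ht : t ≤ 1)
    (hfr : lineMap (w i) (w' i) t ∈ frontier (S.region j)) : Tube.IsTime S w w' r t := by
  intro x hx y hy hxy u hu hut
  rw [← lineMap_pos_apply, ← hxy, lineMap_pos_apply] at hfr
  have hxu := (h.move x hx y hy i).mem_region_iff_of_lt
    (Scene.notMem_frontier Metric.isOpen_ball h.label_left hx i j) ht hu hut hfr
  refine (h.label_segment x hx y hy _
    (lineMap_mem_segment x y hu (hut.le.trans ht))).resolve_right fun hu' => hij ?_
  have hwx := Scene.label_eq_iff.1 (h.label_left x hx) i j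
  have hw'u := Scene.label_eq_iff.1 hu' i j
  rw [lineMap_pos_apply] at hw'u
  exact hwx.symm.trans (hxu.trans hw'u)

theorem Tube.exists_frontier (h : Tube S w w' r) {i : Fin N} {j : Fin W}
    (hij : ¬(w i ∈ S.region j ↔ w' i ∈ S.region j)) :
    ∃ t : ℝ, 0 < t ∧ t < 1 ∧ lineMap (w i) (w' i) t ∈ frontier (S.region j) := by
  obtain ⟨p, hp, hpf⟩ : ∃ p ∈ segment ℝ (w i) (w' i), p ∈ frontier (S.region j) := by
    by_contra! hc
    exact hij (mem_iff_mem_of_isPreconnected (convex_segment _ _).isPreconnected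
      (Set.disjoint_left.2 hc) (left_mem_segment ℝ _ _) (right_mem_segment ℝ _ _))
  obtain ⟨t, h₀, h₁, rfl⟩ := exists_lineMap_of_mem_segment hp
  refine ⟨t, h₀.lt_of_ne ?_, h₁.lt_of_ne ?_, hpf⟩
  · rintro rfl
    rw [AffineMap.lineMap_apply_zero] at hpf
    exact Scene.notMem_frontier Metric.isOpen_ball h.label_left (Metric.mem_ball_self h.pos) i j hpf
  · rintro rfl
    rw [AffineMap.lineMap_apply_one] at hpf
    exact Scene.notMem_frontier Metric.isOpen_ball h.label_right (Metric.mem_ball_self h.pos) i j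
      hpf

theorem Tube.exists_isTime (h : Tube S w w' r) :
    ∃ t, 0 < t ∧ t < 1 ∧ Tube.IsTime S w w' r t ∧ Tube.IsTime S w' w r (1 - t) := by
  by_cases hww' : S.label w = S.label w'
  · exact ⟨1 / 2, by norm_num, by norm_num, h.isTime_of_label_eq hww' (by norm_num),
      h.symm.isTime_of_label_eq hww'.symm (by norm_num)⟩
  · obtain ⟨i, j, hij⟩ : ∃ i j, ¬(w i ∈ S.region j ↔ w' i ∈ S.region j) := by
      simpa only [Scene.label_eq_iff, not_forall] using hww'
    obtain ⟨t, h₀, h₁, hfr⟩ := h.exists_frontier hij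
    refine ⟨t, h₀, h₁, h.isTime_of_frontier hij h₁.le hfr,
      h.symm.isTime_of_frontier (fun h' => hij h'.symm) (by linarith) ?_⟩
    rwa [AffineMap.lineMap_apply_one_sub]

-- A point of the cone lies on a line that starts in the ball around `w`, passes through the apex at
-- time `t` and, as the deviation from `w` is scaled by `(1 - t) / t`, ends in the ball around `w'`.
theorem Tube.mem_freeN_and_label_eq (h : Tube S w w' r) (h₀ : 0 < t) (h₁ : t < 1)
    (ht : Tube.IsTime S w w' r t) (hz : z ∈ cone (lineMap w w' t) (Metric.ball w (r * t))) :
    z ∈ S.freeN ∧ S.label z = S.label w := by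
  obtain ⟨x, hx, l, ⟨hl₀, hl₁⟩, rfl⟩ := hz
  rw [Metric.mem_ball, dist_eq_norm] at hx
  set y := w' - ((1 - t) / t) • (x - w) with hy
  have hxball : x ∈ Metric.ball w r := by
    rw [Metric.mem_ball, dist_eq_norm]
    exact hx.trans (mul_lt_of_lt_one_right h.pos h₁)
  have hyball : y ∈ Metric.ball w' r := by
    rw [Metric.mem_ball, dist_eq_norm, hy, sub_sub_cancel_left, norm_neg, norm_smul,
      Real.norm_of_nonneg (div_nonneg (by linarith) h₀.le)]
    calc (1 - t) / t * ‖x - w‖ < (1 - t) / t * (r * t) :=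
          mul_lt_mul_of_pos_left hx (div_pos (by linarith) h₀)
      _ = (1 - t) * r := by field_simp
      _ < r := by nlinarith [mul_pos h.pos h₀]
  have happex : lineMap x y t = lineMap w w' t := by
    have hsmul : t • ((1 - t) / t) • (x - w) = (1 - t) • (x - w) := by
      rw [smul_smul, mul_div_cancel₀ _ h₀.ne']
    rw [AffineMap.lineMap_apply_module, AffineMap.lineMap_apply_module, hy, smul_sub t w', hsmul]
    module
  have hzline : lineMap (lineMap w w' t) x l = lineMap x y ((1 - l) * t) := by
    rw [← happex, ← AffineMap.lineMap_apply_one_sub, AffineMap.lineMap_lineMap_right]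
  have hu₀ : 0 ≤ (1 - l) * t := mul_nonneg (by linarith) h₀.le
  have hut : (1 - l) * t < t := mul_lt_of_lt_one_left h₀ (by linarith)
  rw [hzline]
  exact ⟨(h.move x hxball y hyball).mem_freeN (lineMap_mem_segment x y hu₀ (by linarith)),
    ht x hxball y hyball happex _ hu₀ hut⟩

-- The deviations `e` and `e'` at the times `s` and `s'` extend affinely to the times `0` and `1`.
theorem exists_lineMap_eq_add {E : Type*} [NormedAddCommGroup E] [NormedSpace ℝ E] {w w' e e' : E}
    {s s' r : ℝ} (hs : 0 ≤ s) (hss' : s < s') (hs' : s' ≤ 1) (he : ‖e‖ < r / 2)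
    (hee' : ‖e' - e‖ ≤ (s' - s) * (r / 2)) :
    ∃ x ∈ Metric.ball w r, ∃ y ∈ Metric.ball w' r,
      lineMap x y s = lineMap w w' s + e ∧ lineMap x y s' = lineMap w w' s' + e' := by
  have hpos : 0 < s' - s := sub_pos.2 hss'
  set g := (s' - s)⁻¹ • (e' - e) with hg
  have hsg : e' = e + (s' - s) • g := by rw [hg, smul_inv_smul₀ hpos.ne', add_sub_cancel]
  have hgn : ‖g‖ ≤ r / 2 := by
    rwa [hg, norm_smul, norm_inv, Real.norm_of_nonneg hpos.le, inv_mul_le_iff₀ hpos]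
  have hball : ∀ (v : E) (c : ℝ), |c| ≤ 1 → v + (e + c • g) ∈ Metric.ball v r := by
    intro v c hc
    rw [mem_ball_iff_norm, add_sub_cancel_left]
    calc ‖e + c • g‖ ≤ ‖e‖ + |c| * ‖g‖ := by
          simpa only [norm_smul, Real.norm_eq_abs] using norm_add_le e (c • g)
      _ ≤ ‖e‖ + ‖g‖ := by gcongr; exact mul_le_of_le_one_left (norm_nonneg g) hc
      _ < r := by linarith
  refine ⟨_, hball w (-s) (abs_le.2 ⟨by linarith, by linarith⟩), _,
    hball w' (1 - s) (abs_le.2 ⟨by linarith, by linarith⟩), ?_, ?_⟩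
  · simp only [AffineMap.lineMap_apply_module]
    module
  · rw [hsg]
    simp only [AffineMap.lineMap_apply_module]
    module

theorem Tube.moveN_of_mem_cone (h : Tube S w w' r) (h₀ : 0 < t) (h₁ : t < 1) {r₁ : ℝ}
    (hr : 2 * r₁ ≤ r * t) (hr' : 2 * r₁ ≤ r * (1 - t)) {z' : Pos d N}
    (hz : z ∈ cone (lineMap w w' t) (Metric.ball w r₁))
    (hz' : z' ∈ cone (lineMap w w' t) (Metric.ball w' r₁)) : S.MoveN z z' := by
  obtain ⟨x, hx, l, ⟨hl₀, hl₁⟩, rfl⟩ := hz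
  obtain ⟨x', hx', l', ⟨hl'₀, hl'₁⟩, rfl⟩ := hz'
  rw [mem_ball_iff_norm] at hx hx'
  have hnorm : ∀ (v : Pos d N) (c : ℝ), 0 < c → ‖v‖ < r₁ → ‖c • v‖ ≤ c * r₁ := fun v c hc hv => by
    rw [norm_smul, Real.norm_of_nonneg hc.le]
    exact mul_le_mul_of_nonneg_left hv.le hc.le
  have he := hnorm (x - w) l hl₀ hx
  have he' := hnorm (x' - w') l' hl'₀ hx'
  have hr₁ : 0 < r₁ := (norm_nonneg _).trans_lt hx
  have hee' : ‖l' • (x' - w') - l • (x - w)‖ ≤ (t + l' * (1 - t) - t * (1 - l)) * (r / 2) := by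
    calc ‖l' • (x' - w') - l • (x - w)‖ ≤ l' * r₁ + l * r₁ :=
          (norm_sub_le _ _).trans (add_le_add he' he)
      _ ≤ (t + l' * (1 - t) - t * (1 - l)) * (r / 2) := by
          nlinarith [mul_le_mul_of_nonneg_left hr hl₀.le, mul_le_mul_of_nonneg_left hr' hl'₀.le]
  have hs : 0 ≤ t * (1 - l) := mul_nonneg h₀.le (by linarith)
  have hss' : t * (1 - l) < t + l' * (1 - t) := by
    nlinarith [mul_pos h₀ hl₀, mul_pos hl'₀ (sub_pos.2 h₁)]
  have hs' : t + l' * (1 - t) ≤ 1 := by nlinarith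
  have her : ‖l • (x - w)‖ < r / 2 := by nlinarith [h.pos]
  obtain ⟨p, hp, q, hq, hpz, hqz⟩ := exists_lineMap_eq_add (w := w) (w' := w') hs hss' hs' her hee'
  have hz : lineMap (lineMap w w' t) x l = lineMap p q (t * (1 - l)) := by
    rw [hpz]
    simp only [AffineMap.lineMap_apply_module]
    module
  have hz' : lineMap (lineMap w w' t) x' l' = lineMap p q (t + l' * (1 - t)) := by
    rw [hqz]
    simp only [AffineMap.lineMap_apply_module]
    module
  rw [hz, hz']
  exact (h.move p hp q hq).mono (lineMap_mem_segment p q hs (hss'.le.trans hs'))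
    (lineMap_mem_segment p q (hs.trans hss'.le) hs')

/-- A point `a` at which the observation can be changed from that of `w` to that of `w'`: the cones
with apex `a` over the balls of radius `r` around `w` and `w'` carry these observations, and every
straight line from the first cone to the second one is a move. -/
structure IsApex (S : Scene d N W) (w w' a : Pos d N) (r : ℝ) : Prop where
  left : ∀ z ∈ cone a (Metric.ball w r), z ∈ S.freeN ∧ S.label z = S.label w
  right : ∀ z ∈ cone a (Metric.ball w' r), z ∈ S.freeN ∧ S.label z = S.label w'
  cross : ∀ z ∈ cone a (Metric.ball w r), ∀ z' ∈ cone a (Metric.ball w' r), S.MoveN z z'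

theorem IsApex.mono {a : Pos d N} (h : IsApex S w w' a r) {r' : ℝ} (hr : r' ≤ r) :
    IsApex S w w' a r' :=
  have hcone : ∀ v, cone a (Metric.ball v r') ⊆ cone a (Metric.ball v r) := fun _ =>
    cone_mono _ (Metric.ball_subset_ball hr)
  ⟨fun z hz => h.left z (hcone w hz), fun z hz => h.right z (hcone w' hz),
    fun z hz z' hz' => h.cross z (hcone w hz) z' (hcone w' hz')⟩

theorem Tube.exists_isApex (h : Tube S w w' r) : ∃ a, ∃ r₁ > 0, IsApex S w w' a r₁ := by
  obtain ⟨t, h₀, h₁, ht, ht'⟩ := h.exists_isTime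
  have h₁' : 0 < 1 - t := sub_pos.2 h₁
  obtain ⟨r₁, hr₁, hr, hr'⟩ : ∃ r₁ > 0, 2 * r₁ ≤ r * t ∧ 2 * r₁ ≤ r * (1 - t) := by
    have hr := h.pos
    refine ⟨min (r * t) (r * (1 - t)) / 2, by positivity, ?_, ?_⟩
    · linarith [min_le_left (r * t) (r * (1 - t))]
    · linarith [min_le_right (r * t) (r * (1 - t))]
  refine ⟨lineMap w w' t, r₁, hr₁, fun z hz => ?_, fun z hz => ?_,
    fun z hz z' hz' => h.moveN_of_mem_cone h₀ h₁ hr hr' hz hz'⟩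
  · exact h.mem_freeN_and_label_eq h₀ h₁ ht
      (cone_mono _ (Metric.ball_subset_ball (by linarith)) hz)
  · rw [← AffineMap.lineMap_apply_one_sub] at hz
    exact h.symm.mem_freeN_and_label_eq h₁' (by linarith) ht'
      (cone_mono _ (Metric.ball_subset_ball (by linarith)) hz)

end

/-! ### A corridor around a plan -/

theorem exists_uniform_radius {ι β : Type*} {f : ι → β} (hf : (Set.range f).Finite)
    {P : β → ℝ → Prop} (hP : ∀ b, Antitone (P b)) (h : ∀ k, ∃ r > 0, P (f k) r) :
    ∃ r > 0, ∀ k, P (f k) r := by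
  have hev : ∀ b ∈ Set.range f, ∀ᶠ r in 𝓝[>] (0 : ℝ), P b r := by
    rintro _ ⟨k, rfl⟩
    obtain ⟨r, hr, hk⟩ := h k
    filter_upwards [Ioc_mem_nhdsGT hr] with r' hr' using hP _ hr'.2 hk
  obtain ⟨r, hr, hr₀⟩ := ((hf.eventually_all.2 hev).and self_mem_nhdsWithin).exists
  exact ⟨r, hr₀, fun k => hr _ ⟨k, rfl⟩⟩

theorem exists_uniform_choice {ι β γ : Type*} {f : ι → β} (hf : (Set.range f).Finite)
    {P : β → γ → ℝ → Prop} (hP : ∀ b c, Antitone (P b c)) (h : ∀ k, ∃ c, ∃ r > 0, P (f k) c r) :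
    ∃ c : ι → γ, ∃ r > 0, (Set.range c).Finite ∧ ∀ k, P (f k) (c k) r := by
  have := hf.to_subtype
  have hc : ∀ b : Set.range f, ∃ c, ∃ r > 0, P b c r := by
    rintro ⟨_, k, rfl⟩
    exact h k
  choose c hc using hc
  obtain ⟨r, hr, hcr⟩ := exists_uniform_radius (f := Set.rangeFactorization f) (Set.toFinite _)
    (P := fun b => P b (c b)) (fun _ => hP _ _) (fun k => hc _)
  exact ⟨fun k => c (Set.rangeFactorization f k), r, hr,
    (Set.finite_range c).subset (Set.range_comp_subset_range (Set.rangeFactorization f) c), hcr⟩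

section

variable {d N W : ℕ} {Q : Type*} {S : Scene d N W}

theorem dist_pos_le {x y : Pos d N} {c : ℝ} (h : ∀ i, dist (x i) (y i) ≤ c) :
    dist x y ≤ N * c := by
  rw [PiLp.dist_eq_of_L2]
  calc √(∑ i, dist (x i) (y i) ^ 2) ≤ ∑ i, dist (x i) (y i) :=
        Real.sqrt_le_left (Finset.sum_nonneg fun i _ => dist_nonneg) |>.mpr
          (Finset.sum_sq_le_sq_sum_of_nonneg fun i _ => dist_nonneg)
    _ ≤ N * c := by simpa using Finset.sum_le_card_nsmul Finset.univ _ c fun i _ => h i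

theorem Plan.finite_range_seq (τ : Plan d N) : (Set.range τ.seq).Finite := by
  have hget : ∀ (l : List (Pos d N)) n, l.getD n 0 ∈ insert 0 {x | x ∈ l} := by
    intro l n
    rcases lt_or_ge n l.length with h | h
    · exact Or.inr (List.getD_eq_getElem l 0 h ▸ List.getElem_mem h)
    · exact Or.inl (List.getD_eq_default l 0 h)
  refine ((τ.pre.finite_toSet.insert 0).union (τ.suf.finite_toSet.insert 0)).subset ?_
  rintro _ ⟨k, rfl⟩
  unfold Plan.seq
  split_ifs
  · exact Or.inl (hget _ _)
  · exact Or.inr (hget _ _)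

/-- The neighbourhood condition along a sequence of positions, with one radius and without Büchi
states. -/
structure IsConvergenceRadius (S : Scene d N W) (p : ℕ → Pos d N) (δ : ℝ) : Prop where
  pos : 0 < δ
  label : ∀ k, ∀ x ∈ S.freeN, dist x (p k) < δ → S.label x = S.label (p k)
  move : ∀ k, ∀ x ∈ S.freeN, ∀ y ∈ S.freeN, dist x (p k) < δ → dist y (p (k + 1)) < δ → S.MoveN x y
  label_segment : ∀ k, ∀ x ∈ S.freeN, ∀ y ∈ S.freeN, dist x (p k) < δ → dist y (p (k + 1)) < δ →
    ∀ z ∈ segment ℝ x y, S.label z = S.label (p k) ∨ S.label z = S.label (p (k + 1))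

theorem Scene.ConvergenceSpace.exists_isConvergenceRadius {B : NBA Q (AP N W)} {τ : Plan d N}
    (h : S.ConvergenceSpace B τ) (hτ : ∀ k, τ.seq k ∈ S.freeN) :
    ∃ δ, IsConvergenceRadius S τ.seq δ := by
  obtain ⟨q, -, ε, hε, h⟩ := h
  have hfin : (Set.range fun k => (τ.seq k, τ.seq (k + 1))).Finite :=
    (τ.finite_range_seq.prod (τ.finite_range_seq.subset
      (Set.range_comp_subset_range (· + 1) τ.seq))).subset (Set.range_pair_subset _ _)
  obtain ⟨δ, hδ, hall⟩ := exists_uniform_radius hfin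
    (P := fun p r => ∀ x ∈ S.freeN, ∀ y ∈ S.freeN, dist x p.1 < r → dist y p.2 < r →
      S.label x = S.label p.1 ∧ S.MoveN x y ∧
        ∀ z ∈ segment ℝ x y, S.label z = S.label p.1 ∨ S.label z = S.label p.2)
    (fun p r r' hr hp x hx y hy hxr hyr => hp x hx y hy (hxr.trans_le hr) (hyr.trans_le hr))
    (fun k => ⟨min (ε k) (ε (k + 1)), lt_min (hε k) (hε (k + 1)), fun x hx y hy hxk hyk =>
      have hk := h k x hx y hy (hxk.trans_le (min_le_left _ _)) (hyk.trans_le (min_le_right _ _))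
      ⟨hk.1, hk.2.1.1, hk.2.2⟩⟩)
  exact ⟨δ, hδ, fun k x hx hxk => (hall k x hx _ (hτ (k + 1)) hxk (by rwa [dist_self])).1,
    fun k x hx y hy hxk hyk => (hall k x hx y hy hxk hyk).2.1,
    fun k x hx y hy hxk hyk => (hall k x hx y hy hxk hyk).2.2⟩

theorem IsConvergenceRadius.tube {p : ℕ → Pos d N} {δ : ℝ} (h : IsConvergenceRadius S p δ) {k : ℕ}
    {w w' : Pos d N} {ρ : ℝ} (hρ : 0 < ρ)
    (hw : ∀ z ∈ Metric.ball w ρ, z ∈ S.freeN ∧ dist z (p k) < δ)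
    (hw' : ∀ z ∈ Metric.ball w' ρ, z ∈ S.freeN ∧ dist z (p (k + 1)) < δ) : Tube S w w' ρ := by
  have hl : ∀ x ∈ Metric.ball w ρ, S.label x = S.label (p k) := fun x hx =>
    h.label k x (hw x hx).1 (hw x hx).2
  have hl' : ∀ x ∈ Metric.ball w' ρ, S.label x = S.label (p (k + 1)) := fun x hx =>
    h.label (k + 1) x (hw' x hx).1 (hw' x hx).2
  refine ⟨hρ, fun x hx => ?_, fun x hx => ?_, fun x hx y hy => ?_, fun x hx y hy => ?_⟩
  · rw [hl x hx, hl w (Metric.mem_ball_self hρ)]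
  · rw [hl' x hx, hl' w' (Metric.mem_ball_self hρ)]
  · exact h.move k x (hw x hx).1 y (hw' y hy).1 (hw x hx).2 (hw' y hy).2
  · rw [hl w (Metric.mem_ball_self hρ), hl' w' (Metric.mem_ball_self hρ)]
    exact h.label_segment k x (hw x hx).1 y (hw' y hy).1 (hw x hx).2 (hw' y hy).2

theorem Scene.SolidFree.subset_closure_interior (h : S.SolidFree) :
    S.freeN ⊆ closure (interior S.freeN) := by
  let e := (PiLp.continuousLinearEquiv 2 ℝ fun _ : Fin N => Pt d).toHomeomorph
  have hfree : S.freeN = e ⁻¹' Set.univ.pi fun _ => S.free := by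
    ext x
    simp [e, Scene.freeN]
  rw [hfree, ← e.preimage_interior, ← e.preimage_closure, interior_pi_set Set.finite_univ,
    closure_pi_set]
  exact Set.preimage_mono (Set.pi_mono fun _ _ => h)

theorem Scene.SolidFree.exists_ball (h : S.SolidFree) {p : Pos d N} (hp : p ∈ S.freeN) {ε : ℝ}
    (hε : 0 < ε) : ∃ w, ∃ r > 0, Metric.ball w r ⊆ S.freeN ∩ Metric.ball p ε := by
  obtain ⟨w, hw, hwp⟩ := Metric.mem_closure_iff.1 (h.subset_closure_interior hp) ε hε
  exact ⟨w, Metric.isOpen_iff.1 (isOpen_interior.inter Metric.isOpen_ball) w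
    ⟨hw, Metric.mem_ball'.2 hwp⟩ |>.imp fun r hr =>
      ⟨hr.1, hr.2.trans (Set.inter_subset_inter_left _ interior_subset)⟩⟩

theorem Scene.exists_first_waypoint {x₀ w₁ : Pos d N} {ρ₀ δ : ℝ} (hρ₀ : 0 < ρ₀) (hδ : 0 < δ)
    (hmove : ∀ y ∈ Metric.ball w₁ ρ₀, S.MoveN x₀ y) :
    ∃ w₀, ∃ ρ > 0, ρ ≤ ρ₀ ∧ ∀ z ∈ cone x₀ (Metric.ball w₀ ρ), S.MoveN x₀ z ∧ dist z x₀ < δ := by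
  obtain ⟨c, hc, hcδ⟩ := exists_pos_mul_lt hδ (dist x₀ w₁ + ρ₀)
  set t := min c 1
  have ht : t ∈ Set.Ioc (0 : ℝ) 1 := ⟨lt_min hc one_pos, min_le_right _ _⟩
  have htδ : (dist x₀ w₁ + ρ₀) * t < δ :=
    (mul_le_mul_of_nonneg_left (min_le_left c 1) (by positivity)).trans_lt hcδ
  refine ⟨lineMap x₀ w₁ t, t * ρ₀, mul_pos ht.1 hρ₀, mul_le_of_le_one_left hρ₀.le ht.2, ?_⟩
  rintro _ ⟨x, hx, l, hl, rfl⟩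
  obtain ⟨y, hy, s, hs, rfl⟩ := ball_subset_cone x₀ w₁ ht ρ₀ hx
  refine ⟨(hmove y hy).mono (left_mem_segment ℝ _ _) ?_, ?_⟩
  · rw [AffineMap.lineMap_lineMap_right]
    exact lineMap_mem_segment x₀ y (mul_nonneg hl.1.le hs.1.le) (mul_le_one₀ hl.2 hs.1.le hs.2)
  · have htri := dist_triangle (lineMap x₀ y s) (lineMap x₀ w₁ t) x₀
    rw [dist_lineMap_left x₀ w₁, Real.norm_of_nonneg ht.1.le] at htri
    calc dist (lineMap x₀ (lineMap x₀ y s) l) x₀ ≤ dist (lineMap x₀ y s) x₀ := by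
          rw [dist_lineMap_left, Real.norm_of_nonneg hl.1.le, dist_comm x₀]
          exact mul_le_of_le_one_left dist_nonneg hl.2
      _ < δ := by linarith [Metric.mem_ball.1 hx]

-- The initial position may be on the boundary of the free space, hence the cone.
theorem IsConvergenceRadius.exists_waypoints (hfree : S.SolidFree) {p : ℕ → Pos d N} {δ : ℝ}
    (hfin : (Set.range p).Finite) (hp : ∀ k, p k ∈ S.freeN) (h : IsConvergenceRadius S p δ) :
    ∃ w : ℕ → Pos d N, ∃ ρ > 0, (Set.range w).Finite ∧
      (∀ k, ∀ z ∈ Metric.ball (w k) ρ, z ∈ S.freeN ∧ dist z (p k) < δ) ∧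
      ∀ z ∈ cone (p 0) (Metric.ball (w 0) ρ), S.MoveN (p 0) z ∧ dist z (p 0) < δ := by
  obtain ⟨v, ρ₀, hρ₀, hv, hball⟩ := exists_uniform_choice hfin
    (P := fun x w r => Metric.ball w r ⊆ S.freeN ∩ Metric.ball x δ)
    (fun x w r r' hr hw => (Metric.ball_subset_ball hr).trans hw)
    (fun k => hfree.exists_ball (hp k) h.pos)
  obtain ⟨w₀, ρ, hρ, hρρ₀, hcone⟩ := Scene.exists_first_waypoint (x₀ := p 0) hρ₀ h.pos
    fun y hy => h.move 0 _ (hp 0) y (hball 1 hy).1 (by rw [dist_self]; exact h.pos) (hball 1 hy).2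
  refine ⟨Function.update v 0 w₀, ρ, hρ, (hv.insert w₀).subset ?_, fun k z hz => ?_, ?_⟩
  · rintro _ ⟨k, rfl⟩
    rcases eq_or_ne k 0 with rfl | hk
    · exact Or.inl (Function.update_self ..)
    · exact Or.inr ⟨k, (Function.update_of_ne hk ..).symm⟩
  · rcases eq_or_ne k 0 with rfl | hk
    · rw [Function.update_self] at hz
      have hz' := hcone z (subset_cone _ _ hz)
      exact ⟨hz'.1.right_mem, hz'.2⟩
    · rw [Function.update_of_ne hk] at hz
      exact hball k (Metric.ball_subset_ball hρρ₀ hz)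
  · rwa [Function.update_self]

/-- The point from which the neighbourhood of the `k`-th waypoint is entered. -/
def entry (x₀ : Pos d N) (a : ℕ → Pos d N) : ℕ → Pos d N
  | 0 => x₀
  | k + 1 => a k

/-- Waypoints `w k`, together with points `a k` where the observation changes from `L k` to
`L (k + 1)`, and cones around the waypoints within and between which one can move. -/
structure Corridor (S : Scene d N W) (L : ℕ → Set (AP N W)) (w a : ℕ → Pos d N) (r : ℝ) : Prop where
  pos : 0 < r
  finite : (Set.range fun k => (w k, a k)).Finite
  label_entry : ∀ k, ∀ z ∈ cone (entry S.x₀ a k) (Metric.ball (w k) r), S.label z = L k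
  label_exit : ∀ k, ∀ z ∈ cone (a k) (Metric.ball (w k) r), S.label z = L k
  move_entry : ∀ k, ∀ z ∈ cone (entry S.x₀ a k) (Metric.ball (w k) r),
    ∀ z' ∈ cone (entry S.x₀ a k) (Metric.ball (w k) r), S.MoveN z z'
  move_exit : ∀ k, ∀ z ∈ cone (a k) (Metric.ball (w k) r),
    ∀ z' ∈ cone (a k) (Metric.ball (w k) r), S.MoveN z z'
  cross : ∀ k, ∀ z ∈ cone (a k) (Metric.ball (w k) r),
    ∀ z' ∈ cone (a k) (Metric.ball (w (k + 1)) r), S.MoveN z z'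
  label_init : S.label S.x₀ = L 0
  move_init : ∀ z ∈ cone S.x₀ (Metric.ball (w 0) r), S.MoveN S.x₀ z

theorem Corridor.of_isApex {L : ℕ → Set (AP N W)} {w a : ℕ → Pos d N} {r : ℝ} (hr : 0 < r)
    (hfin : (Set.range fun k => (w k, a k)).Finite) (hL : ∀ k, S.label (w k) = L k)
    (hapex : ∀ k, IsApex S (w k) (w (k + 1)) (a k) r) (hx₀ : S.label S.x₀ = L 0)
    (hcone : ∀ z ∈ cone S.x₀ (Metric.ball (w 0) r), S.MoveN S.x₀ z ∧ S.label z = L 0) :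
    Corridor S L w a r := by
  have hentry : ∀ k, ∀ z ∈ cone (entry S.x₀ a k) (Metric.ball (w k) r),
      z ∈ S.freeN ∧ S.label z = L k := by
    rintro (_ | k) z hz
    · exact ⟨(hcone z hz).1.right_mem, (hcone z hz).2⟩
    · exact hL (k + 1) ▸ (hapex k).right z hz
  have hexit : ∀ k, ∀ z ∈ cone (a k) (Metric.ball (w k) r), z ∈ S.freeN ∧ S.label z = L k :=
    fun k z hz => hL k ▸ (hapex k).left z hz
  have hmove : ∀ {b c l}, (∀ z ∈ cone b (Metric.ball c r), z ∈ S.freeN ∧ S.label z = l) →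
      ∀ z ∈ cone b (Metric.ball c r), ∀ z' ∈ cone b (Metric.ball c r), S.MoveN z z' :=
    fun h z hz z' hz' => Scene.moveN_of_convex (isOpen_cone _ Metric.isOpen_ball)
      (convex_cone _ (convex_ball _ _)) (fun z hz => (h z hz).1) (fun z hz => (h z hz).2) hz hz'
  exact ⟨hr, hfin, fun k z hz => (hentry k z hz).2, fun k z hz => (hexit k z hz).2,
    fun k => hmove (hentry k), fun k => hmove (hexit k), fun k => (hapex k).cross, hx₀,
    fun z hz => (hcone z hz).1⟩

theorem Scene.exists_corridor (hfree : S.SolidFree) {B : NBA Q (AP N W)} {τ : Plan d N}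
    (hτ : S.Feasible τ) (hC : S.ConvergenceSpace B τ) :
    ∃ w a r, Corridor S (S.trace τ) w a r := by
  obtain ⟨-, -, -, -, hx₀, hmove⟩ := hτ
  have hτ : ∀ k, τ.seq k ∈ S.freeN := fun k => (hmove k).left_mem
  obtain ⟨δ, hδ⟩ := hC.exists_isConvergenceRadius hτ
  obtain ⟨w, ρ, hρ, hwfin, hball, hcone⟩ := hδ.exists_waypoints hfree τ.finite_range_seq hτ
  have hwsucc : (Set.range fun k => w (k + 1)).Finite :=
    hwfin.subset (Set.range_comp_subset_range (· + 1) w)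
  obtain ⟨a, r, hr, hafin, hapex⟩ := exists_uniform_choice
    (f := fun k => (w k, w (k + 1))) ((hwfin.prod hwsucc).subset (Set.range_pair_subset _ _))
    (P := fun p a r => IsApex S p.1 p.2 a r) (fun p a r r' hr h => h.mono hr)
    (fun k => (hδ.tube hρ (hball k) (hball (k + 1))).exists_isApex)
  refine ⟨w, a, min r ρ, Corridor.of_isApex (lt_min hr hρ)
    ((hwfin.prod hafin).subset (Set.range_pair_subset _ _)) (fun k => ?_)
    (fun k => (hapex k).mono (min_le_left r ρ)) (by rw [← hx₀]; rfl) (fun z hz => ?_)⟩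
  · have hwk := hball k (w k) (Metric.mem_ball_self hρ)
    exact hδ.label k _ hwk.1 hwk.2
  · rw [← hx₀] at hz ⊢
    have hz' := hcone z (cone_mono _ (Metric.ball_subset_ball (min_le_right r ρ)) hz)
    exact ⟨hz'.1, hδ.label 0 z hz'.1.right_mem hz'.2⟩

end

/-! ### Runs over words with long blocks -/

theorem mul_add_div_of_lt {m k i : ℕ} (hi : i < m) : (m * k + i) / m = k := by
  rw [Nat.mul_add_div (by omega), Nat.div_eq_of_lt hi, Nat.add_zero]

theorem exists_eq_mul_add {m : ℕ} (hm : 0 < m) (n : ℕ) : ∃ k, ∃ i < m, n = m * k + i :=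
  ⟨n / m, n % m, Nat.mod_lt n hm, (Nat.div_add_mod n m).symm⟩

section

variable {Q P : Type*} {B : NBA Q P}

/-- `p` is a run from `b` to `b'` over the word `L ^ m`. -/
def NBA.BlockRun (B : NBA Q P) (m : ℕ) (L : Set P) (b b' : Q) (p : ℕ → Q) : Prop :=
  p 0 = b ∧ p m = b' ∧ ∀ i < m, B.trans (p i) L (p (i + 1))

/-- Between which states there are runs over `L ^ m`, and runs that visit an accepting state. As
there are only finitely many profiles, the length of a block can be changed without changing what
the automaton can do on it. -/
def NBA.profile (B : NBA Q P) (m : ℕ) : Set P → Q → Q → Prop × Prop := fun L b b' =>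
  (∃ p, B.BlockRun m L b b' p, ∃ p, B.BlockRun m L b b' p ∧ ∃ i < m, p i ∈ B.accept)

theorem NBA.exists_infinite_profile_eq [Finite Q] [Finite P] (B : NBA Q P) :
    ∃ m₀ > 0, {M : ℕ | B.profile (2 * M) = B.profile m₀}.Infinite := by
  obtain ⟨y, hy⟩ := Finite.exists_infinite_fiber fun M : ℕ => B.profile (2 * M)
  rw [Set.infinite_coe_iff] at hy
  obtain ⟨M₀, hM₀, hpos⟩ := hy.exists_gt 0
  exact ⟨2 * M₀, by omega, hy.mono fun M hM => Eq.trans hM (Eq.symm hM₀)⟩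

theorem NBA.exists_run_of_blockRun {m : ℕ} (hm : 0 < m) {σ : ℕ → Set P} {β : ℕ → Q}
    {p : ℕ → ℕ → Q} (hp : ∀ k, B.BlockRun m (σ k) (β k) (β (k + 1)) (p k)) :
    ∃ b : ℕ → Q, b 0 = β 0 ∧ (∀ n, B.trans (b n) (σ (n / m)) (b (n + 1))) ∧
      ∀ k, ∀ i < m, b (m * k + i) = p k i := by
  have hb : ∀ k, ∀ i < m, p ((m * k + i) / m) ((m * k + i) % m) = p k i := fun k i hi => by
    rw [mul_add_div_of_lt hi, Nat.mul_add_mod, Nat.mod_eq_of_lt hi]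
  refine ⟨fun n => p (n / m) (n % m), ?_, fun n => ?_, hb⟩
  · simpa only [Nat.zero_div, Nat.zero_mod] using (hp 0).1
  · obtain ⟨k, i, hi, rfl⟩ := exists_eq_mul_add hm n
    have hstep := (hp k).2.2 i hi
    beta_reduce
    rw [hb k i hi, mul_add_div_of_lt hi]
    rcases Nat.lt_or_eq_of_le (Nat.succ_le_of_lt hi) with h | h
    · rwa [Nat.add_assoc, hb k (i + 1) h]
    · rw [← Nat.succ_eq_add_one i, h, (hp k).2.1, ← (hp (k + 1)).1] at hstep
      rwa [show m * k + i + 1 = m * (k + 1) + 0 by rw [Nat.mul_add]; omega, hb (k + 1) 0 hm]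

theorem NBA.exists_run_of_profile_eq {m m₀ : ℕ} (hprof : B.profile m = B.profile m₀)
    {σ : ℕ → Set P} {β : ℕ → Q} (hβ : ∀ k, ∃ p, B.BlockRun m₀ (σ k) (β k) (β (k + 1)) p)
    {k₁ k₂ : ℕ} (hacc : ∃ p, B.BlockRun m₀ (σ k₁) (β k₁) (β (k₁ + 1)) p ∧
      ∃ i < m₀, p i ∈ B.accept)
    (hσ : σ k₁ = σ k₂) (h : β k₁ = β k₂) (h' : β (k₁ + 1) = β (k₂ + 1)) :
    ∃ b : ℕ → Q, ∃ i < m, b 0 = β 0 ∧ (∀ n, B.trans (b n) (σ (n / m)) (b (n + 1))) ∧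
      b (m * k₁ + i) ∈ B.accept ∧ b (m * k₂ + i) = b (m * k₁ + i) := by
  have hiff := fun L b b' => Prod.ext_iff.1 (congrFun (congrFun (congrFun hprof L) b) b')
  choose p hp using fun k => (hiff _ _ _).1.mpr (hβ k)
  obtain ⟨p₁, hp₁, i, hi, hi'⟩ := (hiff _ _ _).2.mpr hacc
  obtain ⟨b, hb₀, htrans, hb⟩ := NBA.exists_run_of_blockRun (B := B) (by omega : 0 < m) (σ := σ)
    (β := β) (p := fun k => if k = k₁ ∨ k = k₂ then p₁ else p k) (fun k => by
      split_ifs with hk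
      · rcases hk with rfl | rfl
        · exact hp₁
        · rwa [← hσ, ← h, ← h']
      · exact hp k)
  refine ⟨b, i, hi, hb₀, htrans, ?_, ?_⟩
  · rwa [hb k₁ i hi, if_pos (Or.inl rfl)]
  · rw [hb k₁ i hi, hb k₂ i hi, if_pos (Or.inl rfl), if_pos (Or.inr rfl)]

theorem NBA.IsAcceptingRun.infinite_blocks {σ : ℕ → Set P} {ρ : ℕ → Q} (h : B.IsAcceptingRun σ ρ)
    {m : ℕ} (hm : 0 < m) : {k | 1 ≤ k ∧ ∃ i < m, ρ (m * k + i) ∈ B.accept}.Infinite := by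
  obtain ⟨-, -, q, hq, hfreq⟩ := h
  have hblock : ∃ᶠ k in atTop, ∃ i < m, ρ (m * k + i) ∈ B.accept :=
    (isStutter_div hm).tendsto_atTop.frequently <| hfreq.mono fun n hn =>
      ⟨n % m, Nat.mod_lt n hm, by rwa [Nat.div_add_mod, hn]⟩
  exact Nat.frequently_atTop_iff_infinite.1
    ((hblock.and_eventually (eventually_ge_atTop 1)).mono fun _ => And.symm)

theorem NBA.IsAcceptingRun.blockRun {σ : ℕ → Set P} {ρ : ℕ → Q} {m : ℕ}
    (h : B.IsAcceptingRun (fun n => σ (n / m)) ρ) (k : ℕ) :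
    B.BlockRun m (σ k) (ρ (m * k)) (ρ (m * (k + 1))) (fun i => ρ (m * k + i)) :=
  ⟨rfl, rfl, fun i hi => by
    have htrans : B.trans (ρ (m * k + i)) (σ ((m * k + i) / m)) (ρ (m * k + i + 1)) :=
      h.2.1 (m * k + i)
    rwa [mul_add_div_of_lt hi] at htrans⟩

-- The cycle is found on blocks of length `m₀` and carried over to all blocks of the same profile.
theorem NBA.exists_uniform_blocks [Finite Q] [Finite P] {φ : LTL P}
    (hB : ∀ σ, B.Accepts σ ↔ φ.Sat σ) {σ : ℕ → Set P} (hσ : φ.Sat σ) {κ : Type*} {key : ℕ → κ}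
    (hkey : (Set.range key).Finite) :
    ∃ k₁ k₂, 1 ≤ k₁ ∧ k₁ < k₂ ∧ key k₁ = key k₂ ∧
      {M : ℕ | ∃ b : ℕ → Q, ∃ i < 2 * M, b 0 = B.init ∧
        (∀ n, B.trans (b n) (σ (n / (2 * M))) (b (n + 1))) ∧
        b (2 * M * k₁ + i) ∈ B.accept ∧
        b (2 * M * k₂ + i) = b (2 * M * k₁ + i)}.Infinite := by
  obtain ⟨m₀, hm₀, hprof⟩ := B.exists_infinite_profile_eq
  obtain ⟨ρ, hρ⟩ := (hB _).2 ((LTL.sat_comp_iff (isStutter_div hm₀) σ).2 hσ)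
  have hfin : (Set.range fun k => (key k, σ k, ρ (m₀ * k), ρ (m₀ * (k + 1)))).Finite :=
    (hkey.prod (Set.toFinite (Set.range fun k => (σ k, ρ (m₀ * k), ρ (m₀ * (k + 1)))))).subset
      (Set.range_pair_subset _ _)
  obtain ⟨k₁, ⟨hk₁, hacc⟩, k₂, -, hlt, heq⟩ :=
    (hρ.infinite_blocks hm₀).exists_lt_map_eq_of_mapsTo (fun k _ => Set.mem_range_self k) hfin
  simp only [Prod.mk.injEq] at heq
  obtain ⟨hkey₁₂, hσ₁₂, hρ₁₂, hρ₁₂'⟩ := heq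
  refine ⟨k₁, k₂, hk₁, hlt, hkey₁₂, hprof.mono fun M hM => ?_⟩
  obtain ⟨b, i, hi, hb₀, hb⟩ := NBA.exists_run_of_profile_eq hM (β := fun k => ρ (m₀ * k))
    (fun k => ⟨_, hρ.blockRun k⟩) ⟨_, hρ.blockRun k₁, hacc⟩ hσ₁₂ hρ₁₂ hρ₁₂'
  exact ⟨b, i, hi, hb₀.trans hρ.1, hb⟩

end

/-! ### Targets along a corridor -/

section

variable {d N W : ℕ} {S : Scene d N W} {L : ℕ → Set (AP N W)} {w a : ℕ → Pos d N}
  {x₀ : Pos d N} {r D : ℝ} {M n k i : ℕ}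

/-- The `i`-th of `2 * M` points that lead from the entry of the `k`-th neighbourhood to the
waypoint and on to its exit. -/
noncomputable def blockCenter (x₀ : Pos d N) (w a : ℕ → Pos d N) (M k i : ℕ) : Pos d N :=
  if i < M then lineMap (entry x₀ a k) (w k) (((i + 1 : ℕ) : ℝ) / M)
  else lineMap (a k) (w k) (((2 * M - i : ℕ) : ℝ) / M)

/-- The `n`-th point along the corridor, with `2 * M` points for every waypoint. -/
noncomputable def center (x₀ : Pos d N) (w a : ℕ → Pos d N) (M n : ℕ) : Pos d N :=
  blockCenter x₀ w a M (n / (2 * M)) (n % (2 * M))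

theorem center_mul_add (hi : i < 2 * M) :
    center x₀ w a M (2 * M * k + i) = blockCenter x₀ w a M k i := by
  rw [center, mul_add_div_of_lt hi, Nat.mul_add_mod, Nat.mod_eq_of_lt hi]

theorem div_mem_Icc {m M : ℕ} (h : 1 ≤ m) (hM : m ≤ M) : (m / M : ℝ) ∈ Set.Icc (1 / M : ℝ) 1 := by
  have hm : (1 : ℝ) ≤ m := by exact_mod_cast h
  exact ⟨by gcongr, div_le_one_of_le₀ (by exact_mod_cast hM) M.cast_nonneg⟩

theorem blockCenter_succ (x₀ : Pos d N) (w a : ℕ → Pos d N) (k : ℕ) (hi : i + 1 < 2 * M) :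
    ∃ c, (c = entry x₀ a k ∨ c = a k) ∧ ∃ s ∈ Set.Icc (1 / M : ℝ) 1, ∃ t ∈ Set.Icc (1 / M : ℝ) 1,
      dist s t ≤ 1 / M ∧ blockCenter x₀ w a M k i = lineMap c (w k) s ∧
      blockCenter x₀ w a M k (i + 1) = lineMap c (w k) t := by
  have hM : 0 < M := by omega
  have hdist : ∀ m : ℕ, dist (m / M : ℝ) ((m + 1 : ℕ) / M) ≤ 1 / M := fun m => by
    rw [Real.dist_eq, ← sub_div, abs_div, Nat.abs_cast]
    push_cast
    rw [sub_add_cancel_left, abs_neg, abs_one]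
  unfold blockCenter
  rcases lt_trichotomy (i + 1) M with h | h | h
  · rw [if_pos (by omega), if_pos h]
    exact ⟨_, .inl rfl, _, div_mem_Icc (by omega) (by omega), _, div_mem_Icc (by omega) h, hdist _,
      rfl, rfl⟩
  · have hM₁ : (M / M : ℝ) = 1 := div_self (by exact_mod_cast hM.ne')
    rw [if_pos (by omega), if_neg (by omega), h, show 2 * M - M = M by omega, hM₁]
    refine ⟨a k, .inr rfl, 1, hM₁ ▸ div_mem_Icc hM le_rfl, 1, hM₁ ▸ div_mem_Icc hM le_rfl, ?_⟩
    simp only [AffineMap.lineMap_apply_one, dist_self, and_self, and_true]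
    positivity
  · rw [if_neg (by omega), if_neg (by omega), show 2 * M - i = 2 * M - (i + 1) + 1 by omega]
    exact ⟨_, .inr rfl, _, div_mem_Icc (by omega) (by omega), _, div_mem_Icc (by omega) (by omega),
      (dist_comm _ _).trans_le (hdist _), rfl, rfl⟩

theorem blockCenter_last (x₀ : Pos d N) (w a : ℕ → Pos d N) (k : ℕ) (hi : i + 1 = 2 * M) :
    blockCenter x₀ w a M k i = lineMap (a k) (w k) (1 / M : ℝ) ∧
      blockCenter x₀ w a M (k + 1) 0 = lineMap (a k) (w (k + 1)) (1 / M : ℝ) := by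
  unfold blockCenter
  rw [if_neg (by omega), if_pos (by omega), show 2 * M - i = 1 by omega, zero_add,
    Nat.cast_one]
  exact ⟨rfl, rfl⟩

-- A step either stays within one cone or crosses from a cone to the next one through their common
-- apex.
theorem center_succ (x₀ : Pos d N) (w a : ℕ → Pos d N) (hM : 0 < M) (n : ℕ) :
    (∃ c, (c = entry x₀ a (n / (2 * M)) ∨ c = a (n / (2 * M))) ∧
      ∃ s ∈ Set.Icc (1 / M : ℝ) 1, ∃ t ∈ Set.Icc (1 / M : ℝ) 1, dist s t ≤ 1 / M ∧
        center x₀ w a M n = lineMap c (w (n / (2 * M))) s ∧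
        center x₀ w a M (n + 1) = lineMap c (w (n / (2 * M))) t) ∨
    (center x₀ w a M n = lineMap (a (n / (2 * M))) (w (n / (2 * M))) (1 / M : ℝ) ∧
      center x₀ w a M (n + 1) = lineMap (a (n / (2 * M))) (w (n / (2 * M) + 1)) (1 / M : ℝ)) := by
  obtain ⟨k, i, hi, rfl⟩ := exists_eq_mul_add (by omega : 0 < 2 * M) n
  rw [mul_add_div_of_lt hi, center_mul_add hi]
  rcases Nat.lt_or_eq_of_le (Nat.succ_le_of_lt hi) with h | h
  · left
    rw [Nat.add_assoc, center_mul_add h]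
    exact blockCenter_succ x₀ w a k h
  · right
    rw [show 2 * M * k + i + 1 = 2 * M * (k + 1) + 0 by rw [Nat.mul_add]; omega,
      center_mul_add (by omega)]
    exact blockCenter_last x₀ w a k h

theorem ball_div_subset_cone (hr : 0 ≤ r) (hM : 0 < M) (c v : Pos d N) {s : ℝ}
    (hs : s ∈ Set.Icc (1 / M : ℝ) 1) :
    Metric.ball (lineMap c v s) (r / M) ⊆ cone c (Metric.ball v r) := by
  have hM₀ : (0 : ℝ) < 1 / M := by positivity
  refine (Metric.ball_subset_ball ?_).trans (ball_subset_cone c v ⟨hM₀.trans_le hs.1, hs.2⟩ r)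
  rw [div_eq_mul_one_div, mul_comm]
  exact mul_le_mul_of_nonneg_right hs.1 hr

theorem Corridor.label_of_mem_ball_center (h : Corridor S L w a r) (hM : 0 < M) {z : Pos d N}
    (hz : z ∈ Metric.ball (center S.x₀ w a M n) (r / M)) : S.label z = L (n / (2 * M)) := by
  rcases center_succ S.x₀ w a hM n with ⟨c, hc, s, hs, -, -, -, hn, -⟩ | ⟨hn, -⟩
  · rw [hn] at hz
    have hzc := ball_div_subset_cone h.pos.le hM _ _ hs hz
    rcases hc with rfl | rfl
    · exact h.label_entry _ z hzc
    · exact h.label_exit _ z hzc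
  · rw [hn] at hz
    exact h.label_exit _ z (ball_div_subset_cone h.pos.le hM _ _
      (Nat.cast_one (R := ℝ) ▸ div_mem_Icc le_rfl hM) hz)

theorem Corridor.moveN_of_mem_ball_center (h : Corridor S L w a r) (hM : 0 < M) {z z' : Pos d N}
    (hz : z ∈ Metric.ball (center S.x₀ w a M n) (r / M))
    (hz' : z' ∈ Metric.ball (center S.x₀ w a M (n + 1)) (r / M)) : S.MoveN z z' := by
  rcases center_succ S.x₀ w a hM n with ⟨c, hc, s, hs, t, ht, -, hn, hn'⟩ | ⟨hn, hn'⟩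
  · rw [hn] at hz
    rw [hn'] at hz'
    have hzc := ball_div_subset_cone h.pos.le hM _ _ hs hz
    have hzc' := ball_div_subset_cone h.pos.le hM _ _ ht hz'
    rcases hc with rfl | rfl
    · exact h.move_entry _ z hzc z' hzc'
    · exact h.move_exit _ z hzc z' hzc'
  · rw [hn] at hz
    rw [hn'] at hz'
    have hs : (1 / M : ℝ) ∈ Set.Icc (1 / M : ℝ) 1 := Nat.cast_one (R := ℝ) ▸ div_mem_Icc le_rfl hM
    exact h.cross _ z (ball_div_subset_cone h.pos.le hM _ _ hs hz) z'
      (ball_div_subset_cone h.pos.le hM _ _ hs hz')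

theorem Corridor.finite_waypoints (h : Corridor S L w a r) : (Set.range w).Finite :=
  (h.finite.image Prod.fst).subset <| by rw [← Set.range_comp]; rfl

theorem Corridor.finite_apexes (h : Corridor S L w a r) : (Set.range a).Finite :=
  (h.finite.image Prod.snd).subset <| by rw [← Set.range_comp]; rfl

theorem Corridor.finite_entries (h : Corridor S L w a r) : (Set.range (entry S.x₀ a)).Finite := by
  refine (h.finite_apexes.insert S.x₀).subset ?_
  rintro _ ⟨_ | k, rfl⟩
  · exact Or.inl rfl
  · exact Or.inr ⟨k, rfl⟩

theorem Corridor.exists_bound (h : Corridor S L w a r) :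
    ∃ D, ∀ k, dist (a k) (w k) ≤ D ∧ dist (entry S.x₀ a k) (w k) ≤ D := by
  obtain ⟨D, hD⟩ := Metric.isBounded_iff.1
    (h.finite_waypoints.union (h.finite_apexes.union h.finite_entries)).isBounded
  exact ⟨D, fun k => ⟨hD (.inr (.inl ⟨k, rfl⟩)) (.inl ⟨k, rfl⟩),
    hD (.inr (.inr ⟨k, rfl⟩)) (.inl ⟨k, rfl⟩)⟩⟩

theorem dist_center_succ (hD : ∀ k, dist (a k) (w k) ≤ D ∧ dist (entry x₀ a k) (w k) ≤ D)
    (hM : 0 < M) (n : ℕ) :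
    dist (center x₀ w a M n) (center x₀ w a M (n + 1)) ≤ 2 * D / M := by
  have hD₀ : 0 ≤ D := dist_nonneg.trans (hD 0).1
  set k := n / (2 * M)
  rcases center_succ x₀ w a hM n with ⟨c, hc, s, -, t, -, hst, hn, hn'⟩ | ⟨hn, hn'⟩
  · have hcD : dist c (w k) ≤ D := by
      rcases hc with rfl | rfl
      exacts [(hD k).2, (hD k).1]
    rw [hn, hn', dist_lineMap_lineMap]
    calc dist s t * dist c (w k) ≤ 1 / M * D := by gcongr
      _ ≤ 2 * D / M := by rw [one_div_mul_eq_div]; gcongr; linarith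
  · rw [hn, hn']
    calc _ ≤ dist (lineMap (a k) (w k) (1 / M : ℝ)) (a k) +
            dist (a k) (lineMap (a k) (w (k + 1)) (1 / M : ℝ)) := dist_triangle _ _ _
      _ = 1 / M * (dist (a k) (w k) + dist (a k) (w (k + 1))) := by
          rw [dist_lineMap_left, dist_left_lineMap, Real.norm_of_nonneg (by positivity), mul_add]
      _ ≤ 1 / M * (D + D) := by gcongr; exacts [(hD k).1, (hD (k + 1)).2]
      _ = 2 * D / M := by ring

theorem dist_le_of_mem_balls {x y c c' : Pos d N} {s D : ℝ} (hx : x ∈ Metric.ball c s)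
    (hy : y ∈ Metric.ball c' s) (h : dist c c' ≤ D) : dist x y ≤ D + 2 * s := by
  have htri := dist_triangle4 x c c' y
  rw [Metric.mem_ball] at hx
  rw [Metric.mem_ball'] at hy
  linarith

theorem center_one (x₀ : Pos d N) (w a : ℕ → Pos d N) (hM : 2 ≤ M) :
    center x₀ w a M 1 = lineMap x₀ (w 0) ((2 : ℕ) / M : ℝ) := by
  rw [show 1 = 2 * M * 0 + 1 by omega, center_mul_add (by omega), blockCenter, if_pos (by omega)]
  rfl

theorem Corridor.moveN_init (h : Corridor S L w a r) (hM : 2 ≤ M) {z : Pos d N}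
    (hz : z ∈ Metric.ball (center S.x₀ w a M 1) (r / M)) : S.MoveN S.x₀ z := by
  rw [center_one S.x₀ w a hM] at hz
  exact h.move_init z (ball_div_subset_cone h.pos.le (by omega) _ _ (div_mem_Icc one_le_two hM) hz)

theorem Corridor.init_mem_freeN (h : Corridor S L w a r) : S.x₀ ∈ S.freeN :=
  (h.moveN_init le_rfl (Metric.mem_ball_self (div_pos h.pos (by positivity)))).left_mem

theorem dist_center_one (hD : ∀ k, dist (a k) (w k) ≤ D ∧ dist (entry x₀ a k) (w k) ≤ D)
    (hM : 2 ≤ M) : dist x₀ (center x₀ w a M 1) ≤ 2 * D / M := by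
  rw [center_one x₀ w a hM, dist_left_lineMap, Real.norm_of_nonneg (by positivity), Nat.cast_two,
    div_mul_eq_mul_div]
  gcongr
  exact (hD 0).2

/-- A product of balls. -/
def box (c : Pos d N) (ε : ℝ) : Set (Pos d N) := {z | ∀ i, dist (z i) (c i) < ε}

theorem box_subset_ball (hN : 0 < N) (c : Pos d N) {s : ℝ} (hs : 0 < s) :
    box c (s / (2 * N)) ⊆ Metric.ball c s := by
  intro z hz
  have : (0 : ℝ) < N := by exact_mod_cast hN
  calc dist z c ≤ N * (s / (2 * N)) := dist_pos_le fun i => (hz i).le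
    _ = s / 2 := by field_simp
    _ < s := half_lt_self hs

theorem ball_subset_free_of_box {c : Pos d N} {ε : ℝ} (hε : 0 < ε) (h : box c ε ⊆ S.freeN)
    (i : Fin N) : Metric.ball (c i) ε ⊆ S.free := by
  classical
  intro p hp
  have hbox : (WithLp.toLp 2 (Function.update (WithLp.ofLp c) i p) : Pos d N) ∈ box c ε := by
    intro j
    rcases eq_or_ne j i with rfl | hj
    · simpa using hp
    · simpa [Function.update_of_ne hj] using hε
  simpa using h hbox i

/-- The sets that the samples have to hit, one after the other; the initial position comes first and
need not be hit. -/
def target (x₀ : Pos d N) (w a : ℕ → Pos d N) (r : ℝ) (M n : ℕ) : Set (Pos d N) :=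
  if n = 0 then {x₀} else box (center x₀ w a M n) (r / M / (2 * N))

theorem target_of_pos (hn : 0 < n) :
    target x₀ w a r M n = box (center x₀ w a M n) (r / M / (2 * N)) :=
  if_neg hn.ne'

theorem Corridor.target_subset_ball (h : Corridor S L w a r) (hN : 0 < N) (hM : 0 < M)
    (hn : 0 < n) : target S.x₀ w a r M n ⊆ Metric.ball (center S.x₀ w a M n) (r / M) := by
  rw [target_of_pos hn]
  exact box_subset_ball hN _ (div_pos h.pos (by exact_mod_cast hM))

theorem Corridor.target_subset_freeN (h : Corridor S L w a r) (hN : 0 < N) (hM : 0 < M)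
    (hn : 0 < n) : target S.x₀ w a r M n ⊆ S.freeN := fun z hz =>
  (h.moveN_of_mem_ball_center hM (h.target_subset_ball hN hM hn hz)
    (Metric.mem_ball_self (div_pos h.pos (by exact_mod_cast hM)))).left_mem

variable {Q : Type*} {B : NBA Q (AP N W)} {b : ℕ → Q}

theorem Corridor.step_target (h : Corridor S L w a r) (hN : 0 < N)
    (hD : ∀ k, dist (a k) (w k) ≤ D ∧ dist (entry S.x₀ a k) (w k) ≤ D) (hM : 2 ≤ M)
    (hb : ∀ n, B.trans (b n) (L (n / (2 * M))) (b (n + 1))) (n : ℕ) {x y : Pos d N}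
    (hx : x ∈ target S.x₀ w a r M n) (hy : y ∈ target S.x₀ w a r M (n + 1)) :
    S.Step B (x, b n) (y, b (n + 1)) ∧ dist x y ≤ 2 * D / M + 2 * (r / M) := by
  have hM₀ : 0 < M := by omega
  have hy' := h.target_subset_ball hN hM₀ n.succ_pos hy
  rcases n.eq_zero_or_pos with rfl | hn
  · obtain rfl : x = S.x₀ := by simpa [target] using hx
    refine ⟨⟨h.moveN_init hM hy', ?_⟩, dist_le_of_mem_balls
      (Metric.mem_ball_self (div_pos h.pos (by exact_mod_cast hM₀))) hy' (dist_center_one hD hM)⟩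
    rw [h.label_init]
    simpa only [Nat.zero_div] using hb 0
  · have hx' := h.target_subset_ball hN hM₀ hn hx
    refine ⟨⟨h.moveN_of_mem_ball_center hM₀ hx' hy', ?_⟩,
      dist_le_of_mem_balls hx' hy' (dist_center_succ hD hM₀ n)⟩
    rw [h.label_of_mem_ball_center hM₀ hx']
    exact hb n

theorem target_congr {k' : ℕ} (hk : 0 < k) (hk' : 0 < k') (hi : i < 2 * M) (hw : w k = w k')
    (ha : a k = a k') (hentry : entry x₀ a k = entry x₀ a k') :
    target x₀ w a r M (2 * M * k + i) = target x₀ w a r M (2 * M * k' + i) := by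
  have hM : 0 < 2 * M := by omega
  rw [target_of_pos (Nat.add_pos_left (Nat.mul_pos hM hk) i),
    target_of_pos (Nat.add_pos_left (Nat.mul_pos hM hk') i), center_mul_add hi, center_mul_add hi,
    blockCenter, blockCenter, hw, ha, hentry]

end

/-! ### Hitting targets in a given order at random -/

section

variable {α : Type*} {G : ℕ → Set α}

theorem stage_lt_succ_iff (G : ℕ → Set α) (y : ℕ → α) (t H : ℕ) :
    stage G y (t + 1) < H + 1 ↔ stage G y t < H + 1 ∧ ¬(stage G y t = H ∧ y t ∈ G H) := by
  rw [stage]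
  by_cases h : stage G y t = H
  · subst h
    split_ifs with h' <;> simp [h']
  · split_ifs <;> omega

theorem stage_eq_zero {y : ℕ → α} (h : ∀ s, y s ∉ G 0) (t : ℕ) : stage G y t = 0 := by
  induction t with
  | zero => rfl
  | succ t ih => rw [stage, ih, if_neg (h t)]

variable {Ω : Type*} [MeasurableSpace Ω] [MeasurableSpace α] {μ : Measure Ω} {Y : ℕ → Ω → α}
  {p : ℝ} {t H : ℕ}

theorem measurable_stage (hG : ∀ j, MeasurableSet (G j)) (hY : ∀ s < t, Measurable (Y s)) :
    Measurable fun ω => stage G (fun s => Y s ω) t := by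
  induction t with
  | zero => exact measurable_const
  | succ t ih =>
    have hstage := ih fun s hs => hY s (by omega)
    have hhit : MeasurableSet {ω | Y t ω ∈ G (stage G (fun s => Y s ω) t)} := by
      have heq : {ω | Y t ω ∈ G (stage G (fun s => Y s ω) t)} =
          ⋃ j, {ω | stage G (fun s => Y s ω) t = j} ∩ Y t ⁻¹' G j := by
        ext ω
        simp
      rw [heq]
      exact .iUnion fun j => (hstage (measurableSet_singleton j)).inter
        (hY t t.lt_succ_self (hG j))
    exact .ite hhit (hstage.add_const 1) hstage

/-- Every term of the sequence is independent of the terms before it. -/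
def IndepOfPast (Y : ℕ → Ω → α) (μ : Measure Ω) : Prop :=
  ∀ t, Indep (⨆ s ∈ Set.Iio t, MeasurableSpace.comap (Y s) inferInstance)
    (MeasurableSpace.comap (Y t) inferInstance) μ

theorem IndepOfPast.measureReal_stage_eq_inter (h : IndepOfPast Y μ)
    (hG : ∀ j, MeasurableSet (G j)) (t H : ℕ) :
    μ.real ({ω | stage G (fun s => Y s ω) t = H} ∩ Y t ⁻¹' G H) =
      μ.real {ω | stage G (fun s => Y s ω) t = H} * μ.real (Y t ⁻¹' G H) := by
  have hstage : Measurable[⨆ s ∈ Set.Iio t, MeasurableSpace.comap (Y s) inferInstance]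
      fun ω => stage G (fun s => Y s ω) t :=
    @measurable_stage _ _ _ (_) _ _ _ hG fun s hs =>
      (comap_measurable (Y s)).mono (le_iSup₂_of_le s hs le_rfl) le_rfl
  have hmul := (Indep_iff _ _ μ).1 (h t) {ω | stage G (fun s => Y s ω) t = H} (Y t ⁻¹' G H)
    (hstage (measurableSet_singleton H)) ⟨_, hG H, rfl⟩
  simp only [measureReal_def, hmul, ENNReal.toReal_mul]

theorem IndepOfPast.measureReal_stage_lt_succ_le [IsFiniteMeasure μ] (h : IndepOfPast Y μ)
    (hY : ∀ t, Measurable (Y t)) (hG : ∀ j, MeasurableSet (G j))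
    (hp : p ≤ μ.real (Y t ⁻¹' G H)) :
    μ.real {ω | stage G (fun s => Y s ω) (t + 1) < H + 1} ≤
      (1 - p) * μ.real {ω | stage G (fun s => Y s ω) t < H + 1} +
        p * μ.real {ω | stage G (fun s => Y s ω) t < H} := by
  have hstage : Measurable fun ω => stage G (fun s => Y s ω) t :=
    measurable_stage hG fun s _ => hY s
  have hlt : μ.real {ω | stage G (fun s => Y s ω) t = H} =
      μ.real {ω | stage G (fun s => Y s ω) t < H + 1} -
        μ.real {ω | stage G (fun s => Y s ω) t < H} := by
    have hmono : {ω | stage G (fun s => Y s ω) t < H} ⊆ {ω | stage G (fun s => Y s ω) t < H + 1} :=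
      fun _ hω => Nat.lt_succ_of_lt hω
    have hmeas : MeasurableSet {ω | stage G (fun s => Y s ω) t < H} := hstage measurableSet_Iio
    rw [← measureReal_sdiff hmono hmeas]
    congr 1
    ext ω
    simp only [Set.mem_ofPred_eq, Set.mem_sdiff]
    omega
  have hsucc : {ω | stage G (fun s => Y s ω) (t + 1) < H + 1} =
      {ω | stage G (fun s => Y s ω) t < H + 1} \
        ({ω | stage G (fun s => Y s ω) t = H} ∩ Y t ⁻¹' G H) := by
    ext ω
    exact stage_lt_succ_iff G _ t H
  have hhit : {ω | stage G (fun s => Y s ω) t = H} ∩ Y t ⁻¹' G H ⊆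
      {ω | stage G (fun s => Y s ω) t < H + 1} := fun _ hω => Nat.lt_succ_of_le hω.1.le
  have hmeas : MeasurableSet ({ω | stage G (fun s => Y s ω) t = H} ∩ Y t ⁻¹' G H) :=
    (hstage (measurableSet_singleton H)).inter (hY t (hG H))
  rw [hsucc, measureReal_sdiff hhit hmeas, h.measureReal_stage_eq_inter hG]
  have hmul := mul_le_mul_of_nonneg_left hp
    (measureReal_nonneg (μ := μ) (s := {ω | stage G (fun s => Y s ω) t = H}))
  rw [hlt] at hmul ⊢
  linarith

-- Chernoff's bound: the right-hand side is `2 ^ H` times a bound for the mean of `2 ^ (-stage)`.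
theorem IndepOfPast.measureReal_stage_lt_le [IsProbabilityMeasure μ] (h : IndepOfPast Y μ)
    (hY : ∀ t, Measurable (Y t)) (hG : ∀ j, MeasurableSet (G j)) (hp₀ : 0 ≤ p)
    (hp : ∀ t j, p ≤ μ.real (Y t ⁻¹' G j)) (t H : ℕ) :
    μ.real {ω | stage G (fun s => Y s ω) t < H} ≤ 2 ^ H * (1 - p / 2) ^ t := by
  have hp₁ : p ≤ 1 := (hp 0 0).trans measureReal_le_one
  have hq : 0 ≤ 1 - p / 2 := by linarith
  induction t generalizing H with
  | zero =>
    rw [pow_zero, mul_one]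
    exact measureReal_le_one.trans (one_le_pow₀ one_le_two)
  | succ t ih =>
    cases H with
    | zero =>
      simp only [not_lt_zero, Set.ofPred_false, measureReal_empty]
      positivity
    | succ H =>
      calc _ ≤ _ := h.measureReal_stage_lt_succ_le hY hG (hp t H)
        _ ≤ (1 - p) * (2 ^ (H + 1) * (1 - p / 2) ^ t) + p * (2 ^ H * (1 - p / 2) ^ t) :=
            add_le_add (mul_le_mul_of_nonneg_left (ih (H + 1)) (by linarith))
              (mul_le_mul_of_nonneg_left (ih H) hp₀)
        _ = 2 ^ (H + 1) * (1 - p / 2) ^ (t + 1) := by ring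

theorem IndepOfPast.ae_exists_mem [IsProbabilityMeasure μ] (h : IndepOfPast Y μ)
    (hY : ∀ t, Measurable (Y t)) {s : Set α} (hs : MeasurableSet s) (hp₀ : 0 < p)
    (hp : ∀ t, p ≤ μ.real (Y t ⁻¹' s)) : ∀ᵐ ω ∂μ, ∃ t, Y t ω ∈ s := by
  have hle : ∀ t : ℕ, μ.real {ω | ¬∃ t, Y t ω ∈ s} ≤ 2 ^ 1 * (1 - p / 2) ^ t := fun t => by
    refine (measureReal_mono fun ω hω => ?_).trans
      (h.measureReal_stage_lt_le (G := fun _ => s) hY (fun _ => hs) hp₀.le (fun t _ => hp t) t 1)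
    exact (stage_eq_zero (G := fun _ => s) (not_exists.1 hω) t).trans_lt one_pos
  have hp₁ : p ≤ 1 := (hp 0).trans measureReal_le_one
  have hlim : Tendsto (fun t : ℕ => (2 : ℝ) ^ 1 * (1 - p / 2) ^ t) atTop (𝓝 0) := by
    rw [← mul_zero ((2 : ℝ) ^ 1)]
    exact (tendsto_pow_atTop_nhds_zero_of_lt_one (by linarith) (by linarith)).const_mul _
  exact (measureReal_eq_zero_iff).1 (le_antisymm (ge_of_tendsto' hlim hle) measureReal_nonneg)

theorem measureReal_exists_stage_lt_le [IsProbabilityMeasure μ] {Y : ℕ → ℕ → Ω → α}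
    {G : ℕ → ℕ → Set α} (h : ∀ e, IndepOfPast (Y e) μ) (hY : ∀ e t, Measurable (Y e t))
    (hG : ∀ e j, MeasurableSet (G e j)) (hp₀ : 0 ≤ p)
    (hp : ∀ e t j, p ≤ μ.real (Y e t ⁻¹' G e j)) {height : ℕ → ℕ} (hH : ∀ e, height e ≤ H)
    (n t : ℕ) :
    μ.real {ω | ∃ e < n, stage (G e) (fun s => Y e s ω) t < height e} ≤
      n * (2 ^ H * (1 - p / 2) ^ t) := by
  have hunion : {ω | ∃ e < n, stage (G e) (fun s => Y e s ω) t < height e} =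
      ⋃ e ∈ Finset.range n, {ω | stage (G e) (fun s => Y e s ω) t < height e} := by
    ext ω
    simp
  calc _ ≤ ∑ e ∈ Finset.range n, μ.real {ω | stage (G e) (fun s => Y e s ω) t < height e} :=
        hunion ▸ measureReal_biUnion_finset_le _ _
    _ ≤ ∑ _e ∈ Finset.range n, 2 ^ H * (1 - p / 2) ^ t := Finset.sum_le_sum fun e _ =>
        (measureReal_mono fun ω hω => hω.trans_le (hH e)).trans
          ((h e).measureReal_stage_lt_le (hY e) (hG e) hp₀ (hp e) t H)
    _ = n * (2 ^ H * (1 - p / 2) ^ t) := by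
        rw [Finset.sum_const, Finset.card_range, nsmul_eq_mul]

end

/-! ### The samples -/

section

variable {d N W : ℕ} {S : Scene d N W} {Ω : Type*}
  {X : ℕ → ℕ → ℕ → Fin N → Ω → Pt d} {ν : Fin N → Measure (Pt d)}

/-- The joint position drawn at attempt `k.2.2` of iteration `k.2.1` of tree `k.1`. -/
def draw (X : ℕ → ℕ → ℕ → Fin N → Ω → Pt d) (k : ℕ × ℕ × ℕ) (ω : Ω) : Pos d N :=
  WithLp.toLp 2 (fun i => X k.1 k.2.1 k.2.2 i ω)

theorem measurableSet_box (c : Pos d N) (ε : ℝ) : MeasurableSet (box c ε) := by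
  have heq : box c ε = ⋂ i, {z | dist (z i) (c i) < ε} := by
    ext z
    simp [box]
  rw [heq]
  exact (isOpen_iInter_of_finite fun i => isOpen_lt (by fun_prop) continuous_const).measurableSet

theorem measurableSet_target {x₀ : Pos d N} {w a : ℕ → Pos d N} {r : ℝ} {M n : ℕ} (hn : 0 < n) :
    MeasurableSet (target x₀ w a r M n) := by
  rw [target_of_pos hn]
  exact measurableSet_box _ _

theorem draw_preimage_box (k : ℕ × ℕ × ℕ) (c : Pos d N) (ε : ℝ) :
    draw X k ⁻¹' box c ε = ⋂ i, X k.1 k.2.1 k.2.2 i ⁻¹' Metric.ball (c i) ε := by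
  ext ω
  simp [draw, box]

theorem measurable_draw [MeasurableSpace Ω] {k : ℕ × ℕ × ℕ}
    (h : ∀ i, Measurable (X k.1 k.2.1 k.2.2 i)) : Measurable (draw X k) :=
  (WithLp.measurable_toLp 2 _).comp (measurable_pi_iff.2 h)

variable [MeasurableSpace Ω] {μ : Measure Ω}

theorem Scene.UnbiasedSampling.indepOfPast_draw (hX : S.UnbiasedSampling μ X ν)
    {κ : ℕ → ℕ × ℕ × ℕ} (hκ : Function.Injective κ) :
    IndepOfPast (fun t => draw X (κ t)) μ := by
  intro t
  have hindep := indep_iSup_of_disjoint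
    (S := {j : ℕ × ℕ × ℕ × Fin N | (j.1, j.2.1, j.2.2.1) ∈ κ '' Set.Iio t})
    (T := {j | (j.1, j.2.1, j.2.2.1) ∈ ({κ t} : Set _)})
    (fun j => (hX.measurable _ _ _ _).comap_le) hX.indep.iIndep (by
      refine Set.disjoint_left.2 ?_
      rintro j ⟨s, hs, hsj⟩ hj
      exact hs.ne (hκ (hsj.trans hj)))
  have hle : ∀ {k : ℕ × ℕ × ℕ} {K : Set (ℕ × ℕ × ℕ)}, k ∈ K →
      MeasurableSpace.comap (draw X k) inferInstance ≤
        ⨆ j ∈ {j : ℕ × ℕ × ℕ × Fin N | (j.1, j.2.1, j.2.2.1) ∈ K},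
          MeasurableSpace.comap (X j.1 j.2.1 j.2.2.1 j.2.2.2) inferInstance := fun {k K} hk =>
    Measurable.comap_le <| @measurable_draw _ _ _ _ (_) _ fun i =>
      (comap_measurable _).mono (le_iSup₂_of_le
        (f := fun (j : ℕ × ℕ × ℕ × Fin N) (_ : (j.1, j.2.1, j.2.2.1) ∈ K) =>
          MeasurableSpace.comap (X j.1 j.2.1 j.2.2.1 j.2.2.2) inferInstance)
        (k.1, k.2.1, k.2.2, i) hk le_rfl) le_rfl
  exact indep_of_indep_of_le_left (indep_of_indep_of_le_right hindep (hle rfl))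
    (iSup₂_le fun s hs => hle ⟨s, hs, rfl⟩)

theorem Scene.UnbiasedSampling.measurable_draw (hX : S.UnbiasedSampling μ X ν)
    (k : ℕ × ℕ × ℕ) : Measurable (draw X k) :=
  TLRRT.measurable_draw fun _ => hX.measurable _ _ _ _

theorem Scene.UnbiasedSampling.exists_le_measureReal_ball [IsFiniteMeasure μ]
    (hX : S.UnbiasedSampling μ X ν) (i : Fin N) :
    ∃ c > 0, ∀ (x : Pt d) (ε : ℝ), 0 < ε → Metric.ball x ε ⊆ S.free → ∀ a n m,
      c * ε ^ d ≤ μ.real (X a n m i ⁻¹' Metric.ball x ε) := by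
  obtain ⟨c, hc₀, hc⟩ := hX.bounded_below i
  have hc₁ : min c 1 ≠ ⊤ := ne_top_of_le_ne_top ENNReal.one_ne_top (min_le_right _ _)
  refine ⟨(min c 1).toReal * volume.real (Metric.ball (0 : Pt d) 1),
    mul_pos (ENNReal.toReal_pos (lt_min hc₀.bot_lt one_pos).ne' hc₁)
      (ENNReal.toReal_pos (Metric.measure_ball_pos _ _ one_pos).ne' measure_ball_lt_top.ne),
    fun x ε hε hfree a n m => ?_⟩
  calc _ = (min c 1).toReal * volume.real (Metric.ball x ε) := by
        rw [measureReal_def volume (Metric.ball x ε), Measure.addHaar_ball_of_pos _ _ hε,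
          finrank_euclideanSpace_fin, ENNReal.toReal_mul, ENNReal.toReal_ofReal (by positivity),
          ← measureReal_def]
        ring
    _ ≤ μ.real (X a n m i ⁻¹' Metric.ball x ε) := by
        rw [measureReal_def, measureReal_def, ← ENNReal.toReal_mul,
          ← Measure.map_apply (hX.measurable a n m i) measurableSet_ball]
        refine ENNReal.toReal_mono (measure_ne_top _ _) ?_
        rw [hX.law]
        exact (mul_le_mul_left (min_le_left _ _) _).trans (hc _ measurableSet_ball hfree)

theorem Scene.UnbiasedSampling.measureReal_draw_box (hX : S.UnbiasedSampling μ X ν)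
    (k : ℕ × ℕ × ℕ) (c : Pos d N) (ε : ℝ) :
    μ.real (draw X k ⁻¹' box c ε) =
      ∏ i, μ.real (X k.1 k.2.1 k.2.2 i ⁻¹' Metric.ball (c i) ε) := by
  have hinj : Function.Injective fun i : Fin N => (k.1, k.2.1, k.2.2, i) := fun i j hij => by
    simpa using hij
  simp only [measureReal_def]
  rw [draw_preimage_box, (hX.indep.precomp hinj).meas_iInter fun i => ⟨_, measurableSet_ball, rfl⟩,
    ENNReal.toReal_prod]

theorem Scene.UnbiasedSampling.exists_le_measureReal_box [IsFiniteMeasure μ]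
    (hX : S.UnbiasedSampling μ X ν) :
    ∃ c₀ > 0, ∀ (c : Pos d N) (ε : ℝ), 0 < ε → box c ε ⊆ S.freeN → ∀ k,
      c₀ * ε ^ (d * N) ≤ μ.real (draw X k ⁻¹' box c ε) := by
  choose κ hκ₀ hκ using hX.exists_le_measureReal_ball
  refine ⟨∏ i, κ i, Finset.prod_pos fun i _ => hκ₀ i, fun c ε hε hfree k => ?_⟩
  calc _ = ∏ i, κ i * ε ^ d := by
        rw [Finset.prod_mul_distrib, Finset.prod_const, Finset.card_univ, Fintype.card_fin, pow_mul]
    _ ≤ ∏ i, μ.real (X k.1 k.2.1 k.2.2 i ⁻¹' Metric.ball (c i) ε) :=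
        Finset.prod_le_prod (fun i _ => (mul_pos (hκ₀ i) (pow_pos hε d)).le) fun i _ =>
          hκ i _ _ hε (ball_subset_free_of_box hε hfree i) _ _ _
    _ = μ.real (draw X k ⁻¹' box c ε) := (hX.measureReal_draw_box k c ε).symm

theorem Scene.UnbiasedSampling.ae_draw_mem_freeN (hX : S.UnbiasedSampling μ X ν) :
    ∀ᵐ ω ∂μ, ∀ k, draw X k ω ∈ S.freeN :=
  ae_all_iff.2 fun k => ae_all_iff.2 fun i =>
    ae_of_ae_map (hX.measurable k.1 k.2.1 k.2.2 i).aemeasurable (p := (· ∈ S.free)) <| by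
      rw [hX.law]
      exact hX.carried i

theorem Scene.UnbiasedSampling.ae_exists_draw_mem_box [IsProbabilityMeasure μ]
    (hX : S.UnbiasedSampling μ X ν) {c : Pos d N} {ε : ℝ} (hε : 0 < ε) (hfree : box c ε ⊆ S.freeN)
    (a n : ℕ) : ∀ᵐ ω ∂μ, ∃ m, draw X (a, n, m) ω ∈ box c ε := by
  obtain ⟨c₀, hc₀, hbox⟩ := hX.exists_le_measureReal_box
  have hinj : Function.Injective fun m : ℕ => (a, n, m) := fun i j hij => by simpa using hij
  exact (hX.indepOfPast_draw hinj).ae_exists_mem (fun _ => hX.measurable_draw _)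
    (measurableSet_box c ε) (mul_pos hc₀ (pow_pos hε _)) fun m => hbox c ε hε hfree (a, n, m)

theorem exists_box_subset_ball (hN : 0 < N) {C : Set (Pos d N)} (hC : Dense C) (x : Pos d N)
    {ρ : ℝ} (hρ : 0 < ρ) :
    ∃ c ∈ C, ∃ k : ℕ, box c (1 / (k + 1 : ℝ) / (2 * N)) ⊆ Metric.ball x ρ := by
  obtain ⟨c, hcC, hc⟩ := hC.exists_dist_lt x (half_pos hρ)
  obtain ⟨k, hk⟩ := exists_nat_one_div_lt (half_pos hρ)
  refine ⟨c, hcC, k, (box_subset_ball hN c (by positivity)).trans (Metric.ball_subset_ball' ?_)⟩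
  rw [dist_comm]
  linarith

theorem Scene.UnbiasedSampling.ae_exists_draw_near [IsProbabilityMeasure μ]
    (hX : S.UnbiasedSampling μ X ν) (hN : 0 < N) (hfree : S.SolidFree) {η : ℝ} (hη : 0 < η) :
    ∀ᵐ ω ∂μ, ∀ a n, ∀ x ∈ S.freeN, ∃ m, dist x (draw X (a, n, m) ω) ≤ η ∧
      draw X (a, n, m) ω ∈ S.freeN := by
  obtain ⟨C, hCc, hCd⟩ := TopologicalSpace.exists_countable_dense (Pos d N)
  have hhit : ∀ᵐ ω ∂μ, ∀ a n : ℕ, ∀ c ∈ C, ∀ k : ℕ, box c (1 / (k + 1 : ℝ) / (2 * N)) ⊆ S.freeN →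
      ∃ m, draw X (a, n, m) ω ∈ box c (1 / (k + 1 : ℝ) / (2 * N)) := by
    have : (0 : ℝ) < N := by exact_mod_cast hN
    simp only [ae_all_iff, ae_ball_iff hCc]
    intro a n c _ k hbox
    exact hX.ae_exists_draw_mem_box (by positivity) hbox a n
  filter_upwards [hhit, hX.ae_draw_mem_freeN] with ω hω hωfree a n x hx
  obtain ⟨v, ρ, hρ, hv⟩ := hfree.exists_ball hx hη
  obtain ⟨c, hc, k, hbox⟩ := exists_box_subset_ball hN hCd v hρ
  obtain ⟨m, hm⟩ := hω a n c hc k ((hbox.trans hv).trans Set.inter_subset_left)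
  exact ⟨m, (Metric.mem_ball'.1 (hv (hbox hm)).2).le, hωfree _⟩

end

section

variable {d N W : ℕ} {Q : Type*} [Fintype Q] {S : Scene d N W} {B : NBA Q (AP N W)}
  {A : Params d N}

theorem Scene.exists_tlRRT_eq_some_of_stage {φ : LTL (AP N W)} (hA : A.Valid)
    (hB : ∀ σ, B.Accepts σ ↔ φ.Sat σ) (h₀ : S.x₀ ∈ S.freeN) {s : ℕ → ℕ → ℕ → Pos d N}
    (hs : ∀ a n, ∀ x ∈ S.freeN, ∃ m, dist x (s a n m) ≤ A.η ∧ s a n m ∈ S.freeN)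
    {n nPre nSuf : ℕ} (hnPre : n ≤ nPre) (hnSuf : n ≤ nSuf) {h : ℝ} (hη : h ≤ A.η)
    (hradius : ∀ k : ℕ, 2 ≤ k → k ≤ n →
      h ≤ A.γ * (Real.log k / k) ^ (1 / ((d * N : ℕ) + 1 : ℝ)))
    {U : ℕ → Set (Pos d N)} {b : ℕ → Q} (hU₀ : S.x₀ ∈ U 0) (hb₀ : b 0 = B.init)
    (hU : ∀ j, ∀ x ∈ U j, ∀ y ∈ U (j + 1), S.Step B (x, b j) (y, b (j + 1)) ∧ dist x y ≤ h)
    {n₁ H : ℕ} (hacc : b n₁ ∈ B.accept) (hUcycle : U (n₁ + H + 1) = U n₁)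
    (hbcycle : b (n₁ + H + 1) = b n₁)
    (hpre : n₁ ≤ stage (fun j => U (j + 1)) (fun t => s 0 t 0) n)
    (hsuf : ∀ e ≤ 1 + Fintype.card Q * n,
      H ≤ stage (fun j => U (n₁ + (j + 1))) (fun t => s (e + 1) t 0) n) :
    ∃ τ, S.tlRRT B A s nPre nSuf = some τ ∧ S.Feasible τ ∧ φ.Sat (S.trace τ) := by
  obtain ⟨T, hT⟩ := Scene.exists_constructTree_eq_some (B := B) (r := (S.x₀, B.init)) hA h₀
    (hs 0) n
  obtain ⟨z, hz, hzT⟩ := Scene.exists_mem_of_le_stage hA hη hradius hU₀ hb₀.symm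
    (fun j _ => hU j) hT hpre
  refine Scene.exists_tlRRT_eq_some_of_constructTree hA hB h₀ hs hnPre hT hzT hacc
    fun e he T' hT' => ?_
  obtain ⟨T₁, hT₁⟩ := Scene.exists_constructTree_eq_some (B := B) (r := (z, b n₁)) hA
    ((isTree_of_constructTree h₀ hT).mem_freeN _ hzT) (hs (e + 1)) n
  obtain ⟨u, hu, huT₁⟩ := Scene.exists_mem_of_le_stage (U := fun j => U (n₁ + j))
    (b := fun j => b (n₁ + j)) hA hη hradius hz rfl (fun j _ => hU (n₁ + j)) hT₁ (hsuf e he)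
  have hstep := (hU (n₁ + H) u hu z (hUcycle ▸ hz)).1
  rw [hbcycle] at hstep
  exact ⟨_, (Scene.isPrefix_constructTree hnSuf hT₁ hT').subset huT₁, hstep⟩

end

/-! ### The number of iterations for a given step size -/

section

variable {D : ℕ} {C γ c p : ℝ}

/-- A number of iterations for steps of order `1 / M` in dimension `D`: small enough for the
connection radius to remain above `1 / M`, and large enough to hit, with high probability, of order
`M` targets each of which has probability of order `1 / M ^ D`. -/
noncomputable def budget (c : ℝ) (D M : ℕ) : ℕ := ⌊c * (M : ℝ) ^ (D + 1) * Real.log M⌋₊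

theorem budget_le (hc : 0 ≤ c) (D M : ℕ) : budget c D M ≤ c * (M : ℝ) ^ (D + 1) * Real.log M :=
  Nat.floor_le (mul_nonneg (mul_nonneg hc (by positivity)) (Real.log_natCast_nonneg M))

theorem le_mul_rpow_of_pow_le {x l : ℝ} (hx : 0 ≤ x) (hγ : 0 < γ) (h : (x / γ) ^ (D + 1) ≤ l) :
    x ≤ γ * l ^ (1 / ((D : ℝ) + 1)) := by
  have hx' : 0 ≤ x / γ := div_nonneg hx hγ.le
  rw [← div_le_iff₀' hγ]
  calc x / γ = ((x / γ) ^ (D + 1)) ^ (1 / ((D : ℝ) + 1)) := by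
        rw [one_div]
        exact_mod_cast (Real.pow_rpow_inv_natCast hx' D.succ_ne_zero).symm
    _ ≤ l ^ (1 / ((D : ℝ) + 1)) := Real.rpow_le_rpow (by positivity) h (by positivity)

theorem mul_le_log_mul_pow {a : ℝ} {M k : ℕ} (hD : 0 < D) (ha : 0 ≤ a) (hc : 0 ≤ c)
    (hca : c * a ≤ 1) (hM : a ≤ M * Real.log 2) (hk : 2 ≤ k) (hkM : k ≤ budget c D M) :
    a * k ≤ Real.log k * (M : ℝ) ^ (D + 1) := by
  rcases M.eq_zero_or_pos with rfl | hM₀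
  · simp [budget] at hkM
    omega
  have hM₁ : (1 : ℝ) ≤ M := by exact_mod_cast hM₀
  rcases le_total k M with h | h
  · have hlog : Real.log 2 ≤ Real.log k := Real.log_le_log two_pos (by exact_mod_cast hk)
    have hkM' : (k : ℝ) ≤ M := by exact_mod_cast h
    calc a * k ≤ M * Real.log 2 * M ^ D := by
          gcongr
          exact hkM'.trans (le_self_pow₀ hM₁ hD.ne')
      _ = Real.log 2 * M ^ (D + 1) := by ring
      _ ≤ Real.log k * M ^ (D + 1) := by gcongr
  · have hlog : Real.log M ≤ Real.log k := Real.log_le_log (by linarith) (by exact_mod_cast h)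
    have hk' : (k : ℝ) ≤ c * (M : ℝ) ^ (D + 1) * Real.log M :=
      (Nat.cast_le.2 hkM).trans (budget_le hc D M)
    have := Real.log_natCast_nonneg M
    calc a * k ≤ a * (c * (M : ℝ) ^ (D + 1) * Real.log M) := by gcongr
      _ = (c * a) * (Real.log M * (M : ℝ) ^ (D + 1)) := by ring
      _ ≤ 1 * (Real.log k * (M : ℝ) ^ (D + 1)) := by gcongr
      _ = Real.log k * (M : ℝ) ^ (D + 1) := one_mul _

theorem eventually_le_radius (hD : 0 < D) (hC : 0 ≤ C) (hγ : 0 < γ) (hc : 0 ≤ c)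
    (hcC : c * (C / γ) ^ (D + 1) ≤ 1) :
    ∀ᶠ M : ℕ in atTop, ∀ k : ℕ, 2 ≤ k → k ≤ budget c D M →
      C / M ≤ γ * (Real.log k / k) ^ (1 / ((D : ℝ) + 1)) := by
  have hlog2 : 0 < Real.log 2 := Real.log_pos one_lt_two
  filter_upwards [eventually_gt_atTop 0, tendsto_natCast_atTop_atTop.eventually_ge_atTop
    ((C / γ) ^ (D + 1) / Real.log 2)] with M hM hMC k hk hkM
  have : (0 : ℝ) < M := by exact_mod_cast hM
  have hk₀ : (0 : ℝ) < k := by exact_mod_cast (by omega : 0 < k)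
  refine le_mul_rpow_of_pow_le (by positivity) hγ ?_
  rw [div_right_comm, div_pow, div_le_div_iff₀ (by positivity) hk₀]
  exact mul_le_log_mul_pow hD (by positivity) hc hcC ((div_le_iff₀ hlog2).1 hMC) hk hkM

theorem two_pow_mul_pow_le_exp {x : ℝ} (hx : x ≤ 1) (H n : ℕ) :
    2 ^ H * (1 - x) ^ n ≤ Real.exp (H * Real.log 2 - n * x) := by
  calc 2 ^ H * (1 - x) ^ n ≤ Real.exp (Real.log 2) ^ H * Real.exp (-x) ^ n := by
        rw [Real.exp_log two_pos]
        gcongr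
        exact Real.one_sub_le_exp_neg x
    _ = Real.exp (H * Real.log 2 - n * x) := by
        rw [← Real.exp_nat_mul, ← Real.exp_nat_mul, ← Real.exp_add]
        ring_nf

theorem eventually_two_pow_mul_pow_budget_le (hD : 0 < D) (hc : 0 < c) (hp : 0 < p) (K : ℕ) :
    ∀ᶠ M : ℕ in atTop, 0 ≤ 1 - p / (M : ℝ) ^ D / 2 ∧
      2 ^ (2 * M * K) * (1 - p / (M : ℝ) ^ D / 2) ^ budget c D M ≤
        Real.exp (p / 2) * Real.exp (-(M : ℝ)) := by
  have hlog : Tendsto (fun M : ℕ => Real.log M) atTop atTop :=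
    Real.tendsto_log_atTop.comp tendsto_natCast_atTop_atTop
  filter_upwards [eventually_ge_atTop 1, tendsto_natCast_atTop_atTop.eventually_ge_atTop p,
    hlog.eventually_ge_atTop ((2 * K * Real.log 2 + 1) / (p * c / 2))] with M hM hMp hMlog
  have hM₁ : (1 : ℝ) ≤ M := by exact_mod_cast hM
  have hx : p / (M : ℝ) ^ D ≤ 1 :=
    div_le_one_of_le₀ (hMp.trans (le_self_pow₀ hM₁ hD.ne')) (by positivity)
  have hbudget : (c * (M : ℝ) ^ (D + 1) * Real.log M - 1) * (p / (M : ℝ) ^ D / 2) ≤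
      budget c D M * (p / (M : ℝ) ^ D / 2) :=
    mul_le_mul_of_nonneg_right (Nat.sub_one_lt_floor _).le (by positivity)
  have hcancel : (c * (M : ℝ) ^ (D + 1) * Real.log M - 1) * (p / (M : ℝ) ^ D / 2) =
      M * (Real.log M * (p * c / 2)) - p / (M : ℝ) ^ D / 2 := by
    field_simp
    ring
  have hgrowth : M * (2 * K * Real.log 2 + 1) ≤ M * (Real.log M * (p * c / 2)) :=
    mul_le_mul_of_nonneg_left ((div_le_iff₀ (by positivity)).1 hMlog) (by positivity)
  have hp' : p / (M : ℝ) ^ D ≤ p := div_le_self hp.le (one_le_pow₀ hM₁)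
  refine ⟨by linarith, (two_pow_mul_pow_le_exp (by linarith) _ _).trans ?_⟩
  rw [← Real.exp_add, Real.exp_le_exp]
  push_cast
  linarith

theorem budget_le_pow (hc : 0 ≤ c) (hc₁ : c ≤ 1) (D M : ℕ) :
    budget c D M ≤ (M : ℝ) ^ (D + 2) := by
  calc (budget c D M : ℝ) ≤ c * (M : ℝ) ^ (D + 1) * Real.log M := budget_le hc D M
    _ ≤ 1 * (M : ℝ) ^ (D + 1) * M := by
        gcongr
        exact Real.log_le_self M.cast_nonneg
    _ = (M : ℝ) ^ (D + 2) := by ring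

theorem tendsto_mul_two_pow_mul_pow_budget (hD : 0 < D) (hc : 0 < c) (hc₁ : c ≤ 1) (hp : 0 < p)
    (K q m : ℕ) :
    Tendsto (fun M : ℕ => ((q * budget c D M + m : ℕ) : ℝ) *
      (2 ^ (2 * M * K) * (1 - p / (M : ℝ) ^ D / 2) ^ budget c D M)) atTop (𝓝 0) := by
  have hlim : Tendsto (fun M : ℕ => ((q : ℝ) + m) * Real.exp (p / 2) *
      ((M : ℝ) ^ (D + 2) * Real.exp (-(M : ℝ)))) atTop (𝓝 0) := by
    rw [← mul_zero (((q : ℝ) + m) * Real.exp (p / 2))]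
    exact ((Real.tendsto_pow_mul_exp_neg_atTop_nhds_zero (D + 2)).comp
      tendsto_natCast_atTop_atTop).const_mul _
  have hexp := eventually_two_pow_mul_pow_budget_le hD hc hp K
  refine squeeze_zero' (hexp.mono fun M hM => ?_) ?_ hlim
  · have := hM.1
    positivity
  filter_upwards [hexp, eventually_ge_atTop 1] with M hM hM₁
  have hcount : ((q * budget c D M + m : ℕ) : ℝ) ≤ (q + m) * (M : ℝ) ^ (D + 2) := by
    have hpow : (1 : ℝ) ≤ (M : ℝ) ^ (D + 2) := one_le_pow₀ (by exact_mod_cast hM₁)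
    push_cast
    rw [add_mul]
    gcongr
    exacts [budget_le_pow hc.le hc₁ D M, le_mul_of_one_le_right m.cast_nonneg hpow]
  have hM₀ := hM.1
  calc _ ≤ (q + m) * (M : ℝ) ^ (D + 2) * (Real.exp (p / 2) * Real.exp (-(M : ℝ))) :=
        mul_le_mul hcount hM.2 (by positivity) (by positivity)
    _ = _ := by ring

theorem exists_rate (hD : 0 < D) (hC : 0 ≤ C) (hγ : 0 < γ) (hp : 0 < p) (K q m : ℕ) :
    ∃ n : ℕ → ℕ, (∀ᶠ M : ℕ in atTop, ∀ k : ℕ, 2 ≤ k → k ≤ n M →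
        C / M ≤ γ * (Real.log k / k) ^ (1 / ((D : ℝ) + 1))) ∧
      Tendsto (fun M : ℕ => ((q * n M + m : ℕ) : ℝ) *
        (2 ^ (2 * M * K) * (1 - p / (M : ℝ) ^ D / 2) ^ n M)) atTop (𝓝 0) := by
  set c := ((C / γ) ^ (D + 1) + 1)⁻¹ with hc
  have ha : 0 ≤ (C / γ) ^ (D + 1) := by positivity
  have hcC : c * (C / γ) ^ (D + 1) ≤ 1 := by
    rw [hc, inv_mul_eq_div]
    exact div_le_one_of_le₀ (by linarith) (by linarith)
  exact ⟨budget c D, eventually_le_radius hD hC hγ (by positivity) hcC,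
    tendsto_mul_two_pow_mul_pow_budget hD (by positivity) (inv_le_one_of_one_le₀ (by linarith)) hp
      K q m⟩

end

/-! ### The probability of success -/

section

variable {d N W : ℕ} {Q : Type*} [Fintype Q] {S : Scene d N W} {B : NBA Q (AP N W)}
  {A : Params d N} {φ : LTL (AP N W)} {L : ℕ → Set (AP N W)} {w a : ℕ → Pos d N} {r : ℝ}
  {Ω : Type*} [MeasurableSpace Ω] {μ : Measure Ω}
  {X : ℕ → ℕ → ℕ → Fin N → Ω → Pt d} {ν : Fin N → Measure (Pt d)}

theorem Corridor.exists_le_measureReal_target [IsFiniteMeasure μ] (h : Corridor S L w a r)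
    (hN : 0 < N) (hX : S.UnbiasedSampling μ X ν) :
    ∃ p > 0, ∀ M : ℕ, 0 < M → ∀ n > 0, ∀ k,
      p / (M : ℝ) ^ (d * N) ≤ μ.real (draw X k ⁻¹' target S.x₀ w a r M n) := by
  obtain ⟨c₀, hc₀, hbox⟩ := hX.exists_le_measureReal_box
  have hr := h.pos
  have : (0 : ℝ) < N := by exact_mod_cast hN
  refine ⟨c₀ * (r / (2 * N)) ^ (d * N), by positivity, fun M hM n hn k => ?_⟩
  have : (0 : ℝ) < M := by exact_mod_cast hM
  have hfree := h.target_subset_freeN hN hM hn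
  rw [target_of_pos hn] at hfree ⊢
  calc _ = c₀ * (r / M / (2 * N)) ^ (d * N) := by rw [mul_div_assoc, ← div_pow, div_right_comm]
    _ ≤ _ := hbox _ _ (by positivity) hfree k

variable [IsProbabilityMeasure μ]

-- Tree `0` grows the prefix and tree `e + 1` the suffix for the `e`-th accepting node, and the
-- prefix tree has at most `1 + card Q * n` nodes after `n` iterations.
theorem Corridor.measureReal_not_findsPlan_le (h : Corridor S L w a r) (hN : 0 < N)
    (hA : A.Valid) (hB : ∀ σ, B.Accepts σ ↔ φ.Sat σ) (hX : S.UnbiasedSampling μ X ν)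
    (hfree : S.SolidFree) {D : ℝ}
    (hD : ∀ k, dist (a k) (w k) ≤ D ∧ dist (entry S.x₀ a k) (w k) ≤ D) {M : ℕ} (hM : 2 ≤ M)
    {p : ℝ} (hp₀ : 0 ≤ p)
    (hp : ∀ j > 0, ∀ k, p ≤ μ.real (draw X k ⁻¹' target S.x₀ w a r M j)) {n : ℕ}
    (hη : 2 * D / M + 2 * (r / M) ≤ A.η)
    (hradius : ∀ k : ℕ, 2 ≤ k → k ≤ n →
      2 * D / M + 2 * (r / M) ≤ A.γ * (Real.log k / k) ^ (1 / ((d * N : ℕ) + 1 : ℝ)))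
    {b : ℕ → Q} (hb₀ : b 0 = B.init) (hb : ∀ n, B.trans (b n) (L (n / (2 * M))) (b (n + 1)))
    {n₁ n₂ H : ℕ} (hn₁ : n₁ ≤ H) (hn₂ : n₂ ≤ H) (hacc : b n₁ ∈ B.accept)
    (htarget : target S.x₀ w a r M (n₁ + n₂ + 1) = target S.x₀ w a r M n₁)
    (hcycle : b (n₁ + n₂ + 1) = b n₁) :
    μ.real {ω | ¬∀ i ≥ (n, n), S.FindsPlan φ B A X ω i} ≤
      ((Fintype.card Q * n + 3 : ℕ) : ℝ) * (2 ^ H * (1 - p / 2) ^ n) := by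
  let start : ℕ → ℕ := fun e => if e = 0 then 0 else n₁
  let height : ℕ → ℕ := fun e => if e = 0 then n₁ else n₂
  have hinj : ∀ e : ℕ, Function.Injective fun t : ℕ => (e, t, 0) := fun e i j hij => by
    simpa using hij
  have hmiss := measureReal_exists_stage_lt_le (μ := μ) (Y := fun e t => draw X (e, t, 0))
    (G := fun e j => target S.x₀ w a r M (start e + (j + 1))) (height := height) (H := H)
    (fun e => hX.indepOfPast_draw (hinj e)) (fun e t => hX.measurable_draw _)
    (fun e j => measurableSet_target (Nat.succ_pos _)) hp₀
    (fun e t j => hp _ (Nat.succ_pos _) _)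
    (fun e => by dsimp only [height]; split_ifs <;> assumption) (Fintype.card Q * n + 3) n
  refine (ENNReal.toReal_mono (measure_ne_top _ _) (measure_mono_ae ?_)).trans hmiss
  filter_upwards [hX.ae_exists_draw_near hN hfree hA.η_pos] with ω hω hfail
  by_contra hhit
  have hstage : ∀ e < Fintype.card Q * n + 3, height e ≤
      stage (fun j => target S.x₀ w a r M (start e + (j + 1))) (fun t => draw X (e, t, 0) ω) n :=
    fun e he => not_lt.1 fun hlt => hhit ⟨e, he, hlt⟩
  refine hfail fun i hi => Scene.exists_tlRRT_eq_some_of_stage hA hB h.init_mem_freeN hω hi.1 hi.2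
    (n := n) hη hradius (U := target S.x₀ w a r M) (by simp [target]) hb₀
    (fun j x hx y hy => h.step_target hN hD hM hb j hx hy) hacc htarget hcycle ?_ fun e he => ?_
  · simpa [start, height] using hstage 0 (by omega)
  · simpa [start, height] using hstage (e + 1) (by omega)

theorem Corridor.exists_measureReal_not_findsPlan_le (h : Corridor S L w a r) (hd : 0 < d)
    (hN : 0 < N) (hA : A.Valid) (hB : ∀ σ, B.Accepts σ ↔ φ.Sat σ) (hL : φ.Sat L)
    (hX : S.UnbiasedSampling μ X ν) (hfree : S.SolidFree) {ε : ℝ} (hε : 0 < ε) :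
    ∃ n : ℕ, μ.real {ω | ¬∀ i ≥ (n, n), S.FindsPlan φ B A X ω i} ≤ ε := by
  obtain ⟨D, hD⟩ := h.exists_bound
  have hD₀ : 0 ≤ D := dist_nonneg.trans (hD 0).1
  have hr := h.pos
  obtain ⟨p, hp₀, hp⟩ := h.exists_le_measureReal_target hN hX
  have hkey : (Set.range fun k => (w k, a k, entry S.x₀ a k)).Finite :=
    (h.finite_waypoints.prod (h.finite_apexes.prod h.finite_entries)).subset <| by
      rintro _ ⟨k, rfl⟩
      exact ⟨⟨k, rfl⟩, ⟨k, rfl⟩, ⟨k, rfl⟩⟩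
  obtain ⟨k₁, k₂, hk₁, hk, heq, hinf⟩ := NBA.exists_uniform_blocks hB hL hkey
  simp only [Prod.mk.injEq] at heq
  obtain ⟨n, hradius, hrate⟩ := exists_rate (D := d * N) (Nat.mul_pos hd hN)
    (C := 2 * D + 2 * r) (by positivity) hA.γ_pos hp₀ (k₂ + 1) (Fintype.card Q) 3
  have hstep : Tendsto (fun M : ℕ => (2 * D + 2 * r) / M) atTop (𝓝 0) :=
    tendsto_const_div_atTop_nhds_zero_nat _
  obtain ⟨M, ⟨b, i, hi, hb₀, hb, hacc, hcycle⟩, hM, hη, hradius, hsmall⟩ :=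
    ((Nat.frequently_atTop_iff_infinite.2 hinf).and_eventually ((eventually_ge_atTop 2).and
      ((hstep.eventually (ge_mem_nhds hA.η_pos)).and
        (hradius.and (hrate.eventually (ge_mem_nhds hε)))))).exists
  have hC : 2 * D / M + 2 * (r / M) = (2 * D + 2 * r) / M := by ring
  have hM₀ : 0 < M := by omega
  have hblock₁ : 2 * M * k₁ + 2 * M ≤ 2 * M * k₂ := by
    rw [← Nat.mul_succ]
    exact Nat.mul_le_mul_left _ hk
  have hblock₂ : 2 * M * (k₂ + 1) = 2 * M * k₂ + 2 * M := Nat.mul_succ _ _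
  obtain ⟨n₂, hn₂⟩ : ∃ n₂, 2 * M * k₁ + i + n₂ + 1 = 2 * M * k₂ + i :=
    ⟨2 * M * k₂ - 2 * M * k₁ - 1, by omega⟩
  refine ⟨n M, (h.measureReal_not_findsPlan_le (n₁ := 2 * M * k₁ + i) (n₂ := n₂)
    (H := 2 * M * (k₂ + 1)) hN hA hB hX hfree hD hM (by positivity) (hp M hM₀) (by rwa [hC])
    (by rwa [hC]) hb₀ hb (by omega) (by omega) hacc ?_ (by rwa [hn₂])).trans hsmall⟩
  rw [hn₂]
  exact (target_congr hk₁ (Nat.zero_lt_of_lt hk) hi heq.1 heq.2.1 heq.2.2).symm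

end

section

variable {ι Ω : Type*} [Preorder ι] [MeasurableSpace Ω] {μ : Measure Ω} {P : Ω → ι → Prop}

theorem ae_eventually_of_measureReal_le [IsFiniteMeasure μ]
    (h : ∀ ε > 0, ∃ n, μ.real {ω | ¬∀ i ≥ n, P ω i} ≤ ε) : ∀ᵐ ω ∂μ, ∀ᶠ i in atTop, P ω i := by
  refine (measureReal_eq_zero_iff).1 (le_antisymm (le_of_forall_gt_imp_ge_of_dense
    fun ε hε => ?_) measureReal_nonneg)
  obtain ⟨n, hn⟩ := h ε hε
  have hsubset : {ω | ¬∀ᶠ i in atTop, P ω i} ⊆ {ω | ¬∀ i ≥ n, P ω i} :=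
    fun ω hω hall => hω ((eventually_ge_atTop n).mono hall)
  exact (measureReal_mono hsubset).trans hn

theorem tendsto_measure_of_measureReal_le [IsProbabilityMeasure μ]
    (h : ∀ ε > 0, ∃ n, μ.real {ω | ¬∀ i ≥ n, P ω i} ≤ ε) :
    Tendsto (fun i => μ {ω | P ω i}) atTop (𝓝 1) := by
  rw [← ENNReal.tendsto_toReal_iff (fun _ => measure_ne_top _ _) ENNReal.one_ne_top,
    ENNReal.toReal_one]
  refine tendsto_order.2 ⟨fun c hc => ?_, fun c hc => .of_forall fun i =>
    measureReal_le_one.trans_lt hc⟩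
  obtain ⟨n, hn⟩ := h ((1 - c) / 2) (by linarith)
  filter_upwards [eventually_ge_atTop n] with i hi
  have hsubset : {ω | P ω i}ᶜ ⊆ {ω | ¬∀ i ≥ n, P ω i} := fun ω hω hall => hω (hall i hi)
  have hfail : μ.real {ω | P ω i}ᶜ ≤ (1 - c) / 2 := (measureReal_mono hsubset).trans hn
  have hcover : (1 : ℝ) ≤ μ.real {ω | P ω i} + μ.real {ω | P ω i}ᶜ := by
    rw [← probReal_univ (μ := μ), ← Set.union_compl_self {ω | P ω i}]
    exact measureReal_union_le _ _
  exact lt_of_lt_of_le (by linarith) (sub_le_iff_le_add.2 hcover)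

end

end TLRRT

theorem theorem1_general {d N W : ℕ} (hd : 0 < d) (hN : 0 < N)
    {Q : Type*} [Fintype Q] (S : TLRRT.Scene d N W)
    (φ : TLRRT.LTL (TLRRT.AP N W)) (B : TLRRT.NBA Q (TLRRT.AP N W))
    (hB : ∀ σ, B.Accepts σ ↔ φ.Sat σ)
    (A : TLRRT.Params d N) (hA : A.Valid)
    {Ω : Type*} [MeasurableSpace Ω] (μ : Measure Ω) [IsProbabilityMeasure μ]
    (X : ℕ → ℕ → ℕ → Fin N → Ω → TLRRT.Pt d) (ν : Fin N → Measure (TLRRT.Pt d))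
    (hX : S.UnbiasedSampling μ X ν) (hfree : S.SolidFree)
    (hplan : ∃ τ, S.Feasible τ ∧ φ.Sat (S.trace τ) ∧ S.ConvergenceSpace B τ) :
    (∀ᵐ ω ∂μ, ∀ᶠ n : ℕ × ℕ in atTop, S.FindsPlan φ B A X ω n) ∧
    Tendsto (fun n : ℕ × ℕ => μ {ω | S.FindsPlan φ B A X ω n}) atTop (𝓝 1) := by
  obtain ⟨τ, hτ, hsat, hC⟩ := hplan
  obtain ⟨w, a, r, hcorridor⟩ := TLRRT.Scene.exists_corridor hfree hτ hC
  have hfail : ∀ ε > 0, ∃ n : ℕ × ℕ, μ.real {ω | ¬∀ i ≥ n, S.FindsPlan φ B A X ω i} ≤ ε :=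
    fun ε hε =>
      have ⟨n, hn⟩ := hcorridor.exists_measureReal_not_findsPlan_le hd hN hA hB hsat hX hfree hε
      ⟨(n, n), hn⟩
  exact ⟨TLRRT.ae_eventually_of_measureReal_le hfail,
    TLRRT.tendsto_measure_of_measureReal_le hfail⟩

theorem theorem1 {d N W : ℕ} (hd : d = 2 ∨ d = 3) (hN : 0 < N)
    {Q : Type*} [Fintype Q] (S : TLRRT.Scene d N W)
    (φ : TLRRT.LTL (TLRRT.AP N W)) (B : TLRRT.NBA Q (TLRRT.AP N W))
    (hB : ∀ σ, B.Accepts σ ↔ φ.Sat σ)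
    (A : TLRRT.Params d N) (hA : A.Valid)
    {Ω : Type*} [MeasurableSpace Ω] (μ : Measure Ω) [IsProbabilityMeasure μ]
    (X : ℕ → ℕ → ℕ → Fin N → Ω → TLRRT.Pt d) (ν : Fin N → Measure (TLRRT.Pt d))
    (hX : S.UnbiasedSampling μ X ν)
    (hfree : S.SolidFree) (hregions : S.NonpointRegions)
    (hplan : ∃ τ, S.Feasible τ ∧ φ.Sat (S.trace τ) ∧ S.ConvergenceSpace B τ) :
    (∀ᵐ ω ∂μ, ∀ᶠ n : ℕ × ℕ in atTop, S.FindsPlan φ B A X ω n) ∧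
    Tendsto (fun n : ℕ × ℕ => μ {ω | S.FindsPlan φ B A X ω n}) atTop (𝓝 1) :=
  theorem1_general (by omega) hN S φ B hB A hA μ X ν hX hfree hplan
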